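/- Let $\gamma^0=\begin{pmatrix} I_2&0\\0&-I_2\end{pmatrix}$, $\gamma^j=\begin{pmatrix}0&\sigma^j\\-\sigma^j&0\end{pmatrix}$ ($j=1,2,3$, with $\sigma^j$ the Pauli matrices), $\beta=\gamma^0$, $\alpha^j=\gamma^0\gamma^j$, $\langle\xi\rangle=(1+|\xi|^2)^{1/2}$, and let $V_0(x)=\frac{1}{4\pi|x|}$ be the Coulomb potential on $\mathbb R^3$. Let $\Pi_\pm$ be the Fourier multipliers on $L^2(\mathbb R^3;\mathbb C^4)$ with symbols $\Pi_\pm(\xi)=\frac12\big(I_4\pm\frac{\sum_j\alpha^j\xi_j+\beta}{\langle\xi\rangle}\big)$. For $\mathbb C^4$-valued functions $u,v$ on $\mathbb R^3$ put $\mathcal I(u,v)=\int_{\mathbb R^3}[V_0*(u^\dagger v)](x)\,(u^\dagger v)(x)\,dx$, and for time-dependent functions let $\mathcal I(u,v)(t)=\mathcal I(u(t),v(t))$. Let $\|f\|_{B^{5/2}_{1,1}}=\sum_{\lambda\in\{1,2,4,\dots\}}\lambda^{5/2}\|P_\lambda f\|_{L^1}$ be the inhomogeneous Besov norm, where the $P_\lambda$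 are the usual Littlewood–Paley projections. Let $\psi:\mathbb R\times\mathbb R^3\to\mathbb C^4$ be a $C^\infty$ function with $\psi(t)\in L^2$ for all $t$ that solves $$-i\gamma^0\partial_t\psi-i\sum_{j=1}^3\gamma^j\partial_j\psi+\psi=\big(V_0*(\psi^\dagger\gamma^0\psi)\big)\psi .$$ Let $\psi_\infty^\ell(t)=e^{-it\langle\nabla\rangle}\Pi_+\varphi+e^{it\langle\nabla\rangle}\Pi_-\varphi$ be a free solution with $\varphi\in L^2(\mathbb R^3;\mathbb C^4)$ and $\Pi_\pm\varphi\in B^{5/2}_{1,1}$. Suppose that $\psi$ scatters in $L^2$ to $\psi_\infty^\ell$, that is, $\|\psi(t)-\psi_\infty^\ell(t)\|_{L^2}\to0$ as $t\to+\infty$. Suppose also that there are $0<c<1$ and $t_*>0$ such that $$|\mathcal I(\psi_\infty^\ell,\beta\psi_\infty^\ell)(t)|\ \ge\ c\,\mathcal I(\psi_\infty^\ell,\psi_\infty^\ell)(t)\qquad\text{for all } t>t_* .$$ Then $\psi(t)=0$ and $\psi_\infty^\ell(t)=0$ in $L^2(\mathbb R^3;\mathbb C^4)$ for every $t\in\mathbb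 R$. -/

import Mathlib

open MeasureTheory Filter Topology FourierTransform
open scoped ContDiff ENNReal Convolution BoundedContinuousFunction

noncomputable section

namespace DiracHartree

/-! ### Space, spinors and the Dirac matrices -/

/-- The physical space `ℝ³`. -/
abbrev Space := EuclideanSpace ℝ (Fin 3)

/-- The spinor space `ℂ⁴`. -/
abbrev Spinor := EuclideanSpace ℂ (Fin 4)

/-- `L²(ℝ³; ℂ⁴)`. -/
abbrev L2 := Lp (α := Space) Spinor 2 volume

/-- The Dirac gamma matrices `γ⁰, γ¹, γ², γ³` in the standard representation:
`γ⁰ = diag(I, -I)` and `γʲ` has the off-diagonal blocks `σʲ`, `-σʲ` (Pauli matrices). -/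
def gamma : Fin 4 → Matrix (Fin 4) (Fin 4) ℂ :=
  ![!![1, 0, 0, 0; 0, 1, 0, 0; 0, 0, -1, 0; 0, 0, 0, -1],
    !![0, 0, 0, 1; 0, 0, 1, 0; 0, -1, 0, 0; -1, 0, 0, 0],
    !![0, 0, 0, -Complex.I; 0, 0, Complex.I, 0; 0, Complex.I, 0, 0; -Complex.I, 0, 0, 0],
    !![0, 0, 1, 0; 0, 0, 0, -1; -1, 0, 0, 0; 0, 1, 0, 0]]

/-- The action of a `4 × 4` matrix on spinors. -/
def act (A : Matrix (Fin 4) (Fin 4) ℂ) : Spinor →L[ℂ] Spinor :=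
  Matrix.toEuclideanCLM (𝕜 := ℂ) A

/-- `β = γ⁰`. -/
def beta : Spinor →L[ℂ] Spinor := act (gamma 0)

/-- `αʲ = γ⁰ γʲ`, `j = 1, 2, 3` (indexed by `Fin 3`). -/
def alpha (j : Fin 3) : Spinor →L[ℂ] Spinor := act (gamma 0 * gamma j.succ)

/-! ### The potential and the nonlinear equation -/

/-- The Yukawa potential `V_b(x) = (4π)⁻¹ e^{-b|x|} / |x|`; for `b = 0` the Coulomb potential. -/
def potential (b : ℝ) (x : Space) : ℝ :=
  1 / (4 * Real.pi) * (Real.exp (-b * ‖x‖) / ‖x‖)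

/-- `V_b * f` for a complex-valued `f`. -/
def potentialConv (b : ℝ) (f : Space → ℂ) : Space → ℂ :=
  potential b ⋆[ContinuousLinearMap.lsmul ℝ ℝ, volume] f

/-- `ψ : ℝ × ℝ³ → ℂ⁴` is a smooth (finite charge, global) solution of
`-i γ^μ ∂_μ ψ + ψ = (V_b * (ψ† γ⁰ ψ)) ψ`.
Here `inner ℂ u v = u† v`. -/
structure IsSmoothSolution (b : ℝ) (ψ : ℝ → Space → Spinor) : Prop where
  smooth : ContDiff ℝ ∞ (fun p : ℝ × Space => ψ p.1 p.2)
  memLp : ∀ t, MemLp (ψ t) 2 volume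
  equation : ∀ t x,
    (-Complex.I) • (act (gamma 0) (deriv (fun s => ψ s x) t)
        + ∑ j : Fin 3,
            act (gamma j.succ) (fderiv ℝ (ψ t) x (EuclideanSpace.single j (1 : ℝ))))
      + ψ t x
    = potentialConv b (fun y => inner ℂ (ψ t y) (act (gamma 0) (ψ t y))) x • ψ t x

/-- `∫ [V₀ * (u† v)](x) (u† v)(x) dx`. -/
def coulombI (u v : Space → Spinor) : ℂ :=
  ∫ x, potentialConv 0 (fun y => inner ℂ (u y) (v y)) x * inner ℂ (u x) (v x)

/-! ### Fourier multipliers on `L²` -/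

/-- The Japanese bracket `⟨ξ⟩ = (1 + |ξ|²)^{1/2}`. -/
def bracket (ξ : Space) : ℝ := Real.sqrt (1 + ‖ξ‖ ^ 2)

lemma bracket_pos (ξ : Space) : 0 < bracket ξ := by unfold bracket; positivity

lemma one_le_bracket (ξ : Space) : 1 ≤ bracket ξ :=
  Real.one_le_sqrt.mpr (by nlinarith [sq_nonneg ‖ξ‖])

lemma norm_le_bracket (ξ : Space) : ‖ξ‖ ≤ bracket ξ :=
  Real.le_sqrt_of_sq_le (by linarith)

lemma continuous_bracket : Continuous bracket := by unfold bracket; fun_prop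

lemma multiplier_memLp (m : Space →ᵇ (Spinor →L[ℂ] Spinor)) (g : L2) :
    MemLp (fun η : Space => m ((2 * Real.pi) • η) (g η)) 2 volume := by
  refine MemLp.of_le_mul (c := ‖m‖) (Lp.memLp g) ?_ ?_
  · have h1 : AEStronglyMeasurable (fun η : Space => m ((2 * Real.pi) • η)) volume :=
      (m.continuous.comp (continuous_const_smul _)).aestronglyMeasurable
    exact (ContinuousLinearMap.apply ℂ Spinor).flip.aestronglyMeasurable_comp₂ h1
      (Lp.aestronglyMeasurable g)
  · refine Eventually.of_forall fun η => ?_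
    exact (ContinuousLinearMap.le_opNorm _ _).trans
      (mul_le_mul_of_nonneg_right (m.norm_coe_le_norm _) (norm_nonneg _))

/-- The Fourier multiplier `m(-i∇)` on `L²(ℝ³; ℂ⁴)` with a bounded continuous matrix symbol `m(ξ)`,
in the convention where `-i∇` has the symbol `ξ`.  Mathlib's Fourier transform uses the character
`e^{-2πi x·η}`, i.e. `ξ = 2πη`. -/
def multiplier (m : Space →ᵇ (Spinor →L[ℂ] Spinor)) (f : L2) : L2 :=
  𝓕⁻ ((multiplier_memLp m (𝓕 f)).toLp : L2)

/-! ### The Dirac projections and the free evolution -/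

lemma continuous_projSymbol (s : ℤˣ) : Continuous fun ξ : Space =>
    (1 / 2 : ℂ) • ((1 : Spinor →L[ℂ] Spinor)
      + (((s : ℤ) : ℂ) * ((bracket ξ)⁻¹ : ℝ)) • (∑ j, ((ξ j : ℝ) : ℂ) • alpha j + beta)) := by
  have h : Continuous fun ξ => (bracket ξ)⁻¹ :=
    continuous_bracket.inv₀ fun ξ => (bracket_pos ξ).ne'
  fun_prop

lemma projSymbol_bound (s : ℤˣ) (ξ : Space) :
    ‖(1 / 2 : ℂ) • ((1 : Spinor →L[ℂ] Spinor)
      + (((s : ℤ) : ℂ) * ((bracket ξ)⁻¹ : ℝ)) • (∑ j, ((ξ j : ℝ) : ℂ) • alpha j + beta))‖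
    ≤ 1 + (∑ j, ‖alpha j‖ + ‖beta‖) := by
  have hb := bracket_pos ξ
  have hs : ‖((s : ℤ) : ℂ)‖ = 1 := by
    rcases Int.units_eq_one_or s with h | h <;> simp [h]
  have h1 : ‖∑ j, ((ξ j : ℝ) : ℂ) • alpha j + beta‖
      ≤ bracket ξ * (∑ j, ‖alpha j‖ + ‖beta‖) := by
    rw [mul_add, Finset.mul_sum]
    refine (norm_add_le _ _).trans (add_le_add ((norm_sum_le _ _).trans ?_) ?_)
    · refine Finset.sum_le_sum fun j _ => ?_
      rw [norm_smul]
      refine mul_le_mul_of_nonneg_right ?_ (norm_nonneg _)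
      rw [Complex.norm_real]
      exact (PiLp.norm_apply_le ξ j).trans (norm_le_bracket ξ)
    · exact le_mul_of_one_le_left (norm_nonneg _) (one_le_bracket ξ)
  have h2 : ‖(((s : ℤ) : ℂ) * ((bracket ξ)⁻¹ : ℝ)) • (∑ j, ((ξ j : ℝ) : ℂ) • alpha j + beta)‖
      ≤ ∑ j, ‖alpha j‖ + ‖beta‖ := by
    rw [norm_smul, norm_mul, hs, one_mul, Complex.norm_real, Real.norm_of_nonneg (by positivity)]
    calc (bracket ξ)⁻¹ * _ ≤ (bracket ξ)⁻¹ * (bracket ξ * (∑ j, ‖alpha j‖ + ‖beta‖)) := by gcongr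
      _ = _ := by field_simp
  have h3 : ‖(1 : Spinor →L[ℂ] Spinor)‖ ≤ 1 := ContinuousLinearMap.norm_id_le
  rw [norm_smul]
  have h4 := norm_add_le (1 : Spinor →L[ℂ] Spinor)
    ((((s : ℤ) : ℂ) * ((bracket ξ)⁻¹ : ℝ)) • (∑ j, ((ξ j : ℝ) : ℂ) • alpha j + beta))
  have h5 : ‖(1 / 2 : ℂ)‖ ≤ 1 := by norm_num
  have h6 := mul_le_mul_of_nonneg_right h5 (norm_nonneg ((1 : Spinor →L[ℂ] Spinor)
    + (((s : ℤ) : ℂ) * ((bracket ξ)⁻¹ : ℝ)) • (∑ j, ((ξ j : ℝ) : ℂ) • alpha j + beta)))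
  linarith

/-- The symbol `Π_s(ξ) = (1/2) (I + s (αʲ ξ_j + β) / ⟨ξ⟩)`, `s = ±1`. -/
def projSymbol (s : ℤˣ) : Space →ᵇ (Spinor →L[ℂ] Spinor) :=
  BoundedContinuousFunction.ofNormedAddCommGroup
    (fun ξ : Space => (1 / 2 : ℂ) • ((1 : Spinor →L[ℂ] Spinor)
      + (((s : ℤ) : ℂ) * ((bracket ξ)⁻¹ : ℝ)) • (∑ j, ((ξ j : ℝ) : ℂ) • alpha j + beta)))
    (continuous_projSymbol s) _ (projSymbol_bound s)

/-- The Dirac projection operators `Π_±` on `L²`. -/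
def diracProj (s : ℤˣ) : L2 → L2 := multiplier (projSymbol s)

lemma norm_smul_one_le {z : ℂ} {C : ℝ} (hz : ‖z‖ ≤ C) :
    ‖z • (1 : Spinor →L[ℂ] Spinor)‖ ≤ C := by
  have h3 : ‖(1 : Spinor →L[ℂ] Spinor)‖ ≤ 1 := ContinuousLinearMap.norm_id_le
  rw [norm_smul]
  nlinarith [norm_nonneg z]

/-- The (scalar) symbol `e^{-i s t ⟨ξ⟩}`. -/
def halfWaveSymbol (s : ℤˣ) (t : ℝ) : Space →ᵇ (Spinor →L[ℂ] Spinor) :=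
  BoundedContinuousFunction.ofNormedAddCommGroup
    (fun ξ : Space => Complex.exp ((-(((s : ℤ) : ℝ) * t * bracket ξ) : ℝ) * Complex.I)
      • (1 : Spinor →L[ℂ] Spinor))
    (by have := continuous_bracket; fun_prop) 1
    (fun ξ => norm_smul_one_le (Complex.norm_exp_ofReal_mul_I _).le)

/-- The half-wave propagators `e^{∓it⟨∇⟩}` (`s = ±1` gives `e^{-ist⟨∇⟩}`). -/
def halfWave (s : ℤˣ) (t : ℝ) : L2 → L2 := multiplier (halfWaveSymbol s t)

/-- The free Dirac solution with data `φ`: `e^{-it⟨∇⟩} Π₊ φ + e^{it⟨∇⟩} Π₋ φ`. -/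
def freeDirac (φ : L2) (t : ℝ) : L2 :=
  halfWave 1 t (diracProj 1 φ) + halfWave (-1) t (diracProj (-1) φ)

/-! ### Besov norms -/

/-- A smooth cutoff on `[0, ∞)`: equal to `1` on `[0, 6/5]` and to `0` on `[9/5, ∞)`. -/
def lowCutoff (r : ℝ) : ℝ := Real.smoothTransition (3 - 5 / 3 * r)

/-- The radial profile of the dyadic projection to frequencies `≈ 2ⁿ`.  For `n ≥ 1` it is
`ρ(r / 2ⁿ)` with `ρ(r) = lowCutoff r - lowCutoff (2 r)`, supported in `3/5 ≤ r ≤ 9/5`, and for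
`n = 0` it is the low-frequency cutoff; these functions sum to `1`. -/
def lpProfile (n : ℕ) (r : ℝ) : ℝ :=
  if n = 0 then lowCutoff r else lowCutoff (r / 2 ^ n) - lowCutoff (2 * (r / 2 ^ n))

lemma continuous_lpProfile (n : ℕ) : Continuous (lpProfile n) := by
  have h : Continuous lowCutoff := by
    unfold lowCutoff
    exact Real.smoothTransition.continuous.comp (by fun_prop)
  unfold lpProfile
  split_ifs
  · exact h
  · exact (h.comp (by fun_prop)).sub (h.comp (by fun_prop))

lemma norm_lpProfile_le (n : ℕ) (r : ℝ) : ‖((lpProfile n r : ℝ) : ℂ)‖ ≤ 1 := by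
  rw [Complex.norm_real, Real.norm_eq_abs, abs_le]
  unfold lpProfile lowCutoff
  have h0 := Real.smoothTransition.nonneg
  have h1 := Real.smoothTransition.le_one
  split_ifs
  · constructor <;> linarith [h0 (3 - 5 / 3 * r), h1 (3 - 5 / 3 * r)]
  · constructor <;> linarith [h0 (3 - 5 / 3 * (r / 2 ^ n)), h1 (3 - 5 / 3 * (r / 2 ^ n)),
      h0 (3 - 5 / 3 * (2 * (r / 2 ^ n))), h1 (3 - 5 / 3 * (2 * (r / 2 ^ n)))]

/-- The symbol of the Littlewood–Paley projection `P_{2ⁿ}`. -/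
def lpSymbol (n : ℕ) : Space →ᵇ (Spinor →L[ℂ] Spinor) :=
  BoundedContinuousFunction.ofNormedAddCommGroup
    (fun ξ : Space => ((lpProfile n ‖ξ‖ : ℝ) : ℂ) • (1 : Spinor →L[ℂ] Spinor))
    (by have := continuous_lpProfile n; fun_prop) 1
    (fun ξ => norm_smul_one_le (norm_lpProfile_le n _))

/-- The inhomogeneous Besov norm `‖f‖_{B^s_{1,1}} = ∑_{λ = 1, 2, 4, …} λ^s ‖P_λ f‖_{L¹}`,
with values in `[0, ∞]`. -/
def besovNorm (s : ℝ) (f : L2) : ℝ≥0∞ :=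
  ∑' n : ℕ, ((2 : ℝ≥0∞) ^ n) ^ s * eLpNorm (multiplier (lpSymbol n) f) 1 volume

end DiracHartree

end

/-! Suppose `φ ≠ 0` and write v(t) for the free solution. The Coulomb nonlinearity is long-range:
its effect on the phase of the solution decays only like 1/t, which is not integrable, so it is
incompatible with convergence to a free solution. To detect this, pair ψ with a free solution u
close to v. The free parts cancel in the time derivative of Im ∫ u†ψ, leaving Re ∫ [V₀*(ψ†βψ)] u†βψ.
If ψ and u are both near v, this is near 𝓘(v, βv), whose modulus is at least c 𝓘(v, v). Hence the
derivative has size at least const/t while the pairing is bounded by Cauchy–Schwarz; integrating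
gives log T' ≤ const, which fails for T' large (`mul_log_le_of_le_abs_deriv`).

Three estimates make "near" quantitative.

Lower bound 𝓘(v, v) ≥ const/t. Dirac waves travel at speed at most one: the flux ξ·α has operator
norm |ξ|, so the charge in the moving ball ⟨x⟩ ≤ R + t retains a fixed amount
(`monotone_cone_charge`, `exists_charge_lower_bound`). Inside such a ball the kernel 1/(4π|x-y|) is
at least 1/(8π(R+t)) (`coulombI_self_ge`).

Dispersive decay |v| ≤ M t^{-3/2}. This is the only use of the Besov norms. The frequency-localized
kernel is reduced to a planar oscillatory integral by rotation and polar coordinates. One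
integration by parts in the radial variable gains 1/t, and van der Corput's second derivative test
in the variable along x gains t^{-1/2}; the loss at frequency l is l^{5/2}, the Besov weight
(`planar_bound`, `exists_dispersive_bound`).

Stability of the Coulomb energy. Splitting the potential at radius r, the near part costs √r times
an L^∞ norm and the far part 1/r. With r of order t and L^∞ norms of order t^{-3/2}, both parts are
of order 1/t, with a small constant when the L² distances are small (`norm_coulomb_sub_le`,
`exists_stability_parameters`).

Two regularizations justify the differentiation. The data φ are truncated to low frequencies, so
that u is a classical solution (`classicalFree`) within ε of v in L² at all times and obeying the
same dispersive bound. The pairing carries a spatial cutoff at scale L; its derivative contributes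
an error O(1/L), made negligible by choosing L after the time interval [T, T'] is fixed.

Once `φ = 0`, the charge of ψ tends to zero. It is also nondecreasing
(`IsSmoothSolution.eLpNorm_mono`, again from the expanding cones), so it vanishes at every time. -/

open MeasureTheory Filter Topology FourierTransform
open scoped ContDiff ENNReal Convolution BoundedContinuousFunction

noncomputable section

namespace DiracHartree

/-! ### Van der Corput's second derivative test -/

section VanDerCorput

variable {f f' f'' : ℝ → ℝ}

/-- First derivative test: a convex phase with `f' ≥ δ > 0`. -/
lemma norm_integral_exp_le_of_le_deriv {a b δ : ℝ} (hab : a ≤ b) (hδ : 0 < δ)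
    (hf : ∀ x, HasDerivAt f (f' x) x) (hf' : ∀ x, HasDerivAt f' (f'' x) x)
    (hc : Continuous f'') (hpos : ∀ x ∈ Set.Icc a b, 0 ≤ f'' x)
    (hlow : ∀ x ∈ Set.Icc a b, δ ≤ f' x) :
    ‖∫ x in a..b, Complex.exp ((f x : ℂ) * Complex.I)‖ ≤ 2 / δ := by
  have hcf : Continuous f := continuous_iff_continuousAt.2 fun x => (hf x).continuousAt
  have hcf' : Continuous f' := continuous_iff_continuousAt.2 fun x => (hf' x).continuousAt
  have hne : ∀ x ∈ Set.uIcc a b, f' x ≠ 0 := fun x hx => by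
    rw [Set.uIcc_of_le hab] at hx
    linarith [hlow x hx]
  set u : ℝ → ℂ := fun x => Complex.exp ((f x : ℂ) * Complex.I)
  have hu : ∀ x, HasDerivAt u (u x * ((f' x : ℂ) * Complex.I)) x := fun x =>
    (((hf x).ofReal_comp).mul_const Complex.I).cexp
  set v : ℝ → ℂ := fun x => (((f' x)⁻¹ : ℝ) : ℂ)
  have hv : ∀ x ∈ Set.uIcc a b, HasDerivAt v ((-f'' x / f' x ^ 2 : ℝ) : ℂ) x := fun x hx =>
    ((hf' x).inv (hne x hx)).ofReal_comp
  have hdc : ContinuousOn (fun x => -f'' x / f' x ^ 2) (Set.uIcc a b) :=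
    hc.neg.continuousOn.div (hcf'.pow 2).continuousOn fun x hx => pow_ne_zero 2 (hne x hx)
  have hdi : IntervalIntegrable (fun x => -f'' x / f' x ^ 2) volume a b := hdc.intervalIntegrable
  have hcu : Continuous u := by fun_prop
  -- Write e^{if} as (e^{if})' / (i f') and integrate by parts. Since f'' ≥ 0, 1/f' is monotone, so
  -- its total variation telescopes to its end values.
  have key := intervalIntegral.integral_mul_deriv_eq_deriv_mul (u := v) (v := u)
    (u' := fun x => ((-f'' x / f' x ^ 2 : ℝ) : ℂ))
    (v' := fun x => u x * ((f' x : ℂ) * Complex.I)) hv (fun x _ => hu x)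
    ((Complex.continuous_ofReal.comp_continuousOn hdc).intervalIntegrable) (by apply Continuous.intervalIntegrable; fun_prop)
  have e1 : ∫ x in a..b, v x * (u x * ((f' x : ℂ) * Complex.I))
      = (∫ x in a..b, u x) * Complex.I := by
    rw [← intervalIntegral.integral_mul_const]
    refine intervalIntegral.integral_congr fun x hx => ?_
    have : (f' x : ℂ) ≠ 0 := by exact_mod_cast hne x hx
    simp only [v]
    push_cast
    field_simp
  have hnu : ∀ x, ‖u x‖ = 1 := fun x => Complex.norm_exp_ofReal_mul_I _
  have e2 : ‖∫ x in a..b, ((-f'' x / f' x ^ 2 : ℝ) : ℂ) * u x‖ ≤ (f' a)⁻¹ - (f' b)⁻¹ := by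
    have h1 : ∫ x in a..b, (-f'' x / f' x ^ 2) = (f' b)⁻¹ - (f' a)⁻¹ :=
      intervalIntegral.integral_eq_sub_of_hasDerivAt
        (fun x hx => ((hf' x).inv (hne x hx))) hdi
    calc _ ≤ ∫ x in a..b, ‖((-f'' x / f' x ^ 2 : ℝ) : ℂ) * u x‖ :=
          intervalIntegral.norm_integral_le_integral_norm hab
      _ = ∫ x in a..b, -(-f'' x / f' x ^ 2) := by
          refine intervalIntegral.integral_congr fun x hx => ?_
          rw [Set.uIcc_of_le hab] at hx
          simp only [norm_mul, hnu, mul_one, Complex.norm_real, Real.norm_eq_abs]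
          rw [abs_of_nonpos]
          have := hpos x hx
          have : 0 ≤ f'' x / f' x ^ 2 := by positivity
          rw [neg_div]; linarith
      _ = _ := by rw [intervalIntegral.integral_neg, h1]; ring
  have ha := hlow a (Set.left_mem_Icc.2 hab)
  have hb := hlow b (Set.right_mem_Icc.2 hab)
  have hva : ‖v a * u a‖ = (f' a)⁻¹ := by
    simp only [v, norm_mul, hnu, Complex.norm_real, mul_one]
    exact abs_of_pos (inv_pos.2 (by linarith))
  have hvb : ‖v b * u b‖ = (f' b)⁻¹ := by
    simp only [v, norm_mul, hnu, Complex.norm_real, mul_one]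
    exact abs_of_pos (inv_pos.2 (by linarith))
  have e3 : ‖∫ x in a..b, u x‖ = ‖(∫ x in a..b, u x) * Complex.I‖ := by simp
  rw [e3, ← e1, key]
  have h4 : (f' a)⁻¹ ≤ δ⁻¹ := inv_anti₀ hδ ha
  calc _ ≤ ‖v b * u b - v a * u a‖ + ‖∫ x in a..b, ((-f'' x / f' x ^ 2 : ℝ) : ℂ) * u x‖ :=
        norm_sub_le _ _
    _ ≤ (‖v b * u b‖ + ‖v a * u a‖) + ((f' a)⁻¹ - (f' b)⁻¹) := add_le_add (norm_sub_le _ _) e2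
    _ ≤ 2 / δ := by rw [hva, hvb, div_eq_mul_inv]; linarith

lemma norm_integral_exp_le_sub {a b : ℝ} (hab : a ≤ b) :
    ‖∫ x in a..b, Complex.exp ((f x : ℂ) * Complex.I)‖ ≤ b - a := by
  have := intervalIntegral.norm_integral_le_of_norm_le_const (a := a) (b := b) (C := 1)
    (f := fun x => Complex.exp ((f x : ℂ) * Complex.I))
    (fun x _ => (Complex.norm_exp_ofReal_mul_I _).le)
  rwa [one_mul, abs_of_nonneg (sub_nonneg.2 hab)] at this

/-- Convexity forces f' ≥ √m beyond distance 1/√m from the left end. The initial piece is bounded by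
its length 1/√m and the rest by the first derivative test, 2/√m. -/
lemma norm_integral_exp_le_of_deriv_nonneg {a b m : ℝ} (hab : a ≤ b) (hm : 0 < m)
    (hf : ∀ x, HasDerivAt f (f' x) x) (hf' : ∀ x, HasDerivAt f' (f'' x) x)
    (hc : Continuous f'') (hpos : ∀ x ∈ Set.Icc a b, m ≤ f'' x) (ha : 0 ≤ f' a) :
    ‖∫ x in a..b, Complex.exp ((f x : ℂ) * Complex.I)‖ ≤ 3 / √m := by
  have hs : 0 < √m := Real.sqrt_pos.2 hm
  have hss : √m * √m = m := Real.mul_self_sqrt hm.le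
  have hcf : Continuous f := continuous_iff_continuousAt.2 fun x => (hf x).continuousAt
  rcases le_total b (a + 1 / √m) with h | h
  · refine (norm_integral_exp_le_sub hab).trans ?_
    calc b - a ≤ 1 / √m := by linarith
      _ ≤ 3 / √m := by gcongr; norm_num
  · have hp : 0 < 1 / √m := by positivity
    have hii : ∀ c d, IntervalIntegrable (fun x => Complex.exp ((f x : ℂ) * Complex.I))
        volume c d := fun c d => by apply Continuous.intervalIntegrable; fun_prop
    have hgrow : ∀ x ∈ Set.Icc (a + 1 / √m) b, √m ≤ f' x := fun x hx => by
      have hax : a ≤ x := by linarith [hx.1]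
      have h2 : m * (x - a) ≤ f' x - f' a := by
        have hD : DifferentiableOn ℝ f' (interior (Set.Icc a x)) :=
          fun y _ => (hf' y).differentiableAt.differentiableWithinAt
        refine (convex_Icc a x).mul_sub_le_image_sub_of_le_deriv
          (fun y _ => (hf' y).continuousAt.continuousWithinAt) hD ?_ a
          (Set.left_mem_Icc.2 hax) x (Set.right_mem_Icc.2 hax) hax
        intro y hy
        rw [(hf' y).deriv]
        rw [interior_Icc] at hy
        exact hpos y ⟨hy.1.le, hy.2.le.trans hx.2⟩
      have h3 : m * (1 / √m) ≤ m * (x - a) :=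
        mul_le_mul_of_nonneg_left (by linarith [hx.1]) hm.le
      have h4 : m * (1 / √m) = √m := by rw [mul_one_div, Real.div_sqrt]
      linarith
    rw [← intervalIntegral.integral_add_adjacent_intervals (hii a (a + 1 / √m)) (hii _ b)]
    have h1 := norm_integral_exp_le_sub (f := f) (a := a) (b := a + 1 / √m) (by linarith)
    have h2 := norm_integral_exp_le_of_le_deriv h hs hf hf' hc
      (fun x hx => hm.le.trans (hpos x ⟨by linarith [hx.1], hx.2⟩)) hgrow
    refine (norm_add_le _ _).trans ((add_le_add h1 h2).trans (le_of_eq ?_))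
    field_simp
    ring

/-- Van der Corput's second derivative test. -/
lemma norm_integral_exp_le_of_le_deriv2 {a b m : ℝ} (hab : a ≤ b) (hm : 0 < m)
    (hf : ∀ x, HasDerivAt f (f' x) x) (hf' : ∀ x, HasDerivAt f' (f'' x) x)
    (hc : Continuous f'') (hpos : ∀ x ∈ Set.Icc a b, m ≤ f'' x) :
    ‖∫ x in a..b, Complex.exp ((f x : ℂ) * Complex.I)‖ ≤ 6 / √m := by
  have hs : 0 < √m := Real.sqrt_pos.2 hm
  have hcf : Continuous f := continuous_iff_continuousAt.2 fun x => (hf x).continuousAt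
  have hcf' : Continuous f' := continuous_iff_continuousAt.2 fun x => (hf' x).continuousAt
  have h36 : 3 / √m ≤ 6 / √m := by gcongr; norm_num
  -- Reflection x ↦ -x keeps f'' and changes the sign of f', which reduces the part left of the
  -- critical point to the previous lemma.
  have left : ∀ c ∈ Set.Icc a b, f' c ≤ 0 →
      ‖∫ x in a..c, Complex.exp ((f x : ℂ) * Complex.I)‖ ≤ 3 / √m := fun c hcm hc0 => by
    have h := norm_integral_exp_le_of_deriv_nonneg (f := fun x => f (-x)) (f' := fun x => -f' (-x))
      (f'' := fun x => f'' (-x)) (a := -c) (b := -a) (by linarith [hcm.1]) hm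
      (fun x => by simpa [Function.comp_def] using (hf (-x)).scomp x (hasDerivAt_neg x))
      (fun x => by simpa [Function.comp_def, Pi.neg_def] using ((hf' (-x)).scomp x (hasDerivAt_neg x)).neg)
      (by fun_prop) (fun x hx => hpos (-x) ⟨by linarith [hx.2], by linarith [hx.1, hcm.2]⟩)
      (by simpa using hc0)
    rwa [intervalIntegral.integral_comp_neg (fun x => Complex.exp ((f x : ℂ) * Complex.I)),
      neg_neg, neg_neg] at h
  have right : ∀ c ∈ Set.Icc a b, 0 ≤ f' c →
      ‖∫ x in c..b, Complex.exp ((f x : ℂ) * Complex.I)‖ ≤ 3 / √m := fun c hcm hc0 =>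
    norm_integral_exp_le_of_deriv_nonneg hcm.2 hm hf hf' hc
      (fun x hx => hpos x ⟨hcm.1.trans hx.1, hx.2⟩) hc0
  rcases le_total 0 (f' a) with h | h
  · exact (right a (Set.left_mem_Icc.2 hab) h).trans h36
  rcases le_total (f' b) 0 with h' | h'
  · exact (left b (Set.right_mem_Icc.2 hab) h').trans h36
  obtain ⟨c, hcm, hc0⟩ := intermediate_value_Icc hab hcf'.continuousOn (show (0 : ℝ) ∈ _ from ⟨h, h'⟩)
  have hii : ∀ c d, IntervalIntegrable (fun x => Complex.exp ((f x : ℂ) * Complex.I))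
      volume c d := fun c d => by apply Continuous.intervalIntegrable; fun_prop
  rw [← intervalIntegral.integral_add_adjacent_intervals (hii a c) (hii c b)]
  refine (norm_add_le _ _).trans ((add_le_add (left c hcm hc0.le) (right c hcm hc0.ge)).trans
    (le_of_eq ?_))
  ring

/-- Van der Corput's second derivative test with a real amplitude vanishing at the right end. -/
lemma norm_integral_exp_mul_le {a b m : ℝ} (hab : a ≤ b) (hm : 0 < m)
    (hf : ∀ x, HasDerivAt f (f' x) x) (hf' : ∀ x, HasDerivAt f' (f'' x) x)
    (hc : Continuous f'') (hpos : ∀ x ∈ Set.Icc a b, m ≤ f'' x)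
    {A A' : ℝ → ℝ} (hA : ∀ x, HasDerivAt A (A' x) x) (hA' : Continuous A') (hb : A b = 0) :
    ‖∫ x in a..b, Complex.exp ((f x : ℂ) * Complex.I) * (A x : ℂ)‖
      ≤ 6 / √m * ∫ x in a..b, |A' x| := by
  have hcf : Continuous f := continuous_iff_continuousAt.2 fun x => (hf x).continuousAt
  have hce : Continuous fun x => Complex.exp ((f x : ℂ) * Complex.I) := by fun_prop
  set F : ℝ → ℂ := fun y => ∫ x in a..y, Complex.exp ((f x : ℂ) * Complex.I)
  have hF : ∀ x, HasDerivAt F (Complex.exp ((f x : ℂ) * Complex.I)) x := fun x =>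
    intervalIntegral.integral_hasDerivAt_right (hce.intervalIntegrable _ _)
      (hce.stronglyMeasurableAtFilter _ _) hce.continuousAt
  have hFc : Continuous F := continuous_iff_continuousAt.2 fun x => (hF x).continuousAt
  have key := intervalIntegral.integral_deriv_mul_eq_sub (a := a) (b := b)
    (u := F) (v := fun x => (A x : ℂ)) (u' := fun x => Complex.exp ((f x : ℂ) * Complex.I))
    (v' := fun x => (A' x : ℂ)) (fun x _ => hF x) (fun x _ => (hA x).ofReal_comp)
    (hce.intervalIntegrable _ _) (by apply Continuous.intervalIntegrable; fun_prop)
  have hAc : Continuous A := continuous_iff_continuousAt.2 fun x => (hA x).continuousAt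
  rw [intervalIntegral.integral_add (by apply Continuous.intervalIntegrable; fun_prop)
    (by apply Continuous.intervalIntegrable; fun_prop)] at key
  have hFa : F a = 0 := by simp [F]
  rw [hb, hFa] at key
  have e : ∫ x in a..b, Complex.exp ((f x : ℂ) * Complex.I) * (A x : ℂ)
      = - ∫ x in a..b, F x * (A' x : ℂ) := by
    rw [eq_neg_iff_add_eq_zero, key]; simp
  rw [e, norm_neg, ← intervalIntegral.integral_const_mul]
  refine intervalIntegral.norm_integral_le_of_norm_le hab (ae_of_all _ fun x hx => ?_)
    (by apply Continuous.intervalIntegrable; fun_prop)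
  rw [norm_mul, Complex.norm_real, Real.norm_eq_abs]
  exact mul_le_mul_of_nonneg_right (norm_integral_exp_le_of_le_deriv2 hx.1.le hm hf hf' hc
    (fun y hy => hpos y ⟨hy.1, hy.2.trans hx.2⟩)) (abs_nonneg _)

end VanDerCorput

/-! ### The planar oscillatory integral -/

section Planar

/-- Van der Corput's second derivative test, for a phase with second derivative of either sign. -/
lemma norm_integral_exp_mul_le_of_abs {f f' f'' : ℝ → ℝ} {a b m : ℝ} (hab : a ≤ b) (hm : 0 < m)
    (hf : ∀ x, HasDerivAt f (f' x) x) (hf' : ∀ x, HasDerivAt f' (f'' x) x)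
    (hc : Continuous f'')
    (hpos : (∀ x ∈ Set.Icc a b, m ≤ f'' x) ∨ (∀ x ∈ Set.Icc a b, f'' x ≤ -m))
    {A A' : ℝ → ℝ} (hA : ∀ x, HasDerivAt A (A' x) x) (hA' : Continuous A') (hb : A b = 0) :
    ‖∫ x in a..b, Complex.exp ((f x : ℂ) * Complex.I) * (A x : ℂ)‖
      ≤ 6 / √m * ∫ x in a..b, |A' x| := by
  rcases hpos with h | h
  · exact norm_integral_exp_mul_le hab hm hf hf' hc h hA hA' hb
  · have := norm_integral_exp_mul_le (f := fun x => -f x) (f' := fun x => -f' x)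
      (f'' := fun x => -f'' x) hab hm (fun x => (hf x).neg) (fun x => (hf' x).neg) hc.neg
      (fun x hx => by linarith [h x hx]) hA hA' hb
    -- Complex conjugation changes the sign of the phase and fixes the real amplitude.
    rw [← RCLike.norm_conj, intervalIntegral.integral_of_le hab, ← integral_conj,
      ← intervalIntegral.integral_of_le hab]
    simpa [← Complex.exp_conj] using this

/-- The planar Japanese bracket `√(1 + r² + s²)`. -/
def bracket₂ (r s : ℝ) : ℝ := √(1 + r ^ 2 + s ^ 2)

lemma bracket₂_pos (r s : ℝ) : 0 < bracket₂ r s := by unfold bracket₂; positivity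

lemma bracket₂_sq (r s : ℝ) : bracket₂ r s ^ 2 = 1 + r ^ 2 + s ^ 2 :=
  Real.sq_sqrt (by positivity)

lemma bracket₂_comm (r s : ℝ) : bracket₂ r s = bracket₂ s r := by unfold bracket₂; ring_nf

lemma abs_le_bracket₂ (r s : ℝ) : |r| ≤ bracket₂ r s :=
  abs_le_of_sq_le_sq (by rw [bracket₂_sq]; nlinarith [sq_nonneg s]) (bracket₂_pos r s).le

@[fun_prop]
lemma continuous_bracket₂ : Continuous fun p : ℝ × ℝ => bracket₂ p.1 p.2 := by
  unfold bracket₂; fun_prop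

@[fun_prop]
lemma Continuous.bracket₂ {α : Type*} [TopologicalSpace α] {f g : α → ℝ} (hf : Continuous f)
    (hg : Continuous g) : Continuous fun x => DiracHartree.bracket₂ (f x) (g x) :=
  continuous_bracket₂.comp (hf.prodMk hg)

lemma hasDerivAt_bracket₂ (r s : ℝ) :
    HasDerivAt (fun r => bracket₂ r s) (r / bracket₂ r s) r := by
  have h : HasDerivAt (fun r : ℝ => 1 + r ^ 2 + s ^ 2) (2 * r) r := by
    simpa using ((hasDerivAt_pow 2 r).const_add 1).add_const (s ^ 2)
  convert! h.sqrt (by positivity) using 1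
  unfold bracket₂
  field_simp

lemma hasDerivAt_div_bracket₂ (r s : ℝ) :
    HasDerivAt (fun r => r / bracket₂ r s) ((1 + s ^ 2) / bracket₂ r s ^ 3) r := by
  have hp := (bracket₂_pos r s).ne'
  convert! (hasDerivAt_id r).div (hasDerivAt_bracket₂ r s) hp using 1
  have := bracket₂_sq r s
  field_simp
  simp only [id]
  linear_combination -this

lemma hasDerivAt_const_div_bracket₂ (r s : ℝ) :
    HasDerivAt (fun r => s / bracket₂ r s) (-(s * r) / bracket₂ r s ^ 3) r := by
  have hp := (bracket₂_pos r s).ne'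
  convert! (hasDerivAt_const r s).div (hasDerivAt_bracket₂ r s) hp using 1
  field_simp
  ring

lemma bracket₂_le {l r s : ℝ} (hl : 1 ≤ l) (hr : |r| ≤ 3 * l) (hs : |s| ≤ 3 * l) :
    bracket₂ r s ≤ 9 / 2 * l := by
  have h := bracket₂_sq r s
  have hr2 : r ^ 2 ≤ (3 * l) ^ 2 := sq_le_sq' (by linarith [abs_le.1 hr]) (abs_le.1 hr).2
  have hs2 : s ^ 2 ≤ (3 * l) ^ 2 := sq_le_sq' (by linarith [abs_le.1 hs]) (abs_le.1 hs).2
  refine abs_le_of_sq_le_sq' ?_ (by linarith) |>.2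
  nlinarith

/-- On each half-line the integrand is the derivative of -|s|/⟨(r,s)⟩, a function with values in
[-1, 0]. The bound is therefore uniform in s and b, with no logarithm of the frequency scale. -/
lemma integral_abs_mul_div_bracket₂_le {s b : ℝ} (hb : 0 ≤ b) :
    ∫ r in (-b)..b, |s * r / bracket₂ r s ^ 3| ≤ 2 := by
  have hne : ∀ r, bracket₂ r s ^ 3 ≠ 0 := fun r => (pow_pos (bracket₂_pos r s) 3).ne'
  have hcont : Continuous fun r => |s * r / bracket₂ r s ^ 3| :=
    ((continuous_const.mul continuous_id).div (by fun_prop) hne).abs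
  have hcont' : Continuous fun r => |s| * r / bracket₂ r s ^ 3 :=
    (continuous_const.mul continuous_id).div (by fun_prop) hne
  have hd : ∀ r, HasDerivAt (fun r => -(|s| / bracket₂ r s)) (|s| * r / bracket₂ r s ^ 3) r :=
    fun r => by
      have hp := (bracket₂_pos r s).ne'
      convert! ((hasDerivAt_const r |s|).div (hasDerivAt_bracket₂ r s) hp).neg using 1
      field_simp
      ring
  have half : ∫ r in (0 : ℝ)..b, |s * r / bracket₂ r s ^ 3| ≤ 1 := by
    have e : ∫ r in (0 : ℝ)..b, |s * r / bracket₂ r s ^ 3|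
        = ∫ r in (0 : ℝ)..b, |s| * r / bracket₂ r s ^ 3 := by
      refine intervalIntegral.integral_congr fun r hr => ?_
      rw [Set.uIcc_of_le hb] at hr
      simp only [abs_div, abs_mul, abs_of_nonneg hr.1,
        abs_of_pos (pow_pos (bracket₂_pos r s) 3)]
    rw [e, intervalIntegral.integral_eq_sub_of_hasDerivAt (fun r _ => hd r)
      (hcont'.intervalIntegrable _ _)]
    have h1 : 0 ≤ |s| / bracket₂ b s := div_nonneg (abs_nonneg _) (bracket₂_pos _ _).le
    have h2 : |s| / bracket₂ 0 s ≤ 1 := by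
      rw [div_le_one (bracket₂_pos _ _), bracket₂_comm]
      exact abs_le_bracket₂ _ _
    linarith
  have half' : ∫ r in (-b)..0, |s * r / bracket₂ r s ^ 3| ≤ 1 := by
    have := intervalIntegral.integral_comp_neg (a := 0) (b := b)
      (fun r => |s * r / bracket₂ r s ^ 3|)
    rw [neg_zero] at this
    rw [← this]
    convert half using 3 with r
    have : bracket₂ (-r) s = bracket₂ r s := by simp [bracket₂]
    rw [this, mul_neg, neg_div, abs_neg]
  rw [← intervalIntegral.integral_add_adjacent_intervals (hcont.intervalIntegrable (-b) 0)
    (hcont.intervalIntegrable 0 b)]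
  linarith

/-! ### Phase and amplitude bounds for the planar integral. -/

variable {X X' X'' : ℝ → ℝ} {D l τ : ℝ}

/-- The constant 100 rounds up (9/2)³, from ⟨(r,s)⟩ ≤ (9/2) l on the square of side 6l. -/
lemma phase_deriv2_bound {r s : ℝ} (hl : 1 ≤ l) (hr : |r| ≤ 3 * l) (hs : |s| ≤ 3 * l) :
    (100 * l ^ 3)⁻¹ ≤ (1 + s ^ 2) / bracket₂ r s ^ 3 := by
  have h := bracket₂_le hl hr hs
  have hp := bracket₂_pos r s
  have h3 : bracket₂ r s ^ 3 ≤ (9 / 2 * l) ^ 3 := pow_le_pow_left₀ hp.le h 3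
  have hl3 : 0 < l ^ 3 := by positivity
  rw [inv_eq_one_div]
  refine div_le_div₀ (by positivity) (by nlinarith [sq_nonneg s]) (by positivity) ?_
  nlinarith

lemma planar_vdc (hl : 1 ≤ l) (hτ : τ ≠ 0) (a : ℝ) {s : ℝ} (hs : |s| ≤ 3 * l)
    {A A' : ℝ → ℝ} (hA : ∀ x, HasDerivAt A (A' x) x) (hA' : Continuous A') (hb : A (3 * l) = 0) :
    ‖∫ r in (-(3 * l))..(3 * l),
        Complex.exp (((a * r - τ * bracket₂ r s : ℝ) : ℂ) * Complex.I) * (A r : ℂ)‖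
      ≤ 60 * (√(l ^ 3) / √|τ|) * ∫ r in (-(3 * l))..(3 * l), |A' r| := by
  have hl0 : 0 < l := by linarith
  have hne : ∀ r, bracket₂ r s ^ 3 ≠ 0 := fun r => (pow_pos (bracket₂_pos r s) 3).ne'
  have hτ0 : 0 < |τ| := abs_pos.2 hτ
  have hm : 0 < |τ| * (100 * l ^ 3)⁻¹ := by positivity
  have key := norm_integral_exp_mul_le_of_abs (f := fun r => a * r - τ * bracket₂ r s)
    (f' := fun r => a - τ * (r / bracket₂ r s))
    (f'' := fun r => -(τ * ((1 + s ^ 2) / bracket₂ r s ^ 3)))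
    (a := -(3 * l)) (b := 3 * l) (m := |τ| * (100 * l ^ 3)⁻¹) (by linarith) hm
    (fun r => by
      simpa [Pi.sub_def] using
        ((hasDerivAt_id r).const_mul a).sub ((hasDerivAt_bracket₂ r s).const_mul τ))
    (fun r => by
      simpa using ((hasDerivAt_div_bracket₂ r s).const_mul τ).const_sub a)
    ((continuous_const.mul (continuous_const.div (by fun_prop) hne)).neg)
    (by
      rcases lt_or_gt_of_ne hτ with h | h
      · left
        intro r hr
        have := phase_deriv2_bound hl (abs_le.2 hr) hs
        rw [abs_of_neg h, neg_mul]
        nlinarith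
      · right
        intro r hr
        have := phase_deriv2_bound hl (abs_le.2 hr) hs
        rw [abs_of_pos h]
        nlinarith) hA hA' hb
  refine key.trans (le_of_eq ?_)
  congr 1
  rw [Real.sqrt_mul hτ0.le, Real.sqrt_inv, Real.sqrt_mul (by norm_num : (0 : ℝ) ≤ 100),
    show (100 : ℝ) = 10 ^ 2 by norm_num, Real.sqrt_sq (by norm_num)]
  field_simp
  norm_num

/-- The amplitude `√(1 + r² + s²) X((r² + s²) / l²)`. -/
def planeAmp (X : ℝ → ℝ) (l r s : ℝ) : ℝ := bracket₂ r s * X ((r ^ 2 + s ^ 2) / l ^ 2)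

/-- The derivative of `planeAmp` in the first variable. -/
def planeAmpDeriv (X X' : ℝ → ℝ) (l r s : ℝ) : ℝ :=
  r / bracket₂ r s * X ((r ^ 2 + s ^ 2) / l ^ 2)
    + bracket₂ r s * (2 * r / l ^ 2 * X' ((r ^ 2 + s ^ 2) / l ^ 2))

/-- The derivative of `planeAmpDeriv` in the second variable. -/
def planeAmpDeriv₂ (X X' X'' : ℝ → ℝ) (l s r : ℝ) : ℝ :=
  (-(s * r) / bracket₂ r s ^ 3) * X ((r ^ 2 + s ^ 2) / l ^ 2)
    + s / bracket₂ r s * (2 * r / l ^ 2 * X' ((r ^ 2 + s ^ 2) / l ^ 2))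
    + (r / bracket₂ r s * (2 * s / l ^ 2 * X' ((r ^ 2 + s ^ 2) / l ^ 2))
      + bracket₂ r s * (2 * s / l ^ 2 * (2 * r / l ^ 2 * X'' ((r ^ 2 + s ^ 2) / l ^ 2))))

lemma planeAmp_comm (X : ℝ → ℝ) (l r s : ℝ) : planeAmp X l r s = planeAmp X l s r := by
  unfold planeAmp; rw [bracket₂_comm, add_comm]

lemma hasDerivAt_comp_sq_div {f f' : ℝ → ℝ} (hf : ∀ u, HasDerivAt f (f' u) u) (l r s : ℝ) :
    HasDerivAt (fun r => f ((r ^ 2 + s ^ 2) / l ^ 2))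
      (2 * r / l ^ 2 * f' ((r ^ 2 + s ^ 2) / l ^ 2)) r := by
  have h : HasDerivAt (fun r : ℝ => (r ^ 2 + s ^ 2) / l ^ 2) (2 * r / l ^ 2) r := by
    simpa using ((hasDerivAt_pow 2 r).add_const (s ^ 2)).div_const (l ^ 2)
  convert! (hf _).comp r h using 1
  ring

lemma hasDerivAt_planeAmp (hX : ∀ u, HasDerivAt X (X' u) u) (l r s : ℝ) :
    HasDerivAt (fun r => planeAmp X l r s) (planeAmpDeriv X X' l r s) r :=
  (hasDerivAt_bracket₂ r s).mul (hasDerivAt_comp_sq_div hX l r s)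

lemma hasDerivAt_planeAmpDeriv (hX : ∀ u, HasDerivAt X (X' u) u)
    (hX' : ∀ u, HasDerivAt X' (X'' u) u) (l s r : ℝ) :
    HasDerivAt (fun r => planeAmpDeriv X X' l s r) (planeAmpDeriv₂ X X' X'' l s r) r := by
  have h := ((hasDerivAt_const_div_bracket₂ r s).mul (hasDerivAt_comp_sq_div hX l r s)).add
    ((hasDerivAt_bracket₂ r s).mul ((hasDerivAt_comp_sq_div hX' l r s).const_mul (2 * s / l ^ 2)))
  convert! h using 1
  funext r
  simp only [planeAmpDeriv, bracket₂_comm s r, add_comm (s ^ 2)]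
  rfl

lemma abs_div_bracket₂_le (r s : ℝ) : |r / bracket₂ r s| ≤ 1 := by
  rw [abs_div, abs_of_pos (bracket₂_pos r s)]
  exact div_le_one_of_le₀ (abs_le_bracket₂ r s) (bracket₂_pos r s).le

lemma sq_add_sq_div_mem {r s : ℝ} (hl : 1 ≤ l) (hr : |r| ≤ 3 * l) (hs : |s| ≤ 3 * l) :
    (r ^ 2 + s ^ 2) / l ^ 2 ∈ Set.Icc (0 : ℝ) 18 := by
  have hr2 : r ^ 2 ≤ (3 * l) ^ 2 := sq_le_sq' (by linarith [abs_le.1 hr]) (abs_le.1 hr).2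
  have hs2 : s ^ 2 ≤ (3 * l) ^ 2 := sq_le_sq' (by linarith [abs_le.1 hs]) (abs_le.1 hs).2
  refine ⟨by positivity, ?_⟩
  rw [div_le_iff₀ (by positivity)]
  nlinarith

lemma abs_two_mul_div_sq_le {r : ℝ} (hl : 1 ≤ l) (hr : |r| ≤ 3 * l) : |2 * r / l ^ 2| ≤ 6 / l := by
  have hl0 : 0 < l := by linarith
  rw [abs_div, abs_mul, abs_of_pos (by norm_num : (0 : ℝ) < 2), abs_of_pos (by positivity : 0 < l ^ 2),
    div_le_div_iff₀ (by positivity) hl0]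
  nlinarith

lemma abs_planeAmpDeriv_le (hX0 : ∀ u, |X u| ≤ 1) (hD' : ∀ u ∈ Set.Icc (0 : ℝ) 18, |X' u| ≤ D)
    (hl : 1 ≤ l) {r s : ℝ} (hr : |r| ≤ 3 * l) (hs : |s| ≤ 3 * l) :
    |planeAmpDeriv X X' l r s| ≤ 1 + 27 * D := by
  have hl0 : 0 < l := by linarith
  have hu := sq_add_sq_div_mem hl hr hs
  have hD0 : 0 ≤ D := (abs_nonneg _).trans (hD' _ hu)
  have hW : |bracket₂ r s| ≤ 9 / 2 * l := by
    rw [abs_of_pos (bracket₂_pos r s)]; exact bracket₂_le hl hr hs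
  refine (abs_add_le _ _).trans (add_le_add ?_ ?_)
  · rw [abs_mul]
    exact mul_le_one₀ (abs_div_bracket₂_le r s) (abs_nonneg _) (hX0 _)
  · rw [abs_mul, abs_mul]
    calc _ ≤ 9 / 2 * l * (6 / l * D) := by
          gcongr
          · exact abs_two_mul_div_sq_le hl hr
          · exact hD' _ hu
      _ = 27 * D := by field_simp; ring

/-- Where a derivative falls on the cutoff the term is O(D/l), with 174 = 6 + 6 + 162. The remaining
term is not small but has bounded integral in r, so the whole has bounded variation uniformly in l.
-/
lemma abs_planeAmpDeriv₂_le (hX0 : ∀ u, |X u| ≤ 1) (hD' : ∀ u ∈ Set.Icc (0 : ℝ) 18, |X' u| ≤ D)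
    (hD'' : ∀ u ∈ Set.Icc (0 : ℝ) 18, |X'' u| ≤ D)
    (hl : 1 ≤ l) {r s : ℝ} (hr : |r| ≤ 3 * l) (hs : |s| ≤ 3 * l) :
    |planeAmpDeriv₂ X X' X'' l s r| ≤ |s * r / bracket₂ r s ^ 3| + 174 * D / l := by
  have hl0 : 0 < l := by linarith
  have hu := sq_add_sq_div_mem hl hr hs
  have hD0 : 0 ≤ D := (abs_nonneg _).trans (hD' _ hu)
  have hW : |bracket₂ r s| ≤ 9 / 2 * l := by
    rw [abs_of_pos (bracket₂_pos r s)]; exact bracket₂_le hl hr hs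
  have hr' := abs_two_mul_div_sq_le hl hr
  have hs' := abs_two_mul_div_sq_le hl hs
  have h1 : |(-(s * r) / bracket₂ r s ^ 3) * X ((r ^ 2 + s ^ 2) / l ^ 2)|
      ≤ |s * r / bracket₂ r s ^ 3| := by
    rw [abs_mul, neg_div, abs_neg]
    exact mul_le_of_le_one_right (abs_nonneg _) (hX0 _)
  have h2 : |s / bracket₂ r s * (2 * r / l ^ 2 * X' ((r ^ 2 + s ^ 2) / l ^ 2))| ≤ 6 * D / l := by
    rw [abs_mul, abs_mul]
    calc _ ≤ 1 * (6 / l * D) := by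
          gcongr
          · rw [bracket₂_comm]; exact abs_div_bracket₂_le s r
          · exact hD' _ hu
      _ = _ := by ring
  have h3 : |r / bracket₂ r s * (2 * s / l ^ 2 * X' ((r ^ 2 + s ^ 2) / l ^ 2))| ≤ 6 * D / l := by
    rw [abs_mul, abs_mul]
    calc _ ≤ 1 * (6 / l * D) := by
          gcongr
          · exact abs_div_bracket₂_le r s
          · exact hD' _ hu
      _ = _ := by ring
  have h4 : |bracket₂ r s * (2 * s / l ^ 2 * (2 * r / l ^ 2 * X'' ((r ^ 2 + s ^ 2) / l ^ 2)))|
      ≤ 162 * D / l := by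
    rw [abs_mul, abs_mul, abs_mul]
    calc _ ≤ 9 / 2 * l * (6 / l * (6 / l * D)) := by
          gcongr
          exact hD'' _ hu
      _ = _ := by field_simp; ring
  unfold planeAmpDeriv₂
  refine (abs_add_le _ _).trans ?_
  have h5 := abs_add_le ((-(s * r) / bracket₂ r s ^ 3) * X ((r ^ 2 + s ^ 2) / l ^ 2))
    (s / bracket₂ r s * (2 * r / l ^ 2 * X' ((r ^ 2 + s ^ 2) / l ^ 2)))
  have h6 := abs_add_le (r / bracket₂ r s * (2 * s / l ^ 2 * X' ((r ^ 2 + s ^ 2) / l ^ 2)))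
    (bracket₂ r s * (2 * s / l ^ 2 * (2 * r / l ^ 2 * X'' ((r ^ 2 + s ^ 2) / l ^ 2))))
  have e : 174 * D / l = 6 * D / l + 6 * D / l + 162 * D / l := by ring
  rw [e]
  linarith

/-- The oscillatory factor `e^{i(a r - τ √(1+r²+s²))}`. -/
def planeOsc (a τ r s : ℝ) : ℂ :=
  Complex.exp (((a * r - τ * bracket₂ r s : ℝ) : ℂ) * Complex.I)

@[fun_prop]
lemma Continuous.planeOsc {α : Type*} [TopologicalSpace α] {f g : α → ℝ} (hf : Continuous f)
    (hg : Continuous g) (a τ : ℝ) : Continuous fun x => DiracHartree.planeOsc a τ (f x) (g x) := by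
  unfold DiracHartree.planeOsc; fun_prop

/-- The polar weight s is what permits this: s e^{-iτ⟨(r,s)⟩} = (i/τ) ⟨(r,s)⟩ ∂ₛ e^{-iτ⟨(r,s)⟩}. The
boundary term at s = 3l vanishes because X is zero from 5 on and s²/l² = 9 there; the one at s = 0
survives. -/
lemma planar_inner_by_parts (hX : ∀ u, HasDerivAt X (X' u) u) (hX'c : Continuous X')
    (hXs : ∀ u, 5 ≤ u → X u = 0) (hl : 1 ≤ l) (hτ : τ ≠ 0) (a r : ℝ) :
    ∫ s in (0 : ℝ)..(3 * l), (s : ℂ) * planeOsc a τ r s * (X ((r ^ 2 + s ^ 2) / l ^ 2) : ℂ)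
      = (-Complex.I / τ) * (planeOsc a τ r 0 * (planeAmp X l r 0 : ℂ)
        + ∫ s in (0 : ℝ)..(3 * l), planeOsc a τ r s * (planeAmpDeriv X X' l s r : ℂ)) := by
  have hl0 : 0 < l := by linarith
  have hXc : Continuous X := continuous_iff_continuousAt.2 fun u => (hX u).continuousAt
  have hne : ∀ s, bracket₂ s r ≠ 0 := fun s => (bracket₂_pos s r).ne'
  have hne' : ∀ s, bracket₂ r s ≠ 0 := fun s => (bracket₂_pos r s).ne'
  have hτ' : (τ : ℂ) ≠ 0 := by exact_mod_cast hτ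
  have hosc : ∀ s, HasDerivAt (fun s => planeOsc a τ r s)
      (planeOsc a τ r s * (((-(τ * (s / bracket₂ s r)) : ℝ) : ℂ) * Complex.I)) s := fun s => by
    have h1 : HasDerivAt (fun s => a * r - τ * bracket₂ r s) (-(τ * (s / bracket₂ s r))) s := by
      have := ((hasDerivAt_bracket₂ s r).const_mul τ).const_sub (a * r)
      simpa only [bracket₂_comm _ r] using this
    exact ((h1.ofReal_comp).mul_const Complex.I).cexp
  have hamp : ∀ s, HasDerivAt (fun s => (planeAmp X l r s : ℂ)) (planeAmpDeriv X X' l s r : ℂ) s :=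
    fun s => by
      have := (hasDerivAt_planeAmp hX l s r).ofReal_comp
      simpa only [planeAmp_comm X l _ r] using this
  have hcD : Continuous fun s => planeAmpDeriv X X' l s r := by
    unfold planeAmpDeriv
    refine Continuous.add (Continuous.mul (continuous_id.div (by fun_prop) hne) ?_) ?_ <;> fun_prop
  have hcq : Continuous fun s => s / bracket₂ s r := continuous_id.div (by fun_prop) hne
  have key := intervalIntegral.integral_mul_deriv_eq_deriv_mul (a := 0) (b := 3 * l)
    (u := fun s => (planeAmp X l r s : ℂ)) (v := fun s => planeOsc a τ r s)
    (fun s _ => hamp s) (fun s _ => hosc s)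
    (by apply Continuous.intervalIntegrable; fun_prop)
    (by apply Continuous.intervalIntegrable; fun_prop)
  have hb : planeAmp X l r (3 * l) = 0 := by
    unfold planeAmp
    rw [hXs, mul_zero]
    rw [le_div_iff₀ (by positivity)]
    nlinarith [sq_nonneg r, sq_nonneg l]
  rw [hb] at key
  have e1 : ∫ s in (0 : ℝ)..(3 * l), (planeAmp X l r s : ℂ)
        * (planeOsc a τ r s * (((-(τ * (s / bracket₂ s r)) : ℝ) : ℂ) * Complex.I))
      = (-(τ : ℂ) * Complex.I) * ∫ s in (0 : ℝ)..(3 * l),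
        (s : ℂ) * planeOsc a τ r s * (X ((r ^ 2 + s ^ 2) / l ^ 2) : ℂ) := by
    rw [← intervalIntegral.integral_const_mul]
    refine intervalIntegral.integral_congr fun s _ => ?_
    simp only [planeAmp]
    rw [bracket₂_comm s r]
    have : (bracket₂ r s : ℂ) ≠ 0 := by exact_mod_cast hne' s
    push_cast
    field_simp
  rw [e1] at key
  have hI : (-(τ : ℂ) * Complex.I) ≠ 0 := by simp [hτ]
  apply mul_left_cancel₀ hI
  rw [key]
  have h2 : ∀ z : ℂ, -(τ : ℂ) * Complex.I * (-Complex.I / τ * z) = -z := fun z => by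
    field_simp
    ring_nf
    simp
  rw [h2]
  simp only [Complex.ofReal_zero, zero_mul, zero_sub, neg_add]
  rw [sub_eq_add_neg]
  congr 2
  · ring
  · exact intervalIntegral.integral_congr fun s _ => mul_comm _ _

/-- The bound for the planar oscillatory integral to which the kernel of `e^{-iτ⟨∇⟩}` at frequencies
`≲ l` reduces. -/
theorem planar_bound (hX : ∀ u, HasDerivAt X (X' u) u) (hX' : ∀ u, HasDerivAt X' (X'' u) u)
    (hX''c : Continuous X'') (hX0 : ∀ u, |X u| ≤ 1)
    (hD' : ∀ u ∈ Set.Icc (0 : ℝ) 18, |X' u| ≤ D) (hD'' : ∀ u ∈ Set.Icc (0 : ℝ) 18, |X'' u| ≤ D)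
    (hXs : ∀ u, 5 ≤ u → X u = 0) (hXs' : ∀ u, 5 ≤ u → X' u = 0)
    (hl : 1 ≤ l) (hτ : τ ≠ 0) (a : ℝ) :
    ‖∫ r in (-(3 * l))..(3 * l), ∫ s in (0 : ℝ)..(3 * l),
        (s : ℂ) * planeOsc a τ r s * (X ((r ^ 2 + s ^ 2) / l ^ 2) : ℂ)‖
      ≤ (720 + 200000 * D) * (l * √(l ^ 3) / (|τ| * √|τ|)) := by
  have hl0 : 0 < l := by linarith
  have hτ0 : 0 < |τ| := abs_pos.2 hτ
  have hD0 : 0 ≤ D := (abs_nonneg _).trans (hD' 0 (by norm_num))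
  have hXc : Continuous X := continuous_iff_continuousAt.2 fun u => (hX u).continuousAt
  have hX'c : Continuous X' := continuous_iff_continuousAt.2 fun u => (hX' u).continuousAt
  have hne : ∀ p : ℝ × ℝ, bracket₂ p.2 p.1 ≠ 0 := fun s => (bracket₂_pos _ _).ne'
  have hcD : Continuous fun p : ℝ × ℝ => planeAmpDeriv X X' l p.2 p.1 := by
    unfold planeAmpDeriv
    refine Continuous.add (Continuous.mul (continuous_snd.div (by fun_prop) hne) ?_) ?_ <;> fun_prop
  have hcA : Continuous fun r => planeAmp X l r 0 := by unfold planeAmp; fun_prop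
  have hcD1 : Continuous fun r => planeAmpDeriv X X' l r 0 := hcD.comp (by fun_prop : Continuous fun r : ℝ => ((0 : ℝ), r))
  have hcD2 : ∀ s, Continuous fun r => planeAmpDeriv₂ X X' X'' l s r := fun s => by
    unfold planeAmpDeriv₂
    have h0 : ∀ r, bracket₂ r s ≠ 0 := fun r => (bracket₂_pos _ _).ne'
    have h1 : Continuous fun r => -(s * r) / bracket₂ r s ^ 3 :=
      Continuous.div (by fun_prop) (by fun_prop) fun r => pow_ne_zero 3 (h0 r)
    have h2 : Continuous fun r => s / bracket₂ r s := continuous_const.div (by fun_prop) h0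
    have h3 : Continuous fun r => r / bracket₂ r s := continuous_id.div (by fun_prop) h0
    fun_prop
  set F : ℝ → ℝ → ℂ := fun r s => planeOsc a τ r s * (planeAmpDeriv X X' l s r : ℂ)
  have hF : Continuous (Function.uncurry F) := by
    simp only [F, Function.uncurry_def]
    fun_prop
  have hFi : Continuous fun r => ∫ s in (0 : ℝ)..(3 * l), F r s :=
    intervalIntegral.continuous_parametric_intervalIntegral_of_continuous' hF _ _
  rw [intervalIntegral.integral_congr (g := fun r => (-Complex.I / τ) *
    (planeOsc a τ r 0 * (planeAmp X l r 0 : ℂ) + ∫ s in (0 : ℝ)..(3 * l), F r s))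
    (fun r _ => planar_inner_by_parts hX hX'c hXs hl hτ a r),
    intervalIntegral.integral_const_mul, intervalIntegral.integral_add
      (by apply Continuous.intervalIntegrable; fun_prop) (hFi.intervalIntegrable _ _)]
  -- Fubini makes van der Corput in r available at each fixed s. It contributes l^{3/2}/√|τ|, the
  -- length of the remaining interval contributes l, and the integration by parts 1/|τ|.
  have hswap : ∫ r in (-(3 * l))..(3 * l), ∫ s in (0 : ℝ)..(3 * l), F r s
      = ∫ s in (0 : ℝ)..(3 * l), ∫ r in (-(3 * l))..(3 * l), F r s :=
    intervalIntegral_intervalIntegral_swap ((hF.continuousOn.integrableOn_compact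
      (isCompact_uIcc.prod isCompact_uIcc)).mono_set
        (Set.prod_mono Set.uIoc_subset_uIcc Set.uIoc_subset_uIcc))
  have hlen : ∀ {x : ℝ}, x ∈ Set.Ioc (-(3 * l)) (3 * l) → |x| ≤ 3 * l := fun hx =>
    abs_le.2 ⟨hx.1.le, hx.2⟩
  have h5 : 5 ≤ ((3 * l) ^ 2 + (0 : ℝ) ^ 2) / l ^ 2 := by
    rw [le_div_iff₀ (by positivity)]; nlinarith [sq_nonneg l]
  have h1 : ‖∫ r in (-(3 * l))..(3 * l), planeOsc a τ r 0 * (planeAmp X l r 0 : ℂ)‖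
      ≤ 60 * (√(l ^ 3) / √|τ|) * ((1 + 27 * D) * (6 * l)) := by
    refine (planar_vdc (s := 0) hl hτ a (by simpa using by positivity)
      (fun r => hasDerivAt_planeAmp hX l r 0) hcD1 ?_).trans ?_
    · simp only [planeAmp]; rw [hXs _ h5, mul_zero]
    · gcongr
      have := intervalIntegral.norm_integral_le_of_norm_le_const (a := -(3 * l)) (b := 3 * l)
        (f := fun r => |planeAmpDeriv X X' l r 0|) (C := 1 + 27 * D) (fun r hr => by
          rw [Set.uIoc_of_le (by linarith)] at hr
          rw [Real.norm_eq_abs, abs_abs]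
          exact abs_planeAmpDeriv_le hX0 hD' hl (hlen hr) (by simpa using by positivity))
      refine (le_abs_self _).trans (this.trans (le_of_eq ?_))
      rw [abs_of_nonneg (by linarith)]
      ring
  have h2 : ∀ s ∈ Set.Ioc (0 : ℝ) (3 * l), ‖∫ r in (-(3 * l))..(3 * l), F r s‖
      ≤ 60 * (√(l ^ 3) / √|τ|) * (2 + 1044 * D) := fun s hs => by
    have hs' : |s| ≤ 3 * l := abs_le.2 ⟨by linarith [hs.1], hs.2⟩
    have h5' : 5 ≤ (s ^ 2 + (3 * l) ^ 2) / l ^ 2 := by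
      rw [le_div_iff₀ (by positivity)]; nlinarith [sq_nonneg l, sq_nonneg s]
    refine (planar_vdc hl hτ a hs' (fun r => hasDerivAt_planeAmpDeriv hX hX' l s r)
      (hcD2 s) ?_).trans ?_
    · simp only [planeAmpDeriv]; rw [hXs _ h5', hXs' _ h5']; simp
    · gcongr
      have hne3 : ∀ r, bracket₂ r s ^ 3 ≠ 0 := fun r => (pow_pos (bracket₂_pos r s) 3).ne'
      have hcont : Continuous fun r => |s * r / bracket₂ r s ^ 3| :=
        ((continuous_const.mul continuous_id).div (by fun_prop) hne3).abs
      calc _ ≤ ∫ r in (-(3 * l))..(3 * l), (|s * r / bracket₂ r s ^ 3| + 174 * D / l) := by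
            refine intervalIntegral.integral_mono_on (by linarith)
              ((hcD2 s).abs.intervalIntegrable _ _)
              ((hcont.add continuous_const).intervalIntegrable _ _) fun r hr => ?_
            exact abs_planeAmpDeriv₂_le hX0 hD' hD'' hl (abs_le.2 hr) hs'
        _ ≤ 2 + 1044 * D := by
            -- 1044 = 6 · 174: the constant 174 D / l integrated over an interval of length 6l.
            rw [intervalIntegral.integral_add (hcont.intervalIntegrable _ _) (by simp)]
            refine add_le_add (integral_abs_mul_div_bracket₂_le (by linarith)) (le_of_eq ?_)
            rw [intervalIntegral.integral_const, smul_eq_mul]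
            field_simp
            ring
  have h3 : ‖∫ s in (0 : ℝ)..(3 * l), ∫ r in (-(3 * l))..(3 * l), F r s‖
      ≤ 60 * (√(l ^ 3) / √|τ|) * (2 + 1044 * D) * (3 * l) := by
    have := intervalIntegral.norm_integral_le_of_norm_le_const (a := 0) (b := 3 * l)
      (f := fun s => ∫ r in (-(3 * l))..(3 * l), F r s)
      (C := 60 * (√(l ^ 3) / √|τ|) * (2 + 1044 * D)) (fun s hs => by
        rw [Set.uIoc_of_le (by linarith)] at hs
        exact h2 s hs)
    rwa [sub_zero, abs_of_pos (by positivity : 0 < 3 * l)] at this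
  rw [hswap, norm_mul]
  have hI : ‖-Complex.I / (τ : ℂ)‖ = 1 / |τ| := by
    rw [norm_div, norm_neg, Complex.norm_I, Complex.norm_real, Real.norm_eq_abs]
  rw [hI]
  calc _ ≤ 1 / |τ| * (60 * (√(l ^ 3) / √|τ|) * ((1 + 27 * D) * (6 * l))
        + 60 * (√(l ^ 3) / √|τ|) * (2 + 1044 * D) * (3 * l)) := by
        gcongr
        exact (norm_add_le _ _).trans (add_le_add h1 h3)
    _ = (720 + 197640 * D) * (l * √(l ^ 3) / (|τ| * √|τ|)) := by
        have : 0 < √|τ| := Real.sqrt_pos.2 hτ0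
        field_simp
        ring
    _ ≤ _ := by gcongr; norm_num

end Planar

/-! ### The kernel of the half-wave propagator -/

/-- The cutoff `X(u)`, equal to `1` for `u ≤ 4` and to `0` for `u ≥ 5`. -/
def wideCutoff (u : ℝ) : ℝ := Real.smoothTransition (5 - u)

lemma contDiff_wideCutoff : ContDiff ℝ ∞ wideCutoff := by
  unfold wideCutoff
  exact Real.smoothTransition.contDiff.comp (by fun_prop)

@[fun_prop]
lemma continuous_wideCutoff : Continuous wideCutoff := contDiff_wideCutoff.continuous

lemma wideCutoff_nonneg (u : ℝ) : 0 ≤ wideCutoff u := Real.smoothTransition.nonneg _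

lemma wideCutoff_le_one (u : ℝ) : wideCutoff u ≤ 1 := Real.smoothTransition.le_one _

lemma wideCutoff_of_le {u : ℝ} (h : u ≤ 4) : wideCutoff u = 1 :=
  Real.smoothTransition.one_of_one_le (by linarith)

lemma wideCutoff_of_ge {u : ℝ} (h : 5 ≤ u) : wideCutoff u = 0 :=
  Real.smoothTransition.zero_of_nonpos (by linarith)

lemma exists_planar_bound : ∃ C : ℝ, 0 < C ∧ ∀ l τ a : ℝ, 1 ≤ l → τ ≠ 0 →
    ‖∫ r in (-(3 * l))..(3 * l), ∫ s in (0 : ℝ)..(3 * l),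
        (s : ℂ) * planeOsc a τ r s * (wideCutoff ((r ^ 2 + s ^ 2) / l ^ 2) : ℂ)‖
      ≤ C * (l * √(l ^ 3) / (|τ| * √|τ|)) := by
  have h1 : ContDiff ℝ ∞ (deriv wideCutoff) := contDiff_wideCutoff.iterate_deriv 1
  have h2 : ContDiff ℝ ∞ (deriv (deriv wideCutoff)) := h1.iterate_deriv 1
  have hd0 : ∀ u, HasDerivAt wideCutoff (deriv wideCutoff u) u := fun u =>
    (contDiff_wideCutoff.differentiable (by simp) u).hasDerivAt
  have hd1 : ∀ u, HasDerivAt (deriv wideCutoff) (deriv (deriv wideCutoff) u) u := fun u =>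
    (h1.differentiable (by simp) u).hasDerivAt
  obtain ⟨D1, hD1⟩ := (isCompact_Icc (a := (0 : ℝ)) (b := 18)).exists_bound_of_continuousOn
    h1.continuous.continuousOn
  obtain ⟨D2, hD2⟩ := (isCompact_Icc (a := (0 : ℝ)) (b := 18)).exists_bound_of_continuousOn
    h2.continuous.continuousOn
  have hD : 0 ≤ max D1 D2 := (norm_nonneg _).trans ((hD1 0 (by norm_num)).trans (le_max_left _ _))
  refine ⟨720 + 200000 * max D1 D2, by positivity, fun l τ a hl hτ => ?_⟩
  refine planar_bound hd0 hd1 h2.continuous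
    (fun u => abs_le.2 ⟨by linarith [wideCutoff_nonneg u], wideCutoff_le_one u⟩)
    (fun u hu => (hD1 u hu).trans (le_max_left _ _))
    (fun u hu => (hD2 u hu).trans (le_max_right _ _))
    (fun u hu => wideCutoff_of_ge hu) (fun u hu => ?_) hl hτ a
  -- The cutoff is nonnegative and vanishes at u, so u is a minimum. This covers u = 5 as well.
  refine IsLocalMin.deriv_eq_zero (Eventually.of_forall fun v => ?_)
  rw [wideCutoff_of_ge hu]
  exact wideCutoff_nonneg v

/-- Integration of a radial function over the plane. -/
lemma integral_radial_plane (G : ℝ → ℂ) :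
    ∫ p : ℝ × ℝ, G (p.1 ^ 2 + p.2 ^ 2)
      = (2 * Real.pi : ℝ) * ∫ s in Set.Ioi (0 : ℝ), (s : ℂ) * G (s ^ 2) := by
  rw [← integral_comp_polarCoord_symm]
  have h : ∀ p : ℝ × ℝ, p.1 • G ((polarCoord.symm p).1 ^ 2 + (polarCoord.symm p).2 ^ 2)
      = ((p.1 : ℂ) * G (p.1 ^ 2)) * 1 := fun p => by
    rw [polarCoord_symm_apply, Complex.real_smul, mul_one]
    congr 2
    have := Real.cos_sq_add_sin_sq p.2
    linear_combination p.1 ^ 2 * this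
  simp_rw [h, polarCoord_target, Measure.volume_eq_prod]
  rw [setIntegral_prod_mul (fun s : ℝ => (s : ℂ) * G (s ^ 2)) (fun _ => (1 : ℂ)), mul_comm]
  congr 1
  rw [setIntegral_const]
  simp [Real.volume_real_Ioo, two_mul, Real.pi_pos.le]

/-- The coordinates `(ξ₀, (ξ₁, ξ₂))` on `ℝ³`. -/
def splitCoord : Space ≃ᵐ ℝ × (ℝ × ℝ) :=
  (MeasurableEquiv.toLp 2 (Fin 3 → ℝ)).symm.trans
    ((MeasurableEquiv.piFinSuccAbove (fun _ => ℝ) 0).trans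
      ((MeasurableEquiv.refl ℝ).prodCongr MeasurableEquiv.finTwoArrow))

lemma measurePreserving_splitCoord : MeasurePreserving splitCoord := by
  refine MeasurePreserving.trans (EuclideanSpace.volume_preserving_symm_measurableEquiv_toLp (Fin 3)) ?_
  refine MeasurePreserving.trans (volume_preserving_piFinSuccAbove (fun _ : Fin 3 => ℝ) 0) ?_
  exact (MeasurePreserving.id volume).prod (volume_preserving_finTwoArrow ℝ)

/-- Turns the linear phase x·ξ into ‖x‖ ξ₀. What remains of the kernel's integrand is radial in the
two transversal variables. -/
lemma exists_rotation (x : Space) : ∃ R : Space ≃ₗᵢ[ℝ] Space, ∀ ξ,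
    inner ℝ x (R ξ) = ‖x‖ * ξ 0 := by
  by_cases hx : x = 0
  · exact ⟨LinearIsometryEquiv.refl ℝ _, fun ξ => by simp [hx]⟩
  have hx' : ‖x‖ ≠ 0 := norm_ne_zero_iff.2 hx
  obtain ⟨b, hb⟩ := Orthonormal.exists_orthonormalBasis_extension_of_card_eq (𝕜 := ℝ) (E := Space)
    (ι := Fin 3) (by simp) (v := fun _ => ‖x‖⁻¹ • x) (s := {0}) (by
      constructor
      · rintro ⟨i, hi⟩
        simp [norm_smul, hx']
      · rintro ⟨i, hi⟩ ⟨j, hj⟩ hij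
        simp only [Set.mem_singleton_iff] at hi hj
        subst hi hj
        exact absurd rfl hij)
  refine ⟨b.repr.symm, fun ξ => ?_⟩
  have h0 : x = ‖x‖ • b 0 := by
    rw [hb 0 rfl, smul_smul, mul_inv_cancel₀ hx', one_smul]
  have h1 : inner ℝ (b 0) (b.repr.symm ξ) = ξ 0 := by
    rw [← b.repr_apply_apply]; simp
  conv_lhs => rw [h0]
  rw [real_inner_smul_left, h1]

lemma norm_sq_eq_three (ξ : Space) : ‖ξ‖ ^ 2 = ξ 0 ^ 2 + (ξ 1 ^ 2 + ξ 2 ^ 2) := by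
  rw [EuclideanSpace.norm_sq_eq, Fin.sum_univ_three]
  simp [add_assoc]

/-- The kernel of `e^{-iτ⟨∇⟩}` localised to frequencies `≲ l`, up to the normalisation. -/
def halfWaveKernel (l τ : ℝ) (x : Space) : ℂ :=
  ∫ ξ : Space, Complex.exp (((inner ℝ x ξ - τ * bracket ξ : ℝ) : ℂ) * Complex.I)
    * (wideCutoff (‖ξ‖ ^ 2 / l ^ 2) : ℂ)

lemma hasCompactSupport_wideCutoff {l : ℝ} (hl : 0 < l) :
    HasCompactSupport fun ξ : Space => wideCutoff (‖ξ‖ ^ 2 / l ^ 2) := by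
  refine HasCompactSupport.intro (isCompact_closedBall (0 : Space) (3 * l)) fun ξ hξ => ?_
  refine wideCutoff_of_ge ?_
  rw [Metric.mem_closedBall, dist_zero_right, not_le] at hξ
  rw [le_div_iff₀ (by positivity)]
  nlinarith

/-- Rotate x onto the first axis and use polar coordinates in the orthogonal plane; the weight s is
the Jacobian. The integration ranges can be cut at 3l because the cutoff vanishes once (r² + s²)/l²
≥ 5. -/
lemma halfWaveKernel_eq_planar {l : ℝ} (hl : 0 < l) (τ : ℝ) (x : Space) :
    halfWaveKernel l τ x = (2 * Real.pi : ℝ) * ∫ r in (-(3 * l))..(3 * l),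
      ∫ s in (0 : ℝ)..(3 * l),
        (s : ℂ) * planeOsc ‖x‖ τ r s * (wideCutoff ((r ^ 2 + s ^ 2) / l ^ 2) : ℂ) := by
  obtain ⟨R, hR⟩ := exists_rotation x
  have hcb := continuous_bracket
  set g : ℝ → ℝ → ℂ := fun r u => Complex.exp (((‖x‖ * r - τ * √(1 + (r ^ 2 + u)) : ℝ) : ℂ)
    * Complex.I) * (wideCutoff ((r ^ 2 + u) / l ^ 2) : ℂ)
  have e1 : halfWaveKernel l τ x = ∫ ξ : Space, g (ξ 0) (ξ 1 ^ 2 + ξ 2 ^ 2) := by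
    unfold halfWaveKernel
    rw [← (R.measurePreserving).integral_comp R.toHomeomorph.measurableEmbedding]
    refine integral_congr_ae (ae_of_all _ fun ξ => ?_)
    simp only [g]
    rw [hR, bracket, R.norm_map, norm_sq_eq_three]
  have hint : Integrable (fun p : ℝ × (ℝ × ℝ) => g p.1 (p.2.1 ^ 2 + p.2.2 ^ 2))
      (volume.prod volume) := by
    rw [← Measure.volume_eq_prod, ← measurePreserving_splitCoord.integrable_comp_emb
      splitCoord.measurableEmbedding]
    have hc : Continuous fun ξ : Space => g (ξ 0) (ξ 1 ^ 2 + ξ 2 ^ 2) := by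
      simp only [g]; fun_prop
    refine hc.integrable_of_hasCompactSupport (HasCompactSupport.intro
      (isCompact_closedBall (0 : Space) (3 * l)) fun ξ hξ => ?_)
    simp only [g]
    rw [← norm_sq_eq_three, wideCutoff_of_ge, Complex.ofReal_zero, mul_zero]
    rw [Metric.mem_closedBall, dist_zero_right, not_le] at hξ
    rw [le_div_iff₀ (by positivity)]
    nlinarith
  have e2 : halfWaveKernel l τ x = ∫ r : ℝ, ∫ p : ℝ × ℝ, g r (p.1 ^ 2 + p.2 ^ 2) := by
    rw [e1, ← integral_prod _ hint, ← Measure.volume_eq_prod,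
      ← measurePreserving_splitCoord.integral_comp splitCoord.measurableEmbedding]
    rfl
  have hz : ∀ r s : ℝ, 3 * l < |r| ∨ 3 * l < |s| → g r (s ^ 2) = 0 := fun r s h => by
    simp only [g]
    rw [wideCutoff_of_ge, Complex.ofReal_zero, mul_zero]
    rw [le_div_iff₀ (by positivity)]
    rcases h with h | h
    · nlinarith [sq_abs r, sq_nonneg s]
    · nlinarith [sq_abs s, sq_nonneg r]
  rw [e2]
  simp_rw [integral_radial_plane]
  rw [integral_const_mul]
  congr 1
  have e3 : ∀ r, ∫ s in Set.Ioi (0 : ℝ), (s : ℂ) * g r (s ^ 2)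
      = ∫ s in (0 : ℝ)..(3 * l), (s : ℂ) * g r (s ^ 2) := fun r => by
    rw [intervalIntegral.integral_of_le (by linarith)]
    refine (setIntegral_eq_of_subset_of_forall_sdiff_eq_zero measurableSet_Ioi
      Set.Ioc_subset_Ioi_self fun s hs => ?_)
    rw [hz r s (Or.inr ?_), mul_zero]
    have := hs.2
    simp only [Set.mem_Ioc, not_and, not_le] at this
    exact (this hs.1).trans_le (le_abs_self s)
  simp_rw [e3]
  rw [intervalIntegral.integral_of_le (by linarith)]
  rw [← setIntegral_eq_integral_of_forall_compl_eq_zero (s := Set.Ioc (-(3 * l)) (3 * l))]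
  · refine setIntegral_congr_fun measurableSet_Ioc fun r _ => ?_
    refine intervalIntegral.integral_congr fun s _ => ?_
    simp only [g, planeOsc, bracket₂, add_assoc, mul_assoc]
  · intro r hr
    refine (intervalIntegral.integral_congr (g := fun _ => 0) fun s _ => ?_).trans (by simp)
    have h : g r (s ^ 2) = 0 := by
      simp only [Set.mem_Ioc, not_and_or, not_lt, not_le] at hr
      rcases hr with h | h
      · rcases h.lt_or_eq with h | h
        · exact hz r s (Or.inl (by linarith [neg_le_abs r]))
        · simp only [g]
          rw [wideCutoff_of_ge, Complex.ofReal_zero, mul_zero]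
          rw [le_div_iff₀ (by positivity), h]
          nlinarith [sq_nonneg s]
      · exact hz r s (Or.inl (h.trans_le (le_abs_self r)))
    simp [h]

theorem exists_halfWaveKernel_bound : ∃ C : ℝ, 0 < C ∧ ∀ (l τ : ℝ) (x : Space), 1 ≤ l → τ ≠ 0 →
    ‖halfWaveKernel l τ x‖ ≤ C * (l * √(l ^ 3) / (|τ| * √|τ|)) := by
  obtain ⟨C, hC, h⟩ := exists_planar_bound
  refine ⟨2 * Real.pi * C, by positivity, fun l τ x hl hτ => ?_⟩
  rw [halfWaveKernel_eq_planar (by linarith), norm_mul, Complex.norm_real, Real.norm_of_nonneg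
    (by positivity), mul_assoc _ C]
  exact mul_le_mul_of_nonneg_left (h l τ ‖x‖ hl hτ) (by positivity)

/-! ### The Fourier transform on `L¹ ∩ L²` -/

section FourierL1L2

/-- Test functions are Schwartz functions, so these pairings determine a locally integrable
function. It serves to identify L² Fourier transforms, which are accessible through their action as
tempered distributions. -/
lemma ae_eq_of_forall_schwartz {f : L2} {g : Space → Spinor} (hg : LocallyIntegrable g volume)
    (h : ∀ k : SchwartzMap Space ℂ, ∫ x, k x • f x = ∫ x, k x • g x) : f =ᵐ[volume] g := by
  refine ae_eq_of_integral_contDiff_smul_eq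
    ((Lp.memLp f).locallyIntegrable (by norm_num)) hg fun k hk hkc => ?_
  have hg₁ : HasCompactSupport (Complex.ofRealCLM ∘ k) := hkc.comp_left rfl
  have hg₂ : ContDiff ℝ ∞ (Complex.ofRealCLM ∘ k) := by fun_prop
  simpa using h (hg₁.toSchwartzMap hg₂)

lemma continuous_fourier_of_integrable {f : Space → Spinor} (hf : Integrable f) :
    Continuous (𝓕 f) :=
  VectorFourier.fourierIntegral_continuous Real.continuous_fourierChar
    (by simpa using continuous_inner) hf

lemma continuous_fourierInv_of_integrable {f : Space → Spinor} (hf : Integrable f) :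
    Continuous (𝓕⁻ f) := by
  have : 𝓕⁻ f = fun x => 𝓕 f (-x) := funext fun x => Real.fourierInv_eq_fourier_neg f x
  rw [this]
  exact (continuous_fourier_of_integrable hf).comp continuous_neg

/-- The `L²` Fourier transform of an integrable function is its Fourier integral. -/
lemma fourier_ae_eq_of_integrable {f : L2} (hf : Integrable f) :
    ((𝓕 f : L2) : Space → Spinor) =ᵐ[volume] 𝓕 (f : Space → Spinor) := by
  refine ae_eq_of_forall_schwartz (continuous_fourier_of_integrable hf).locallyIntegrable
    fun k => ?_
  -- As a distribution, the L² transform acts on k by pairing f with 𝓕 k; for integrable f the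
  -- multiplication formula moves the transform back onto f.
  have h1 := Lp.toTemperedDistribution_apply (𝓕 f : L2) k
  rw [← Lp.fourier_toTemperedDistribution_eq, TemperedDistribution.fourier_apply,
    Lp.toTemperedDistribution_apply] at h1
  rw [← h1]
  exact VectorFourier.integral_fourierIntegral_smul_eq_flip (L := innerₗ Space)
    Real.continuous_fourierChar (by simpa using continuous_inner) k.integrable hf |>.trans (by
      rw [flip_innerₗ]; rfl)

/-- The `L²` inverse Fourier transform of an integrable function is its inverse Fourier
integral. -/
lemma fourierInv_ae_eq_of_integrable {f : L2} (hf : Integrable f) :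
    ((𝓕⁻ f : L2) : Space → Spinor) =ᵐ[volume] 𝓕⁻ (f : Space → Spinor) := by
  refine ae_eq_of_forall_schwartz (continuous_fourierInv_of_integrable hf).locallyIntegrable
    fun k => ?_
  have h1 := Lp.toTemperedDistribution_apply (𝓕⁻ f : L2) k
  rw [← Lp.fourierInv_toTemperedDistribution_eq, TemperedDistribution.fourierInv_apply,
    Lp.toTemperedDistribution_apply] at h1
  rw [← h1]
  have hc : Continuous fun p : Space × Space => (-innerₗ Space) p.1 p.2 :=
    (continuous_inner (𝕜 := ℝ) (E := Space)).neg
  have h2 := VectorFourier.integral_fourierIntegral_smul_eq_flip (L := -innerₗ Space)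
    (f := k) (g := (f : Space → Spinor)) (μ := volume) (ν := volume)
    Real.continuous_fourierChar hc k.integrable hf
  have : (-innerₗ Space).flip = -innerₗ Space := by
    ext x y; simp [real_inner_comm]
  rw [this] at h2
  rw [SchwartzMap.fourierInv_coe]
  exact h2

end FourierL1L2

/-! ### Algebra of Fourier multipliers -/

section Multiplier

lemma fourier_multiplier_ae (m : Space →ᵇ (Spinor →L[ℂ] Spinor)) (f : L2) :
    ((𝓕 (multiplier m f) : L2) : Space → Spinor)
      =ᵐ[volume] fun η => m ((2 * Real.pi) • η) ((𝓕 f : L2) η) := by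
  unfold multiplier
  rw [FourierTransform.fourier_fourierInv_eq (F := L2)]
  exact MemLp.coeFn_toLp _

lemma fourier_injective {f g : L2} (h : (𝓕 f : L2) = 𝓕 g) : f = g := by
  simpa only [FourierTransform.fourierInv_fourier_eq] using congrArg (fun k : L2 => (𝓕⁻ k : L2)) h

/-- Injectivity of 𝓕 on L² turns every identity between multipliers into a pointwise identity
between symbols. -/
lemma eq_multiplier_iff {m : Space →ᵇ (Spinor →L[ℂ] Spinor)} {f g : L2} :
    g = multiplier m f ↔ ((𝓕 g : L2) : Space → Spinor)
      =ᵐ[volume] fun η => m ((2 * Real.pi) • η) ((𝓕 f : L2) η) := by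
  constructor
  · rintro rfl
    exact fourier_multiplier_ae m f
  · intro h
    exact fourier_injective (Lp.ext (h.trans (fourier_multiplier_ae m f).symm))

variable {m m₁ m₂ : Space →ᵇ (Spinor →L[ℂ] Spinor)}

lemma multiplier_multiplier (h : ∀ ξ v, m ξ v = m₁ ξ (m₂ ξ v)) (f : L2) :
    multiplier m₁ (multiplier m₂ f) = multiplier m f := by
  rw [eq_multiplier_iff]
  filter_upwards [fourier_multiplier_ae m₁ (multiplier m₂ f), fourier_multiplier_ae m₂ f]
    with η h1 h2
  rw [h1, h2, h]

lemma multiplier_add_symbol (h : ∀ ξ v, m ξ v = m₁ ξ v + m₂ ξ v) (f : L2) :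
    multiplier m₁ f + multiplier m₂ f = multiplier m f := by
  rw [eq_multiplier_iff, FourierTransform.fourier_add]
  filter_upwards [Lp.coeFn_add (𝓕 (multiplier m₁ f) : L2) (𝓕 (multiplier m₂ f)),
    fourier_multiplier_ae m₁ f, fourier_multiplier_ae m₂ f] with η h0 h1 h2
  rw [h0, Pi.add_apply, h1, h2, h]

lemma multiplier_add (f g : L2) : multiplier m (f + g) = multiplier m f + multiplier m g := by
  symm
  rw [eq_multiplier_iff, FourierTransform.fourier_add, FourierTransform.fourier_add]
  filter_upwards [Lp.coeFn_add (𝓕 (multiplier m f) : L2) (𝓕 (multiplier m g)),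
    Lp.coeFn_add (𝓕 f : L2) (𝓕 g),
    fourier_multiplier_ae m f, fourier_multiplier_ae m g] with η h0 h0' h1 h2
  rw [h0, h0', Pi.add_apply, Pi.add_apply, h1, h2, map_add]

lemma multiplier_zero : multiplier m 0 = 0 := by
  have := multiplier_add (m := m) 0 0
  simpa using this

lemma multiplier_neg (f : L2) : multiplier m (-f) = -multiplier m f := by
  rw [eq_neg_iff_add_eq_zero, ← multiplier_add, neg_add_cancel, multiplier_zero]

lemma multiplier_sub (f g : L2) : multiplier m (f - g) = multiplier m f - multiplier m g := by
  rw [sub_eq_add_neg, multiplier_add, multiplier_neg, sub_eq_add_neg]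

lemma norm_multiplier_le (h : ∀ ξ v, ‖m ξ v‖ ≤ ‖v‖) (f : L2) : ‖multiplier m f‖ ≤ ‖f‖ := by
  rw [← Lp.norm_fourier_eq (multiplier m f), ← Lp.norm_fourier_eq f]
  refine Lp.norm_le_norm_of_ae_le ?_
  filter_upwards [fourier_multiplier_ae m f] with η h1
  rw [h1]
  exact h _ _

lemma norm_multiplier_eq (h : ∀ ξ v, ‖m ξ v‖ = ‖v‖) (f : L2) : ‖multiplier m f‖ = ‖f‖ := by
  refine le_antisymm (norm_multiplier_le (fun ξ v => (h ξ v).le) f) ?_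
  rw [← Lp.norm_fourier_eq (multiplier m f), ← Lp.norm_fourier_eq f]
  refine Lp.norm_le_norm_of_ae_le ?_
  filter_upwards [fourier_multiplier_ae m f] with η h1
  rw [h1]
  exact (h _ _).ge

end Multiplier

/-! ### The Dirac matrices and the free symbol -/

section Dirac

/-- The matrix `Σ ξ_j αʲ + μ β`. -/
def diracMatrix (ξ : Space) (μ : ℝ) : Matrix (Fin 4) (Fin 4) ℂ :=
  ∑ j, ((ξ j : ℝ) : ℂ) • (gamma 0 * gamma j.succ) + ((μ : ℝ) : ℂ) • gamma 0

/-- The operator `Σ ξ_j αʲ + μ β`. -/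
def diracOp (ξ : Space) (μ : ℝ) : Spinor →L[ℂ] Spinor :=
  ∑ j, ((ξ j : ℝ) : ℂ) • alpha j + ((μ : ℝ) : ℂ) • beta

lemma act_diracMatrix (ξ : Space) (μ : ℝ) : act (diracMatrix ξ μ) = diracOp ξ μ := by
  simp only [act, diracMatrix, diracOp, alpha, beta, map_add, map_sum, map_smul]

lemma act_mul_apply (A B : Matrix (Fin 4) (Fin 4) ℂ) (v : Spinor) :
    act (A * B) v = act A (act B v) := by
  simp only [act, map_mul]; rfl

/-- The Clifford relations, checked entrywise. They yield D² = ⟨ξ⟩² for the free symbol and |ξ·α v|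
= |ξ||v|, the source of the unit propagation speed. -/
lemma diracMatrix_sq (ξ : Space) (μ : ℝ) :
    diracMatrix ξ μ * diracMatrix ξ μ = ((‖ξ‖ ^ 2 + μ ^ 2 : ℝ) : ℂ) • 1 := by
  rw [norm_sq_eq_three]
  ext i j
  fin_cases i <;> fin_cases j <;>
    simp [diracMatrix, gamma, Fin.sum_univ_three, Matrix.mul_apply, Fin.sum_univ_four] <;>
    ring_nf <;> simp [Complex.I_sq]

lemma diracMatrix_conjTranspose (ξ : Space) (μ : ℝ) :
    (diracMatrix ξ μ).conjTranspose = diracMatrix ξ μ := by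
  ext i j
  fin_cases i <;> fin_cases j <;>
    simp [diracMatrix, gamma, Fin.sum_univ_three]

lemma diracOp_diracOp (ξ : Space) (μ : ℝ) (v : Spinor) :
    diracOp ξ μ (diracOp ξ μ v) = ((‖ξ‖ ^ 2 + μ ^ 2 : ℝ) : ℂ) • v := by
  rw [← act_diracMatrix, ← act_mul_apply, diracMatrix_sq]
  simp [act]

lemma inner_act_of_conjTranspose {A : Matrix (Fin 4) (Fin 4) ℂ} (h : A.conjTranspose = A)
    (u v : Spinor) : inner ℂ (act A u) v = inner ℂ u (act A v) := by
  have h1 : ContinuousLinearMap.adjoint (act A) = act A := by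
    have : star (act A) = act (star A) := (map_star (Matrix.toEuclideanCLM (𝕜 := ℂ)) A).symm
    rw [Matrix.star_eq_conjTranspose, h] at this
    exact this
  conv_lhs => rw [← h1]
  rw [ContinuousLinearMap.adjoint_inner_left]

lemma inner_diracOp (ξ : Space) (μ : ℝ) (u v : Spinor) :
    inner ℂ (diracOp ξ μ u) v = inner ℂ u (diracOp ξ μ v) := by
  rw [← act_diracMatrix]
  exact inner_act_of_conjTranspose (diracMatrix_conjTranspose ξ μ) u v

lemma norm_diracOp_sq (ξ : Space) (μ : ℝ) (v : Spinor) :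
    ‖diracOp ξ μ v‖ ^ 2 = (‖ξ‖ ^ 2 + μ ^ 2) * ‖v‖ ^ 2 := by
  rw [← inner_self_eq_norm_sq (𝕜 := ℂ), inner_diracOp, diracOp_diracOp, inner_smul_right,
    ← inner_self_eq_norm_sq (𝕜 := ℂ) v]
  exact Complex.re_ofReal_mul _ _

lemma diracOp_zero_left : diracOp 0 1 = beta := by
  ext1 v; simp [diracOp]

lemma diracOp_single (j : Fin 3) : diracOp (EuclideanSpace.single j 1) 0 = alpha j := by
  ext1 v; fin_cases j <;> simp [diracOp, Fin.sum_univ_three]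

lemma norm_beta (v : Spinor) : ‖beta v‖ = ‖v‖ := by
  have := norm_diracOp_sq 0 1 v
  rw [diracOp_zero_left] at this
  exact (sq_eq_sq₀ (norm_nonneg _) (norm_nonneg _)).1 (by simpa using this)

lemma inner_beta (u v : Spinor) : inner ℂ (beta u) v = inner ℂ u (beta v) := by
  rw [← diracOp_zero_left]; exact inner_diracOp 0 1 u v

lemma beta_beta (v : Spinor) : beta (beta v) = v := by
  rw [← diracOp_zero_left, diracOp_diracOp]; simp

lemma inner_alpha (j : Fin 3) (u v : Spinor) : inner ℂ (alpha j u) v = inner ℂ u (alpha j v) := by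
  rw [← diracOp_single]; exact inner_diracOp _ _ u v

lemma norm_diracOp_zero_right (ξ : Space) (v : Spinor) : ‖diracOp ξ 0 v‖ = ‖ξ‖ * ‖v‖ := by
  have := norm_diracOp_sq ξ 0 v
  refine (sq_eq_sq₀ (norm_nonneg _) (by positivity)).1 ?_
  rw [this]; ring

lemma act_gamma_zero_eq_beta : act (gamma 0) = beta := rfl

lemma alpha_apply (j : Fin 3) (v : Spinor) : alpha j v = beta (act (gamma j.succ) v) := by
  simp only [alpha, beta, act_mul_apply]

lemma projSymbol_apply (s : ℤˣ) (ξ : Space) (v : Spinor) : projSymbol s ξ v =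
    (1 / 2 : ℂ) • (v + (((s : ℤ) : ℂ) * ((bracket ξ)⁻¹ : ℝ)) • diracOp ξ 1 v) := by
  simp [projSymbol, diracOp]

lemma halfWaveSymbol_apply (s : ℤˣ) (t : ℝ) (ξ : Space) (v : Spinor) : halfWaveSymbol s t ξ v =
    Complex.exp ((-(((s : ℤ) : ℝ) * t * bracket ξ) : ℝ) * Complex.I) • v := by
  simp [halfWaveSymbol]

lemma bracket_sq (ξ : Space) : bracket ξ ^ 2 = 1 + ‖ξ‖ ^ 2 := Real.sq_sqrt (by positivity)

/-- Since D² = ⟨ξ⟩², the matrix (1/2)(1 + sD/⟨ξ⟩) maps into the eigenspace of D for the eigenvalue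
s⟨ξ⟩. This makes the plane waves below solve the Dirac equation. -/
lemma diracOp_projSymbol (s : ℤˣ) (ξ : Space) (v : Spinor) :
    diracOp ξ 1 (projSymbol s ξ v) = (((s : ℤ) : ℝ) * bracket ξ : ℝ) • projSymbol s ξ v := by
  have hb : (bracket ξ : ℂ) ≠ 0 := by exact_mod_cast (bracket_pos ξ).ne'
  have hs : ((s : ℤ) : ℂ) * ((s : ℤ) : ℂ) = 1 := by
    rcases Int.units_eq_one_or s with h | h <;> simp [h]
  have h2 : ((‖ξ‖ ^ 2 + 1 ^ 2 : ℝ) : ℂ) = (bracket ξ : ℂ) ^ 2 := by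
    rw [← Complex.ofReal_pow, bracket_sq]; push_cast; ring
  rw [projSymbol_apply, map_smul, map_add, map_smul, diracOp_diracOp, h2,
    ← Complex.coe_smul]
  simp only [smul_add, smul_smul]
  rw [add_comm]
  congr 2
  · push_cast
    field_simp
  · push_cast
    field_simp
    linear_combination -hs

/-- The symbol of the free Dirac propagator. -/
def freeSymbol (t : ℝ) : Space →ᵇ (Spinor →L[ℂ] Spinor) :=
  halfWaveSymbol 1 t * projSymbol 1 + halfWaveSymbol (-1) t * projSymbol (-1)

lemma freeSymbol_apply (t : ℝ) (ξ : Space) (v : Spinor) : freeSymbol t ξ v =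
    halfWaveSymbol 1 t ξ (projSymbol 1 ξ v) + halfWaveSymbol (-1) t ξ (projSymbol (-1) ξ v) := rfl

lemma freeDirac_eq_multiplier (φ : L2) (t : ℝ) : freeDirac φ t = multiplier (freeSymbol t) φ := by
  unfold freeDirac halfWave diracProj
  rw [multiplier_multiplier (m := halfWaveSymbol 1 t * projSymbol 1) (fun _ _ => rfl),
    multiplier_multiplier (m := halfWaveSymbol (-1) t * projSymbol (-1)) (fun _ _ => rfl)]
  exact multiplier_add_symbol (fun _ _ => rfl) φ

/-- Euler's formula for e^{-itD} with D² = ⟨ξ⟩²; unitarity is read off from this form. -/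
lemma freeSymbol_apply' (t : ℝ) (ξ : Space) (v : Spinor) : freeSymbol t ξ v =
    (Real.cos (t * bracket ξ) : ℂ) • v
      + (-Complex.I * ((Real.sin (t * bracket ξ) / bracket ξ : ℝ) : ℂ)) • diracOp ξ 1 v := by
  rw [freeSymbol_apply, halfWaveSymbol_apply, halfWaveSymbol_apply, projSymbol_apply,
    projSymbol_apply]
  have e1 : Complex.exp ((-(((1 : ℤˣ) : ℤ) * t * bracket ξ) : ℝ) * Complex.I)
      = Real.cos (t * bracket ξ) - Real.sin (t * bracket ξ) * Complex.I := by
    rw [Complex.exp_mul_I]; simp [sub_eq_add_neg]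
  have e2 : Complex.exp ((-((((-1 : ℤˣ) : ℤ) : ℝ) * t * bracket ξ) : ℝ) * Complex.I)
      = Real.cos (t * bracket ξ) + Real.sin (t * bracket ξ) * Complex.I := by
    rw [Complex.exp_mul_I]; simp
  rw [e1, e2]
  simp only [smul_add, smul_smul]
  rw [add_add_add_comm, ← add_smul, ← add_smul]
  congr 2
  · ring
  · push_cast
    field_simp
    simp
    ring

lemma norm_freeSymbol (t : ℝ) (ξ : Space) (v : Spinor) : ‖freeSymbol t ξ v‖ = ‖v‖ := by
  refine (sq_eq_sq₀ (norm_nonneg _) (norm_nonneg _)).1 ?_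
  have hb := (bracket_pos ξ).ne'
  have him : (inner ℂ v (diracOp ξ 1 v)).im = 0 := by
    have h := inner_conj_symm (𝕜 := ℂ) v (diracOp ξ 1 v)
    rw [inner_diracOp] at h
    exact Complex.conj_eq_iff_im.1 h
  rw [freeSymbol_apply', norm_add_sq (𝕜 := ℂ), norm_smul, norm_smul, inner_smul_left,
    inner_smul_right, mul_pow, mul_pow, norm_diracOp_sq, norm_mul, Complex.norm_real,
    Complex.norm_real, norm_neg, Complex.norm_I, one_mul, Real.norm_eq_abs, Real.norm_eq_abs,
    sq_abs, sq_abs, div_pow, one_pow, add_comm (‖ξ‖ ^ 2), ← bracket_sq]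
  -- The cross term is i times a real number, because D is self-adjoint.
  have h2 : RCLike.re ((starRingEnd ℂ) (Real.cos (t * bracket ξ) : ℂ) *
      (-Complex.I * ((Real.sin (t * bracket ξ) / bracket ξ : ℝ) : ℂ) *
        inner ℂ v (diracOp ξ 1 v))) = 0 := by
    simp [Complex.mul_re, Complex.mul_im, him, -Complex.ofReal_cos, -Complex.ofReal_sin]
  rw [h2]
  have := Real.cos_sq_add_sin_sq (t * bracket ξ)
  field_simp
  linear_combination ‖v‖ ^ 2 * this

lemma norm_freeDirac (φ : L2) (t : ℝ) : ‖freeDirac φ t‖ = ‖φ‖ := by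
  rw [freeDirac_eq_multiplier]
  exact norm_multiplier_eq (norm_freeSymbol t) φ

lemma freeDirac_sub (φ χ : L2) (t : ℝ) : freeDirac (φ - χ) t = freeDirac φ t - freeDirac χ t := by
  simp only [freeDirac_eq_multiplier, multiplier_sub]

end Dirac

/-! ### The dispersive estimate -/

section Dispersive

lemma L2_norm_sq_eq_integral (f : L2) : ‖f‖ ^ 2 = ∫ x, ‖f x‖ ^ 2 := by
  have h := congrArg Complex.re (L2.inner_def (𝕜 := ℂ) f f)
  have h1 : (inner ℂ f f : ℂ).re = ‖f‖ ^ 2 := inner_self_eq_norm_sq (𝕜 := ℂ) f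
  rw [← h1, h]
  have h2 : ∀ x, (inner ℂ (f x) (f x) : ℂ) = ((‖f x‖ ^ 2 : ℝ) : ℂ) := fun x => by
    rw [inner_self_eq_norm_sq_to_K]; simp
  simp_rw [h2, integral_complex_ofReal, Complex.ofReal_re]

lemma integrable_norm_sq (f : L2) : Integrable fun x => ‖f x‖ ^ 2 :=
  (memLp_two_iff_integrable_sq_norm (Lp.memLp f).1).1 (Lp.memLp f)

/-- The symbol of the half-wave propagator localised to frequencies `≲ 2ⁿ`. -/
def wideHalfWaveSymbol (n : ℕ) (s : ℤˣ) (t : ℝ) : Space →ᵇ (Spinor →L[ℂ] Spinor) :=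
  BoundedContinuousFunction.ofNormedAddCommGroup
    (fun ξ : Space => (Complex.exp ((-(((s : ℤ) : ℝ) * t * bracket ξ) : ℝ) * Complex.I)
      * (wideCutoff (‖ξ‖ ^ 2 / (2 ^ n) ^ 2) : ℂ)) • (1 : Spinor →L[ℂ] Spinor))
    (by have := continuous_bracket; fun_prop) 1
    (fun ξ => norm_smul_one_le (by
      rw [norm_mul, Complex.norm_exp_ofReal_mul_I, one_mul, Complex.norm_real,
        Real.norm_of_nonneg (wideCutoff_nonneg _)]
      exact wideCutoff_le_one _))

lemma wideHalfWaveSymbol_apply (n : ℕ) (s : ℤˣ) (t : ℝ) (ξ : Space) (v : Spinor) :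
    wideHalfWaveSymbol n s t ξ v =
    (Complex.exp ((-(((s : ℤ) : ℝ) * t * bracket ξ) : ℝ) * Complex.I)
      * (wideCutoff (‖ξ‖ ^ 2 / (2 ^ n) ^ 2) : ℂ)) • v := by
  simp [wideHalfWaveSymbol]

lemma lpSymbol_apply (n : ℕ) (ξ : Space) (v : Spinor) :
    lpSymbol n ξ v = (lpProfile n ‖ξ‖ : ℂ) • v := by
  simp [lpSymbol]

lemma lowCutoff_of_ge {r : ℝ} (h : 9 / 5 ≤ r) : lowCutoff r = 0 :=
  Real.smoothTransition.zero_of_nonpos (by linarith)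

lemma lowCutoff_of_le {r : ℝ} (h : r ≤ 6 / 5) : lowCutoff r = 1 :=
  Real.smoothTransition.one_of_one_le (by linarith)

lemma lpProfile_of_ge {n : ℕ} {r : ℝ} (h : 9 / 5 * 2 ^ n ≤ r) : lpProfile n r = 0 := by
  unfold lpProfile
  split_ifs with hn
  · subst hn
    exact lowCutoff_of_ge (by linarith)
  · have h1 : 9 / 5 ≤ r / 2 ^ n := by rw [le_div_iff₀ (by positivity)]; exact h
    rw [lowCutoff_of_ge h1, lowCutoff_of_ge (by linarith), sub_zero]

/-- The profile lives on ‖ξ‖ ≤ (9/5) 2ⁿ, and (9/5)² < 4, so the wide cutoff equals 1 there. The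
half-wave acting on a dyadic piece may thus be given a compactly supported symbol. -/
lemma wideCutoff_mul_lpProfile (n : ℕ) (ξ : Space) :
    wideCutoff (‖ξ‖ ^ 2 / (2 ^ n) ^ 2) * lpProfile n ‖ξ‖ = lpProfile n ‖ξ‖ := by
  rcases le_total (9 / 5 * 2 ^ n) ‖ξ‖ with h | h
  · rw [lpProfile_of_ge h, mul_zero]
  · rw [wideCutoff_of_le, one_mul]
    rw [div_le_iff₀ (by positivity)]
    have : (0 : ℝ) < 2 ^ n := by positivity
    nlinarith [norm_nonneg ξ]

lemma halfWave_lp (n : ℕ) (s : ℤˣ) (t : ℝ) (f : L2) :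
    halfWave s t (multiplier (lpSymbol n) f)
      = multiplier (wideHalfWaveSymbol n s t) (multiplier (lpSymbol n) f) := by
  unfold halfWave
  rw [multiplier_multiplier (m := halfWaveSymbol s t * lpSymbol n) (fun _ _ => rfl),
    multiplier_multiplier (m := halfWaveSymbol s t * lpSymbol n) (fun ξ v => ?_)]
  change halfWaveSymbol s t ξ (lpSymbol n ξ v) = _
  rw [halfWaveSymbol_apply, lpSymbol_apply, wideHalfWaveSymbol_apply, smul_smul, smul_smul,
    mul_assoc (Complex.exp _), ← Complex.ofReal_mul, wideCutoff_mul_lpProfile]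

/-- The scalar symbol defining `wideHalfWaveSymbol`, in the variable `η = ξ / 2π`. -/
lemma wideHalfWave_kernel (n : ℕ) (s : ℤˣ) (t : ℝ) (x y : Space) :
    𝓕 (fun η : Space => Complex.exp (((2 * Real.pi * inner ℝ η x : ℝ) : ℂ) * Complex.I)
      * (Complex.exp ((-(((s : ℤ) : ℝ) * t * bracket ((2 * Real.pi) • η)) : ℝ) * Complex.I)
      * (wideCutoff (‖(2 * Real.pi) • η‖ ^ 2 / (2 ^ n) ^ 2) : ℂ))) y
      = |((2 * Real.pi) ^ 3)⁻¹| • halfWaveKernel (2 ^ n) (((s : ℤ) : ℝ) * t) (x - y) := by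
  rw [Real.fourier_eq']
  unfold halfWaveKernel
  have h := Measure.integral_comp_smul (volume : Measure Space) (fun ξ : Space =>
    Complex.exp (((inner ℝ (x - y) ξ - ((s : ℤ) : ℝ) * t * bracket ξ : ℝ) : ℂ) * Complex.I)
    * (wideCutoff (‖ξ‖ ^ 2 / (2 ^ n) ^ 2) : ℂ)) (2 * Real.pi)
  rw [finrank_euclideanSpace_fin] at h
  rw [← h]
  refine integral_congr_ae (ae_of_all _ fun η => ?_)
  simp only [smul_eq_mul, ← mul_assoc]
  rw [← Complex.exp_add, ← Complex.exp_add]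
  congr 2
  rw [inner_smul_right, inner_sub_left, real_inner_comm x η, real_inner_comm y η]
  push_cast
  ring

lemma continuous_wideScalar (n : ℕ) (s : ℤˣ) (t : ℝ) (x : Space) : Continuous fun η : Space =>
    Complex.exp (((2 * Real.pi * inner ℝ η x : ℝ) : ℂ) * Complex.I)
      * (Complex.exp ((-(((s : ℤ) : ℝ) * t * bracket ((2 * Real.pi) • η)) : ℝ) * Complex.I)
      * (wideCutoff (‖(2 * Real.pi) • η‖ ^ 2 / (2 ^ n) ^ 2) : ℂ)) := by
  have := continuous_bracket
  fun_prop

lemma integrable_wideScalar (n : ℕ) (s : ℤˣ) (t : ℝ) (x : Space) : Integrable fun η : Space =>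
    Complex.exp (((2 * Real.pi * inner ℝ η x : ℝ) : ℂ) * Complex.I)
      * (Complex.exp ((-(((s : ℤ) : ℝ) * t * bracket ((2 * Real.pi) • η)) : ℝ) * Complex.I)
      * (wideCutoff (‖(2 * Real.pi) • η‖ ^ 2 / (2 ^ n) ^ 2) : ℂ)) := by
  refine (continuous_wideScalar n s t x).integrable_of_hasCompactSupport ?_
  have h := (hasCompactSupport_wideCutoff (l := 2 ^ n) (by positivity)).comp_homeomorph
    (Homeomorph.smulOfNeZero (2 * Real.pi) (by positivity))
  have h2 := (h.comp_left (g := fun u : ℝ => (u : ℂ)) (by simp)).mul_left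
    (f := fun η : Space => Complex.exp (((2 * Real.pi * inner ℝ η x : ℝ) : ℂ) * Complex.I)
      * Complex.exp ((-(((s : ℤ) : ℝ) * t * bracket ((2 * Real.pi) • η)) : ℝ) * Complex.I))
  refine h2.mono' ?_
  refine subset_trans ?_ subset_closure
  intro η hη
  simpa [Function.mem_support, Function.comp_def] using hη

/-- The kernel representation bounds a frequency-localised half-wave pointwise. -/
lemma ae_norm_wideHalfWave_le {B : ℝ} (n : ℕ) (s : ℤˣ) (t : ℝ)
    (hB : ∀ x, ‖halfWaveKernel (2 ^ n) (((s : ℤ) : ℝ) * t) x‖ ≤ B) {g : L2} (hg : Integrable g) :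
    ∀ᵐ x, ‖multiplier (wideHalfWaveSymbol n s t) g x‖ ≤ B * ∫ y, ‖g y‖ := by
  set m := wideHalfWaveSymbol n s t
  set h : L2 := (multiplier_memLp m (𝓕 g)).toLp
  have hh : (h : Space → Spinor) =ᵐ[volume] fun η => m ((2 * Real.pi) • η) ((𝓕 g : L2) η) :=
    MemLp.coeFn_toLp _
  have hg1 := fourier_ae_eq_of_integrable hg
  have hh' : (h : Space → Spinor) =ᵐ[volume] fun η =>
      (Complex.exp ((-(((s : ℤ) : ℝ) * t * bracket ((2 * Real.pi) • η)) : ℝ) * Complex.I)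
      * (wideCutoff (‖(2 * Real.pi) • η‖ ^ 2 / (2 ^ n) ^ 2) : ℂ)) • 𝓕 (g : Space → Spinor) η := by
    filter_upwards [hh, hg1] with η h1 h2
    rw [h1, h2, wideHalfWaveSymbol_apply]
  have hgc := continuous_fourier_of_integrable hg
  have hbd : ∀ η, ‖𝓕 (g : Space → Spinor) η‖ ≤ ∫ y, ‖g y‖ := fun η =>
    VectorFourier.norm_fourierIntegral_le_integral_norm _ _ _ _ _
  have hhi : Integrable h := by
    rw [integrable_congr hh']
    have h0 := integrable_wideScalar n s t 0
    simp only [inner_zero_right, mul_zero, Complex.ofReal_zero, zero_mul, Complex.exp_zero,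
      one_mul] at h0
    exact h0.smul_bdd _ hgc.aestronglyMeasurable (ae_of_all _ hbd)
  have hm : multiplier m g = (𝓕⁻ h : L2) := rfl
  have h3 := fourierInv_ae_eq_of_integrable hhi
  filter_upwards [h3] with x hx
  rw [hm, hx, Real.fourierInv_congr_ae hh', Real.fourierInv_eq']
  have e : ∀ η : Space, Complex.exp (((2 * Real.pi * inner ℝ η x : ℝ) : ℂ) * Complex.I) •
      ((Complex.exp ((-(((s : ℤ) : ℝ) * t * bracket ((2 * Real.pi) • η)) : ℝ) * Complex.I)
      * (wideCutoff (‖(2 * Real.pi) • η‖ ^ 2 / (2 ^ n) ^ 2) : ℂ)) • 𝓕 (g : Space → Spinor) η)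
      = (Complex.exp (((2 * Real.pi * inner ℝ η x : ℝ) : ℂ) * Complex.I)
      * (Complex.exp ((-(((s : ℤ) : ℝ) * t * bracket ((2 * Real.pi) • η)) : ℝ) * Complex.I)
      * (wideCutoff (‖(2 * Real.pi) • η‖ ^ 2 / (2 ^ n) ^ 2) : ℂ))) • 𝓕 (g : Space → Spinor) η :=
    fun η => smul_smul _ _ _
  simp_rw [e]
  -- The multiplication formula transfers the transform from g to the exponential times the symbol,
  -- producing convolution of g with the kernel.
  have h4 := VectorFourier.integral_fourierIntegral_smul_eq_flip (L := innerₗ Space)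
    (f := fun η : Space => Complex.exp (((2 * Real.pi * inner ℝ η x : ℝ) : ℂ) * Complex.I)
      * (Complex.exp ((-(((s : ℤ) : ℝ) * t * bracket ((2 * Real.pi) • η)) : ℝ) * Complex.I)
      * (wideCutoff (‖(2 * Real.pi) • η‖ ^ 2 / (2 ^ n) ^ 2) : ℂ)))
    (g := (g : Space → Spinor)) (μ := volume) (ν := volume)
    Real.continuous_fourierChar (by simpa using continuous_inner) (integrable_wideScalar n s t x) hg
  rw [flip_innerₗ] at h4
  refine (congrArg norm h4.symm).le.trans ?_
  rw [← integral_const_mul]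
  refine norm_integral_le_of_norm_le (hg.norm.const_mul B) (ae_of_all _ fun y => ?_)
  rw [norm_smul]
  refine mul_le_mul_of_nonneg_right ?_ (norm_nonneg _)
  have h5 := wideHalfWave_kernel n s t x y
  refine (congrArg norm h5).le.trans ?_
  rw [norm_smul, Real.norm_eq_abs, abs_abs]
  -- The change of variable ξ = 2πη gives a factor (2π)⁻³ ≤ 1, which is dropped.
  refine (mul_le_of_le_one_left (norm_nonneg _) ?_).trans (hB _)
  rw [abs_of_pos (by positivity)]
  exact inv_le_one_of_one_le₀ (one_le_pow₀ (by linarith [Real.pi_gt_three]))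

lemma dyadic_five_halves (n : ℕ) :
    ((2 : ℝ≥0∞) ^ n) ^ (5 / 2 : ℝ) = ENNReal.ofReal ((2 : ℝ) ^ n * √(((2 : ℝ) ^ n) ^ 3)) := by
  have h : (0 : ℝ) < 2 ^ n := by positivity
  have e : (2 : ℝ) ^ n * √(((2 : ℝ) ^ n) ^ 3) = ((2 : ℝ) ^ n) ^ (5 / 2 : ℝ) := by
    rw [Real.sqrt_eq_rpow, ← Real.rpow_natCast ((2 : ℝ) ^ n) 3, ← Real.rpow_mul h.le]
    nth_rewrite 1 [← Real.rpow_one ((2 : ℝ) ^ n)]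
    rw [← Real.rpow_add h]
    norm_num
  rw [e, ← ENNReal.ofReal_rpow_of_pos h, ENNReal.ofReal_pow (by norm_num)]
  norm_num

/-- The L¹–L^∞ bound by the sup of the kernel at l = 2ⁿ, where l √(l³) = (2ⁿ)^{5/2} is exactly the
Besov weight of the nth dyadic piece. -/
theorem exists_halfWave_lp_bound : ∃ C : ℝ, 0 < C ∧ ∀ (n : ℕ) (s : ℤˣ) (t : ℝ) (f : L2), 0 < t →
    eLpNorm (multiplier (lpSymbol n) f) 1 volume ≠ ⊤ →
    eLpNorm (halfWave s t (multiplier (lpSymbol n) f)) ⊤ volume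
      ≤ ENNReal.ofReal (C / (t * √t))
        * (((2 : ℝ≥0∞) ^ n) ^ (5 / 2 : ℝ) * eLpNorm (multiplier (lpSymbol n) f) 1 volume) := by
  obtain ⟨C, hC, hK⟩ := exists_halfWaveKernel_bound
  refine ⟨C, hC, fun n s t f ht hfin => ?_⟩
  set g := multiplier (lpSymbol n) f
  have hgi : Integrable g := by
    rw [← memLp_one_iff_integrable]
    exact ⟨(Lp.memLp g).1, hfin.lt_top⟩
  have hs : |((s : ℤ) : ℝ) * t| = t := by
    rw [abs_mul, abs_of_pos ht]
    rcases Int.units_eq_one_or s with h | h <;> simp [h]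
  have hs0 : ((s : ℤ) : ℝ) * t ≠ 0 := by
    intro h; rw [h, abs_zero] at hs; exact ht.ne hs
  have hB := ae_norm_wideHalfWave_le n s t (fun x => hK (2 ^ n) (((s : ℤ) : ℝ) * t) x
    (one_le_pow₀ (by norm_num)) hs0) hgi
  rw [hs] at hB
  rw [halfWave_lp, eLpNorm_exponent_top]
  have e : eLpNorm g 1 volume = ENNReal.ofReal (∫ y, ‖g y‖) := by
    rw [eLpNorm_one_eq_lintegral_enorm, ofReal_integral_norm_eq_lintegral_enorm hgi]
  rw [e, dyadic_five_halves, ← ENNReal.ofReal_mul (by positivity),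
    ← ENNReal.ofReal_mul (by positivity)]
  refine eLpNormEssSup_le_of_ae_bound ?_
  filter_upwards [hB] with x hx
  refine hx.trans (le_of_eq ?_)
  ring

/-! ### Low-frequency truncation and summation of the dyadic pieces. -/

lemma continuous_lowCutoff : Continuous lowCutoff := by
  unfold lowCutoff
  exact Real.smoothTransition.continuous.comp (by fun_prop)

/-- The symbol of the projection to frequencies `≲ 2ⁿ`. -/
def lowSymbol (n : ℕ) : Space →ᵇ (Spinor →L[ℂ] Spinor) :=
  BoundedContinuousFunction.ofNormedAddCommGroup
    (fun ξ : Space => ((lowCutoff (‖ξ‖ / 2 ^ n) : ℝ) : ℂ) • (1 : Spinor →L[ℂ] Spinor))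
    (by have := continuous_lowCutoff; fun_prop) 1
    (fun ξ => norm_smul_one_le (by
      simpa [lpProfile] using norm_lpProfile_le 0 (‖ξ‖ / 2 ^ n)))

lemma lowSymbol_apply (n : ℕ) (ξ : Space) (v : Spinor) :
    lowSymbol n ξ v = ((lowCutoff (‖ξ‖ / 2 ^ n) : ℝ) : ℂ) • v := by
  simp [lowSymbol]

/-- The projection to frequencies `≲ 2ⁿ`. -/
def lowPart (n : ℕ) (f : L2) : L2 := multiplier (lowSymbol n) f

lemma lowCutoff_nonneg (r : ℝ) : 0 ≤ lowCutoff r := Real.smoothTransition.nonneg _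

lemma lowCutoff_le_one (r : ℝ) : lowCutoff r ≤ 1 := Real.smoothTransition.le_one _

lemma lowPart_zero (f : L2) : lowPart 0 f = multiplier (lpSymbol 0) f := by
  unfold lowPart
  congr 1
  ext ξ v
  rw [lowSymbol_apply, lpSymbol_apply]
  simp [lpProfile]

/-- The dyadic profiles are differences of consecutive low-frequency cutoffs, so they telescope. -/
lemma lowPart_succ (n : ℕ) (f : L2) :
    lowPart (n + 1) f = lowPart n f + multiplier (lpSymbol (n + 1)) f := by
  unfold lowPart
  refine (multiplier_add_symbol (fun ξ v => ?_) f).symm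
  rw [lowSymbol_apply, lowSymbol_apply, lpSymbol_apply, ← add_smul]
  congr 1
  rw [← Complex.ofReal_add]
  congr 1
  have : 2 * (‖ξ‖ / 2 ^ (n + 1)) = ‖ξ‖ / 2 ^ n := by rw [pow_succ]; field_simp
  simp only [lpProfile, Nat.succ_ne_zero, if_false, this]
  ring

lemma norm_lowPart_le (n : ℕ) (f : L2) : ‖lowPart n f‖ ≤ ‖f‖ :=
  norm_multiplier_le (fun ξ v => by
    rw [lowSymbol_apply, norm_smul, Complex.norm_real, Real.norm_of_nonneg (lowCutoff_nonneg _)]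
    exact mul_le_of_le_one_left (norm_nonneg _) (lowCutoff_le_one _)) f

lemma tendsto_integral_norm_sub_sq {f : Space → Spinor} (hf : MemLp f 2 volume)
    {c : ℕ → Space → ℝ} (hc : ∀ n, Continuous (c n)) (hc0 : ∀ n η, 0 ≤ c n η)
    (hc1 : ∀ n η, c n η ≤ 1) (hlim : ∀ η, ∀ᶠ n in atTop, c n η = 1) :
    Tendsto (fun n => ∫ η, ‖(c n η : ℂ) • f η - f η‖ ^ 2) atTop (𝓝 0) := by
  have h0 : (0 : ℝ) = ∫ _ : Space, (0 : ℝ) := by simp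
  rw [h0]
  refine tendsto_integral_of_dominated_convergence (fun η => ‖f η‖ ^ 2) (fun n => ?_)
    ((memLp_two_iff_integrable_sq_norm hf.1).1 hf) (fun n => ae_of_all _ fun η => ?_)
    (ae_of_all _ fun η => ?_)
  · have h1 : AEStronglyMeasurable (fun η => (c n η : ℂ)) volume :=
      (Complex.continuous_ofReal.comp (hc n)).aestronglyMeasurable
    have h2 : AEStronglyMeasurable (fun η => (c n η : ℂ) • f η - f η) volume :=
      (h1.smul hf.1).sub hf.1
    exact (continuous_pow 2).comp_aestronglyMeasurable h2.norm
  · have e : (c n η : ℂ) • f η - f η = ((c n η : ℂ) - 1) • f η := by rw [sub_smul, one_smul]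
    rw [e, norm_smul, mul_pow, Real.norm_of_nonneg (by positivity)]
    refine mul_le_of_le_one_left (by positivity) ?_
    rw [← Complex.ofReal_one, ← Complex.ofReal_sub, Complex.norm_real, Real.norm_eq_abs, sq_abs]
    nlinarith [hc0 n η, hc1 n η]
  · refine tendsto_const_nhds.congr' ?_
    filter_upwards [hlim η] with n hn
    rw [hn]
    simp

lemma norm_lowPart_sub_sq (n : ℕ) (f : L2) : ‖lowPart n f - f‖ ^ 2 = ∫ η : Space,
    ‖((lowCutoff (‖(2 * Real.pi) • η‖ / 2 ^ n) : ℝ) : ℂ) • (𝓕 f : L2) η - (𝓕 f : L2) η‖ ^ 2 := by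
  have h0 : (𝓕 (lowPart n f - f) : L2) = 𝓕 (lowPart n f) - 𝓕 f :=
    map_sub (Lp.fourierTransformₗᵢ Space Spinor) _ _
  rw [← Lp.norm_fourier_eq, h0, L2_norm_sq_eq_integral]
  refine integral_congr_ae ?_
  filter_upwards [Lp.coeFn_sub (𝓕 (lowPart n f) : L2) (𝓕 f),
    fourier_multiplier_ae (lowSymbol n) f] with η h1 h2
  rw [h1, Pi.sub_apply, lowPart, h2, lowSymbol_apply]

lemma tendsto_lowPart (f : L2) : Tendsto (fun n => lowPart n f) atTop (𝓝 f) := by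
  rw [tendsto_iff_norm_sub_tendsto_zero]
  have hlc := continuous_lowCutoff
  have key := tendsto_integral_norm_sub_sq (Lp.memLp (𝓕 f : L2))
    (c := fun n η => lowCutoff (‖(2 * Real.pi) • η‖ / 2 ^ n)) (fun n => by fun_prop)
    (fun _ _ => lowCutoff_nonneg _) (fun _ _ => lowCutoff_le_one _) fun η => by
      have ht : Tendsto (fun n : ℕ => ‖(2 * Real.pi) • η‖ / 2 ^ n) atTop (𝓝 0) :=
        tendsto_const_nhds.div_atTop (tendsto_pow_atTop_atTop_of_one_lt (by norm_num))
      filter_upwards [ht.eventually (gt_mem_nhds (by norm_num : (0 : ℝ) < 6 / 5))] with n hn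
      exact lowCutoff_of_le hn.le
  simp_rw [← norm_lowPart_sub_sq] at key
  have := key.sqrt
  simpa [Real.sqrt_sq] using this

/-- Truncated sums of dyadic pieces are dominated by the full Besov series; the bound does not
depend on n. -/
lemma halfWave_lowPart_le {B : ℝ} {n : ℕ} {s : ℤˣ} {t : ℝ} {f : L2}
    (h : ∀ k, eLpNorm (halfWave s t (multiplier (lpSymbol k) f)) ⊤ volume
      ≤ ENNReal.ofReal B * (((2 : ℝ≥0∞) ^ k) ^ (5 / 2 : ℝ)
        * eLpNorm (multiplier (lpSymbol k) f) 1 volume)) :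
    eLpNorm (halfWave s t (lowPart n f)) ⊤ volume ≤ ENNReal.ofReal B * besovNorm (5 / 2) f := by
  have hsum : eLpNorm (halfWave s t (lowPart n f)) ⊤ volume ≤ ∑ k ∈ Finset.range (n + 1),
      ENNReal.ofReal B * (((2 : ℝ≥0∞) ^ k) ^ (5 / 2 : ℝ)
        * eLpNorm (multiplier (lpSymbol k) f) 1 volume) := by
    induction n with
    | zero => simpa [lowPart_zero] using h 0
    | succ n ih =>
      rw [Finset.sum_range_succ, lowPart_succ, halfWave, multiplier_add,
        eLpNorm_congr_ae (Lp.coeFn_add _ _)]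
      refine (eLpNorm_add_le (Lp.memLp _).1 (Lp.memLp _).1 le_top).trans (add_le_add ih (h _))
  refine hsum.trans ?_
  rw [← Finset.mul_sum]
  gcongr
  exact ENNReal.sum_le_tsum _

/-- L² convergence gives an almost everywhere convergent subsequence, along which the sup norm is
lower semicontinuous. -/
lemma eLpNorm_top_le_of_tendsto {f : ℕ → L2} {g : L2} (h : Tendsto f atTop (𝓝 g)) {B : ℝ≥0∞}
    (hB : ∀ n, eLpNorm (f n) ⊤ volume ≤ B) : eLpNorm g ⊤ volume ≤ B := by
  obtain ⟨ns, -, hns⟩ := (tendstoInMeasure_of_tendsto_Lp h).exists_seq_tendsto_ae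
  refine (Lp.eLpNorm_lim_le_liminf_eLpNorm (fun n => (Lp.memLp (f (ns n))).1) g hns).trans ?_
  exact liminf_le_of_le (by isBoundedDefault) fun b hb =>
    let ⟨n, hn⟩ := hb.exists; hn.trans (hB _)

lemma multiplier_comm_lowPart {m : Space →ᵇ (Spinor →L[ℂ] Spinor)} (n : ℕ) (f : L2) :
    multiplier m (lowPart n f) = lowPart n (multiplier m f) := by
  unfold lowPart
  rw [multiplier_multiplier (m := m * lowSymbol n) (fun _ _ => rfl),
    multiplier_multiplier (m := m * lowSymbol n) (fun ξ v => ?_)]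
  change m ξ (lowSymbol n ξ v) = _
  rw [lowSymbol_apply, lowSymbol_apply, map_smul]

lemma freeDirac_lowPart (n : ℕ) (φ : L2) (t : ℝ) : freeDirac (lowPart n φ) t
    = halfWave 1 t (lowPart n (diracProj 1 φ)) + halfWave (-1) t (lowPart n (diracProj (-1) φ)) := by
  unfold freeDirac diracProj
  rw [multiplier_comm_lowPart, multiplier_comm_lowPart]

lemma freeDirac_lowPart_eq (n : ℕ) (φ : L2) (t : ℝ) :
    freeDirac (lowPart n φ) t = lowPart n (freeDirac φ t) := by
  rw [freeDirac_eq_multiplier, freeDirac_eq_multiplier, multiplier_comm_lowPart]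

/-- The dispersive estimate for free Dirac solutions with data in `B^{5/2}_{1,1}`, and for their
low-frequency truncations. -/
theorem exists_dispersive_bound (φ : L2) (hp : besovNorm (5 / 2) (diracProj 1 φ) < ⊤)
    (hm : besovNorm (5 / 2) (diracProj (-1) φ) < ⊤) : ∃ M : ℝ, 0 < M ∧ ∀ t : ℝ, 0 < t →
      (∀ᵐ x, ‖freeDirac φ t x‖ ≤ M / (t * √t)) ∧
      ∀ n, ∀ᵐ x, ‖freeDirac (lowPart n φ) t x‖ ≤ M / (t * √t) := by
  obtain ⟨C, hC, hb⟩ := exists_halfWave_lp_bound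
  set b := (besovNorm (5 / 2) (diracProj 1 φ) + besovNorm (5 / 2) (diracProj (-1) φ)).toReal
  -- The summand 1 keeps M positive when both Besov norms vanish.
  refine ⟨C * (b + 1), by positivity, fun t ht => ?_⟩
  have hterm : ∀ f : L2, besovNorm (5 / 2) f < ⊤ → ∀ k,
      eLpNorm (multiplier (lpSymbol k) f) 1 volume ≠ ⊤ := fun f hf k hk => by
    have h1 := ENNReal.le_tsum (f := fun n : ℕ => ((2 : ℝ≥0∞) ^ n) ^ (5 / 2 : ℝ)
      * eLpNorm (multiplier (lpSymbol n) f) 1 volume) k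
    have h2 : ((2 : ℝ≥0∞) ^ k) ^ (5 / 2 : ℝ) ≠ 0 := by
      rw [dyadic_five_halves]
      have : (0 : ℝ) < 2 ^ k := by positivity
      simp
    simp only [hk, ENNReal.mul_top h2] at h1
    exact (h1.trans_lt hf).ne rfl
  have hlow : ∀ n, eLpNorm (freeDirac (lowPart n φ) t) ⊤ volume
      ≤ ENNReal.ofReal (C * (b + 1) / (t * √t)) := fun n => by
    have h1 := halfWave_lowPart_le (n := n) (fun k => hb k 1 t _ ht (hterm _ hp k))
    have h2 := halfWave_lowPart_le (n := n) (fun k => hb k (-1) t _ ht (hterm _ hm k))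
    rw [freeDirac_lowPart, eLpNorm_congr_ae (Lp.coeFn_add _ _)]
    refine (eLpNorm_add_le (Lp.memLp _).1 (Lp.memLp _).1 le_top).trans
      ((add_le_add h1 h2).trans ?_)
    rw [← mul_add, ← ENNReal.ofReal_toReal (ENNReal.add_lt_top.2 ⟨hp, hm⟩).ne,
      ← ENNReal.ofReal_mul (by positivity)]
    refine ENNReal.ofReal_le_ofReal ?_
    rw [mul_div_right_comm]
    gcongr
    linarith
  have hlim : eLpNorm (freeDirac φ t) ⊤ volume ≤ ENNReal.ofReal (C * (b + 1) / (t * √t)) := by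
    refine eLpNorm_top_le_of_tendsto (f := fun n => freeDirac (lowPart n φ) t) ?_ hlow
    simp_rw [freeDirac_lowPart_eq]
    exact tendsto_lowPart _
  have hconv : ∀ f : L2, eLpNorm f ⊤ volume ≤ ENNReal.ofReal (C * (b + 1) / (t * √t)) →
      ∀ᵐ x, ‖f x‖ ≤ C * (b + 1) / (t * √t) := fun f hf => by
    rw [eLpNorm_exponent_top] at hf
    filter_upwards [ae_le_eLpNormEssSup (f := (f : Space → Spinor)) (μ := volume)] with x hx
    have := hx.trans hf
    rw [← ofReal_norm] at this
    exact (ENNReal.ofReal_le_ofReal_iff (by positivity)).1 this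
  exact ⟨hconv _ hlim, fun n => hconv _ (hlow n)⟩

end Dispersive

/-! ### Classical solutions of the linear Dirac equation with a potential -/

section Classical

/-- `u` is a `C¹` solution of `∂ₜu = -Σ αʲ ∂ⱼu - iβu + iVβu`. -/
structure IsDiracSolution (V : ℝ → Space → ℝ) (u : ℝ → Space → Spinor) : Prop where
  contDiff : ContDiff ℝ 1 (fun p : ℝ × Space => u p.1 p.2)
  equation : ∀ t x, deriv (fun s => u s x) t
    = -(∑ j, alpha j (fderiv ℝ (u t) x (EuclideanSpace.single j (1 : ℝ))))
      - Complex.I • beta (u t x) + (Complex.I * (V t x : ℂ)) • beta (u t x)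

/-- The inclusion of the time axis. -/
lemma hasFDerivAt_prodMk_time (t : ℝ) (x : Space) :
    HasFDerivAt (fun s : ℝ => (s, x)) (ContinuousLinearMap.inl ℝ ℝ Space) t :=
  hasFDerivAt_prodMk_left t x

lemma hasDerivAt_time {E : Type*} [NormedAddCommGroup E] [NormedSpace ℝ E]
    {u : ℝ → Space → E} (h : ContDiff ℝ 1 (fun p : ℝ × Space => u p.1 p.2)) (t : ℝ) (x : Space) :
    HasDerivAt (fun s => u s x) (fderiv ℝ (fun p : ℝ × Space => u p.1 p.2) (t, x) (1, 0)) t := by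
  have h1 := (h.differentiable (by norm_num) (t, x)).hasFDerivAt.comp t
    (hasFDerivAt_prodMk_time t x)
  simpa [Function.comp_def] using h1.hasDerivAt

lemma hasFDerivAt_space {E : Type*} [NormedAddCommGroup E] [NormedSpace ℝ E]
    {u : ℝ → Space → E} (h : ContDiff ℝ 1 (fun p : ℝ × Space => u p.1 p.2)) (t : ℝ) (x : Space) :
    HasFDerivAt (u t) ((fderiv ℝ (fun p : ℝ × Space => u p.1 p.2) (t, x)).comp
      (ContinuousLinearMap.inr ℝ ℝ Space)) x :=
  (h.differentiable (by norm_num) (t, x)).hasFDerivAt.comp x (hasFDerivAt_prodMk_right t x)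

lemma IsDiracSolution.add {V : ℝ → Space → ℝ} {u v : ℝ → Space → Spinor}
    (hu : IsDiracSolution V u) (hv : IsDiracSolution V v) :
    IsDiracSolution V (fun t x => u t x + v t x) where
  contDiff := hu.contDiff.add hv.contDiff
  equation t x := by
    have h1 := (hasDerivAt_time hu.contDiff t x).differentiableAt
    have h2 := (hasDerivAt_time hv.contDiff t x).differentiableAt
    have h3 := (hasFDerivAt_space hu.contDiff t x).differentiableAt
    have h4 := (hasFDerivAt_space hv.contDiff t x).differentiableAt
    rw [deriv_fun_add h1 h2, hu.equation, hv.equation, fderiv_fun_add h3 h4]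
    simp only [add_apply, map_add, smul_add, Finset.sum_add_distrib, neg_add]
    abel

/-- The linear phase `(t, x) ↦ 2π η·x - s t ⟨2πη⟩`. -/
def phase (s : ℤˣ) (η : Space) : ℝ × Space →L[ℝ] ℝ :=
  ((2 * Real.pi) • innerSL ℝ η).comp (ContinuousLinearMap.snd ℝ ℝ Space)
    - (((s : ℤ) : ℝ) * bracket ((2 * Real.pi) • η)) • ContinuousLinearMap.fst ℝ ℝ Space

lemma phase_apply (s : ℤˣ) (η : Space) (p : ℝ × Space) :
    phase s η p = 2 * Real.pi * inner ℝ η p.2 - ((s : ℤ) : ℝ) * bracket ((2 * Real.pi) • η) * p.1 := by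
  simp [phase]

lemma continuous_phase (s : ℤˣ) : Continuous (phase s) := by
  have := continuous_bracket
  unfold phase
  have h1 : Continuous fun η : Space => ((2 * Real.pi) • innerSL ℝ η).comp
      (ContinuousLinearMap.snd ℝ ℝ Space) :=
    (((innerSL ℝ).continuous.const_smul (2 * Real.pi))).clm_comp continuous_const
  refine h1.sub ?_
  fun_prop

variable {L : Space → (ℝ × Space →L[ℝ] ℝ)} {a : Space → Spinor} {R : ℝ}

/-- On a bounded frequency support a continuous weight is bounded. This provides the majorants for
differentiating superpositions of plane waves under the integral. -/
lemma integrable_smul_of_support {E : Type*} [NormedAddCommGroup E]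
    {g : Space → E} (ha : Integrable a) (hsupp : ∀ᵐ η, R < ‖η‖ → a η = 0)
    {c : Space → ℝ} (hc : Continuous c) (hg : AEStronglyMeasurable g volume)
    (hle : ∀ η, ‖g η‖ ≤ c η * ‖a η‖) : Integrable g := by
  obtain ⟨C, hC⟩ := (isCompact_closedBall (0 : Space) R).exists_bound_of_continuousOn hc.continuousOn
  refine (ha.norm.const_mul C).mono' hg ?_
  filter_upwards [hsupp] with η h
  rcases lt_or_ge R ‖η‖ with h1 | h1
  · have := hle η
    rw [h h1, norm_zero, mul_zero] at this
    rw [h h1, norm_zero, mul_zero]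
    exact this
  · refine (hle η).trans (mul_le_mul_of_nonneg_right ?_ (norm_nonneg _))
    exact (le_abs_self _).trans (hC η (by simpa using h1))

/-- The superposition `p ↦ ∫ e^{i L_η(p)} a(η) dη` of plane waves. -/
def planeWaves (L : Space → (ℝ × Space →L[ℝ] ℝ)) (a : Space → Spinor) (p : ℝ × Space) : Spinor :=
  ∫ η, Complex.exp ((L η p : ℂ) * Complex.I) • a η

lemma aestronglyMeasurable_planeWave (hL : Continuous L) (ha : AEStronglyMeasurable a volume)
    (p : ℝ × Space) :
    AEStronglyMeasurable (fun η => Complex.exp ((L η p : ℂ) * Complex.I) • a η) volume := by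
  have h : Continuous fun η => Complex.exp ((L η p : ℂ) * Complex.I) := by fun_prop
  exact h.aestronglyMeasurable.smul ha

lemma norm_planeWave (η : Space) (p : ℝ × Space) :
    ‖Complex.exp ((L η p : ℂ) * Complex.I) • a η‖ = ‖a η‖ := by
  rw [norm_smul, Complex.norm_exp_ofReal_mul_I, one_mul]

lemma integrable_planeWave (hL : Continuous L) (ha : Integrable a) (p : ℝ × Space) :
    Integrable fun η => Complex.exp ((L η p : ℂ) * Complex.I) • a η :=
  ha.mono (aestronglyMeasurable_planeWave hL ha.1 p) (ae_of_all _ fun η => (norm_planeWave η p).le)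

lemma hasFDerivAt_planeWave (η : Space) (p : ℝ × Space) :
    HasFDerivAt (fun p => Complex.exp ((L η p : ℂ) * Complex.I) • a η)
      ((L η).smulRight (Complex.I • Complex.exp ((L η p : ℂ) * Complex.I) • a η)) p := by
  have h1 : HasDerivAt (fun r : ℝ => Complex.exp ((r : ℂ) * Complex.I) • a η)
      (Complex.I • Complex.exp ((L η p : ℂ) * Complex.I) • a η) (L η p) := by
    have := (((Complex.ofRealCLM.hasDerivAt (x := L η p)).mul_const Complex.I).cexp).smul_const (a η)
    simpa [smul_smul, mul_comm] using this
  exact (h1.hasFDerivAt.comp p (L η).hasFDerivAt).congr_fderiv (by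
    ext q <;> simp)

lemma hasFDerivAt_planeWaves (hL : Continuous L) (ha : Integrable a)
    (hsupp : ∀ᵐ η, R < ‖η‖ → a η = 0) (p : ℝ × Space) :
    HasFDerivAt (planeWaves L a)
      (∫ η, (L η).smulRight (Complex.I • Complex.exp ((L η p : ℂ) * Complex.I) • a η)) p
      ∧ Integrable (fun η => (L η).smulRight
        (Complex.I • Complex.exp ((L η p : ℂ) * Complex.I) • a η)) := by
  have hmeas : ∀ p, AEStronglyMeasurable (fun η => (L η).smulRight
      (Complex.I • Complex.exp ((L η p : ℂ) * Complex.I) • a η)) volume := fun p => by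
    exact (ContinuousLinearMap.smulRightL ℝ (ℝ × Space) Spinor).aestronglyMeasurable_comp₂
      hL.aestronglyMeasurable ((aestronglyMeasurable_planeWave hL ha.1 p).const_smul Complex.I)
  have hbd : ∀ η p, ‖(L η).smulRight (Complex.I • Complex.exp ((L η p : ℂ) * Complex.I) • a η)‖
      ≤ ‖L η‖ * ‖a η‖ := fun η p => by
    rw [ContinuousLinearMap.norm_smulRight_apply, norm_smul, norm_planeWave]
    simp
  refine ⟨hasFDerivAt_integral_of_dominated_of_fderiv_le (bound := fun η => ‖L η‖ * ‖a η‖)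
    (F' := fun p η => (L η).smulRight (Complex.I • Complex.exp ((L η p : ℂ) * Complex.I) • a η))
    (s := Set.univ) univ_mem (Eventually.of_forall fun p => aestronglyMeasurable_planeWave hL ha.1 p)
    (integrable_planeWave hL ha p) (hmeas p)
    (ae_of_all _ fun η q _ => hbd η q) ?_ (ae_of_all _ fun η q _ => hasFDerivAt_planeWave η q), ?_⟩
  · exact integrable_smul_of_support ha hsupp hL.norm
      (hL.norm.aestronglyMeasurable.mul ha.1.norm) fun η => by simp
  · exact integrable_smul_of_support ha hsupp hL.norm (hmeas p) fun η => hbd η p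

lemma contDiff_planeWaves (hL : Continuous L) (ha : Integrable a)
    (hsupp : ∀ᵐ η, R < ‖η‖ → a η = 0) : ContDiff ℝ 1 (planeWaves L a) := by
  rw [contDiff_one_iff_fderiv]
  refine ⟨fun p => (hasFDerivAt_planeWaves hL ha hsupp p).1.differentiableAt, ?_⟩
  have e : fderiv ℝ (planeWaves L a) = fun p => ∫ η, (L η).smulRight
      (Complex.I • Complex.exp ((L η p : ℂ) * Complex.I) • a η) :=
    funext fun p => (hasFDerivAt_planeWaves hL ha hsupp p).1.fderiv
  rw [e]
  refine continuous_of_dominated (bound := fun η => ‖L η‖ * ‖a η‖)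
    (fun p => (hasFDerivAt_planeWaves hL ha hsupp p).2.1) (fun p => ae_of_all _ fun η => ?_)
    (integrable_smul_of_support ha hsupp hL.norm
      (hL.norm.aestronglyMeasurable.mul ha.1.norm) fun η => by simp) (ae_of_all _ fun η => ?_)
  · rw [ContinuousLinearMap.norm_smulRight_apply, norm_smul, norm_planeWave]
    simp
  · have h1 : Continuous fun p => Complex.I • Complex.exp ((L η p : ℂ) * Complex.I) • a η := by
      fun_prop
    exact ((ContinuousLinearMap.smulRightL ℝ (ℝ × Space) Spinor) (L η)).continuous.comp h1

lemma fderiv_planeWaves_apply (hL : Continuous L) (ha : Integrable a)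
    (hsupp : ∀ᵐ η, R < ‖η‖ → a η = 0) (p q : ℝ × Space) :
    fderiv ℝ (planeWaves L a) p q
      = ∫ η, (L η q : ℂ) • Complex.I • Complex.exp ((L η p : ℂ) * Complex.I) • a η := by
  obtain ⟨h1, h2⟩ := hasFDerivAt_planeWaves hL ha hsupp p
  rw [h1.fderiv, ContinuousLinearMap.integral_apply h2]
  simp

/-- Each plane wave has frequency -s⟨ξ⟩ in time, and its amplitude is an eigenvector of the Dirac
symbol with eigenvalue s⟨ξ⟩; these match pointwise in η under the integral. -/
lemma isDiracSolution_planeWaves (s : ℤˣ) (ha : Integrable a)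
    (hsupp : ∀ᵐ η, R < ‖η‖ → a η = 0)
    (heig : ∀ η, diracOp ((2 * Real.pi) • η) 1 (a η)
      = (((s : ℤ) : ℝ) * bracket ((2 * Real.pi) • η) : ℝ) • a η) :
    IsDiracSolution (fun _ _ => 0) (fun t x => planeWaves (phase s) a (t, x)) := by
  have hL := continuous_phase s
  have hC := contDiff_planeWaves hL ha hsupp
  refine ⟨hC, fun t x => ?_⟩
  have hC' : ContDiff ℝ 1 (fun p : ℝ × Space => (fun t x => planeWaves (phase s) a (t, x)) p.1 p.2) :=
    hC
  have et := (hasDerivAt_time (u := fun t x => planeWaves (phase s) a (t, x)) hC' t x).deriv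
  have ex := (hasFDerivAt_space (u := fun t x => planeWaves (phase s) a (t, x)) hC' t x).fderiv
  rw [et, ex]
  simp only [Complex.ofReal_zero, mul_zero, zero_smul, add_zero, ContinuousLinearMap.comp_apply,
    ContinuousLinearMap.inr_apply]
  change fderiv ℝ (planeWaves (phase s) a) (t, x) (1, 0)
    = -(∑ j, alpha j (fderiv ℝ (planeWaves (phase s) a) (t, x) (0, EuclideanSpace.single j 1)))
      - Complex.I • beta (planeWaves (phase s) a (t, x))
  simp_rw [fderiv_planeWaves_apply hL ha hsupp]
  set E : Space → Spinor := fun η => Complex.exp ((phase s η (t, x) : ℂ) * Complex.I) • a η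
  have hE : Integrable E := integrable_planeWave hL ha _
  have hi : ∀ q, Integrable fun η => (phase s η q : ℂ) • Complex.I • E η := fun q => by
    have := (hasFDerivAt_planeWaves hL ha hsupp (t, x)).2.apply_continuousLinearMap q
    simpa using this
  change ∫ η, (phase s η (1, 0) : ℂ) • Complex.I • E η
    = -(∑ j, alpha j (∫ η, (phase s η (0, EuclideanSpace.single j 1) : ℂ) • Complex.I • E η))
      - Complex.I • beta (∫ η, E η)
  have e1 : ∀ j, alpha j (∫ η, (phase s η (0, EuclideanSpace.single j 1) : ℂ) • Complex.I • E η)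
      = ∫ η, alpha j ((phase s η (0, EuclideanSpace.single j 1) : ℂ) • Complex.I • E η) :=
    fun j => ((alpha j).integral_comp_comm (hi _)).symm
  have e2 : Complex.I • beta (∫ η, E η) = ∫ η, Complex.I • beta (E η) := by
    rw [integral_smul, beta.integral_comp_comm hE]
  rw [e2]
  simp_rw [e1]
  have i1 : Integrable fun η => -∑ j : Fin 3,
      alpha j ((phase s η (0, EuclideanSpace.single j 1) : ℂ) • Complex.I • E η) :=
    (integrable_finsetSum _ fun j _ => (alpha j).integrable_comp (hi _)).neg
  have i2 : Integrable fun η => Complex.I • beta (E η) :=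
    (Complex.I • beta).integrable_comp hE
  rw [← integral_finsetSum _ fun j _ => (alpha j).integrable_comp (hi _), ← integral_neg,
    ← integral_sub i1 i2]
  refine integral_congr_ae (ae_of_all _ fun η => ?_)
  have h1 : diracOp ((2 * Real.pi) • η) 1 (E η)
      = (((s : ℤ) : ℝ) * bracket ((2 * Real.pi) • η) : ℝ) • E η := by
    change diracOp _ 1 (Complex.exp ((phase s η (t, x) : ℂ) * Complex.I) • a η) = _
    rw [map_smul, heig, smul_comm]
  have h2 : diracOp ((2 * Real.pi) • η) 1 (E η)
      = ∑ j, ((2 * Real.pi * η j : ℝ) : ℂ) • alpha j (E η) + beta (E η) := by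
    simp [diracOp]
  have h3 : ∀ j : Fin 3, phase s η (0, EuclideanSpace.single j 1) = 2 * Real.pi * η j := fun j => by
    rw [phase_apply]; simp [EuclideanSpace.inner_single_right]
  have h4 : phase s η (1, 0) = -(((s : ℤ) : ℝ) * bracket ((2 * Real.pi) • η)) := by
    rw [phase_apply]; simp
  simp only [h3, h4, map_smul]
  have h5 : ∑ j, ((2 * Real.pi * η j : ℝ) : ℂ) • Complex.I • alpha j (E η)
      = Complex.I • ((((s : ℤ) : ℝ) * bracket ((2 * Real.pi) • η) : ℝ) • E η - beta (E η)) := by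
    rw [← h1, h2, add_sub_cancel_right, Finset.smul_sum]
    exact Finset.sum_congr rfl fun j _ => smul_comm _ _ _
  rw [h5]
  clear_value E
  rw [← Complex.coe_smul, smul_sub, Complex.ofReal_neg, neg_smul, smul_comm Complex.I]
  abel

end Classical

/-! ### A classical version of band-limited free solutions -/

section BandLimited

/-- The classical version of the free Dirac solution with band-limited data. -/
def classicalFree (f : L2) (t : ℝ) (x : Space) : Spinor :=
  planeWaves (phase 1) (fun η => projSymbol 1 ((2 * Real.pi) • η) ((𝓕 f : L2) η)) (t, x)
  + planeWaves (phase (-1)) (fun η => projSymbol (-1) ((2 * Real.pi) • η) ((𝓕 f : L2) η)) (t, x)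

variable {f : L2} {R : ℝ}

lemma integrable_fourier_of_support (hsupp : ∀ᵐ η, R < ‖η‖ → (𝓕 f : L2) η = 0) :
    Integrable (𝓕 f : L2) := by
  have : IsFiniteMeasure (volume.restrict (Metric.closedBall (0 : Space) R)) :=
    ⟨by rw [Measure.restrict_apply_univ]; exact measure_closedBall_lt_top⟩
  have h : IntegrableOn (𝓕 f : L2) (Metric.closedBall 0 R) :=
    ((Lp.memLp (𝓕 f : L2)).restrict _).integrable (by norm_num)
  refine h.integrable_of_ae_notMem_eq_zero ?_
  filter_upwards [hsupp] with η h1 h2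
  exact h1 (by simpa using h2)

lemma integrable_projSymbol (s : ℤˣ) (hi : Integrable (𝓕 f : L2)) :
    Integrable fun η => projSymbol s ((2 * Real.pi) • η) ((𝓕 f : L2) η) := by
  have h1 : AEStronglyMeasurable (fun η : Space => projSymbol s ((2 * Real.pi) • η)) volume :=
    ((projSymbol s).continuous.comp (continuous_const_smul _)).aestronglyMeasurable
  refine (hi.norm.const_mul ‖projSymbol s‖).mono'
    ((ContinuousLinearMap.apply ℂ Spinor).flip.aestronglyMeasurable_comp₂ h1 hi.1)
    (ae_of_all _ fun η => (ContinuousLinearMap.le_opNorm _ _).trans ?_)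
  exact mul_le_mul_of_nonneg_right ((projSymbol s).norm_coe_le_norm _) (norm_nonneg _)

lemma projSymbol_support (s : ℤˣ) (hsupp : ∀ᵐ η, R < ‖η‖ → (𝓕 f : L2) η = 0) :
    ∀ᵐ η : Space, R < ‖η‖ → projSymbol s ((2 * Real.pi) • η) ((𝓕 f : L2) η) = 0 := by
  filter_upwards [hsupp] with η h h1
  rw [h h1, map_zero]

lemma isDiracSolution_classicalFree (hsupp : ∀ᵐ η, R < ‖η‖ → (𝓕 f : L2) η = 0) :
    IsDiracSolution (fun _ _ => 0) (classicalFree f) := by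
  have hi := integrable_fourier_of_support hsupp
  exact (isDiracSolution_planeWaves 1 (integrable_projSymbol 1 hi) (projSymbol_support 1 hsupp)
    fun η => diracOp_projSymbol _ _ _).add
    (isDiracSolution_planeWaves (-1) (integrable_projSymbol (-1) hi) (projSymbol_support (-1) hsupp)
    fun η => diracOp_projSymbol _ _ _)

lemma exp_smul_freeSymbol (t : ℝ) (x η : Space) (v : Spinor) :
    Complex.exp (((2 * Real.pi * inner ℝ η x : ℝ) : ℂ) * Complex.I)
      • freeSymbol t ((2 * Real.pi) • η) v
    = Complex.exp ((phase 1 η (t, x) : ℂ) * Complex.I) • projSymbol 1 ((2 * Real.pi) • η) v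
      + Complex.exp ((phase (-1) η (t, x) : ℂ) * Complex.I)
        • projSymbol (-1) ((2 * Real.pi) • η) v := by
  rw [freeSymbol_apply, halfWaveSymbol_apply, halfWaveSymbol_apply, smul_add, smul_smul, smul_smul,
    ← Complex.exp_add, ← Complex.exp_add, phase_apply, phase_apply]
  congr 3
  · push_cast; ring_nf
  · push_cast; ring_nf

lemma classicalFree_eq_integral (hi : Integrable (𝓕 f : L2)) (t : ℝ) (x : Space) :
    classicalFree f t x = ∫ η, Complex.exp (((2 * Real.pi * inner ℝ η x : ℝ) : ℂ) * Complex.I)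
      • freeSymbol t ((2 * Real.pi) • η) ((𝓕 f : L2) η) := by
  simp_rw [exp_smul_freeSymbol]
  rw [integral_add
    (integrable_planeWave (a := fun η => projSymbol 1 ((2 * Real.pi) • η) ((𝓕 f : L2) η))
      (continuous_phase 1) (integrable_projSymbol 1 hi) (t, x))
    (integrable_planeWave (a := fun η => projSymbol (-1) ((2 * Real.pi) • η) ((𝓕 f : L2) η))
      (continuous_phase (-1)) (integrable_projSymbol (-1) hi) (t, x))]
  rfl

/-- Both sides are the inverse Fourier integral of the propagated data. Bounded support makes the L²
data integrable, so that integral converges absolutely. -/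
lemma freeDirac_ae_eq_classicalFree (hsupp : ∀ᵐ η, R < ‖η‖ → (𝓕 f : L2) η = 0) (t : ℝ) :
    (freeDirac f t : Space → Spinor) =ᵐ[volume] classicalFree f t := by
  have hi := integrable_fourier_of_support hsupp
  obtain ⟨h, hm, hh⟩ : ∃ h : L2, freeDirac f t = (𝓕⁻ h : L2) ∧ (h : Space → Spinor) =ᵐ[volume]
      fun η => freeSymbol t ((2 * Real.pi) • η) ((𝓕 f : L2) η) :=
    ⟨_, freeDirac_eq_multiplier f t, MemLp.coeFn_toLp _⟩
  have hhi : Integrable h := by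
    refine hi.mono (Lp.memLp h).1 ?_
    filter_upwards [hh] with η h1
    rw [h1, norm_freeSymbol]
  filter_upwards [fourierInv_ae_eq_of_integrable hhi] with x hx
  rw [hm, hx, Real.fourierInv_congr_ae hh, Real.fourierInv_eq', classicalFree_eq_integral hi]

/-- In the variable η = ξ/2π the cutoff vanishes from (9/5) 2ⁿ / 2π on, well below 2ⁿ. -/
lemma fourier_lowPart_support (n : ℕ) (φ : L2) :
    ∀ᵐ η, (2 : ℝ) ^ n < ‖η‖ → (𝓕 (lowPart n φ) : L2) η = 0 := by
  filter_upwards [fourier_multiplier_ae (lowSymbol n) φ] with η h h1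
  rw [lowPart, h, lowSymbol_apply, lowCutoff_of_ge, Complex.ofReal_zero, zero_smul]
  rw [le_div_iff₀ (by positivity), norm_smul, Real.norm_of_nonneg (by positivity)]
  have : (0 : ℝ) < 2 ^ n := by positivity
  nlinarith [Real.pi_gt_three]

end BandLimited

/-! ### Local conservation laws -/

section Conservation

/-- The supports of `F t ·` are bounded, locally uniformly in `t`. -/
def LocallyBoundedSupport {E : Type*} [Zero E] (F : ℝ → Space → E) : Prop :=
  ∀ T : ℝ, ∃ r : ℝ, ∀ t, |t| ≤ T → ∀ x, r < ‖x‖ → F t x = 0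

lemma LocallyBoundedSupport.hasCompactSupport {E : Type*} [Zero E] {F : ℝ → Space → E}
    (h : LocallyBoundedSupport F) (t : ℝ) : HasCompactSupport (F t) := by
  obtain ⟨r, hr⟩ := h |t|
  refine HasCompactSupport.intro (isCompact_closedBall (0 : Space) r) fun x hx => hr t le_rfl x ?_
  simpa using hx

lemma hasDerivAt_integral_of_contDiff {F : ℝ → Space → ℂ}
    (hF : ContDiff ℝ 1 (fun p : ℝ × Space => F p.1 p.2)) (hs : LocallyBoundedSupport F) (t : ℝ) :
    Integrable (fun x => deriv (fun s => F s x) t) ∧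
    HasDerivAt (fun t => ∫ x, F t x) (∫ x, deriv (fun s => F s x) t) t := by
  obtain ⟨r, hr⟩ := hs (|t| + 2)
  have hcont : ∀ s, Continuous (F s) := fun s =>
    hF.continuous.comp (by fun_prop : Continuous fun x : Space => (s, x))
  have hd : ∀ s x, HasDerivAt (fun s => F s x) (deriv (fun s => F s x) s) s := fun s x =>
    (hasDerivAt_time hF s x).differentiableAt.hasDerivAt
  have hdc : Continuous fun p : ℝ × Space => deriv (fun s => F s p.2) p.1 := by
    have e : (fun p : ℝ × Space => deriv (fun s => F s p.2) p.1)
        = fun p => fderiv ℝ (fun p : ℝ × Space => F p.1 p.2) p (1, 0) :=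
      funext fun p => (hasDerivAt_time hF p.1 p.2).deriv
    rw [e]
    exact (hF.continuous_fderiv (by norm_num)).clm_apply continuous_const
  have hcompact : IsCompact (Set.Icc (t - 1) (t + 1) ×ˢ Metric.closedBall (0 : Space) r) :=
    isCompact_Icc.prod (isCompact_closedBall _ _)
  obtain ⟨C, hC⟩ := hcompact.exists_bound_of_continuousOn hdc.continuousOn
  have habs : ∀ s ∈ Metric.ball t 1, |s| < |t| + 2 := fun s hs => by
    rw [Metric.mem_ball, Real.dist_eq] at hs
    have := abs_add_le (s - t) t
    rw [sub_add_cancel] at this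
    linarith
  refine hasDerivAt_integral_of_dominated_loc_of_deriv_le
    (bound := (Metric.closedBall (0 : Space) r).indicator fun _ => C)
    (F' := fun s x => deriv (fun s => F s x) s)
    (Metric.ball_mem_nhds t one_pos)
    (Eventually.of_forall fun s => (hcont s).aestronglyMeasurable)
    ((hcont t).integrable_of_hasCompactSupport (hs.hasCompactSupport t))
    (hdc.comp (by fun_prop : Continuous fun x : Space => (t, x))).aestronglyMeasurable
    (ae_of_all _ fun x s hsb => ?_) ?_ (ae_of_all _ fun x s _ => hd s x)
  · by_cases hx : x ∈ Metric.closedBall (0 : Space) r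
    · rw [Set.indicator_of_mem hx]
      refine hC (s, x) ⟨?_, hx⟩
      rw [Metric.mem_ball, Real.dist_eq, abs_lt] at hsb
      constructor <;> linarith
    · rw [Set.indicator_of_notMem hx]
      have hx' : r < ‖x‖ := by simpa using hx
      have hz : (fun s => F s x) =ᶠ[𝓝 s] fun _ => 0 := by
        have : ∀ᶠ s' in 𝓝 s, |s'| < |t| + 2 :=
          (continuous_abs.tendsto s).eventually (gt_mem_nhds (habs s hsb))
        filter_upwards [this] with s' hs'
        exact hr s' hs'.le x hx'
      rw [hz.deriv_eq]
      simp
  · exact (integrable_indicator_iff Metric.isClosed_closedBall.measurableSet).2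
      (integrableOn_const measure_closedBall_lt_top.ne)

lemma integral_fderiv_eq_zero {G : Space → ℂ} (hG : ContDiff ℝ 1 G) (hs : HasCompactSupport G)
    (v : Space) : Integrable (fun x => fderiv ℝ G x v) ∧ ∫ x, fderiv ℝ G x v = 0 := by
  have hi : Integrable (fun x => fderiv ℝ G x v) :=
    ((hG.continuous_fderiv (by norm_num)).clm_apply continuous_const).integrable_of_hasCompactSupport
      (hs.fderiv_apply (𝕜 := ℝ) v)
  refine ⟨hi, ?_⟩
  have hGi : Integrable G := hG.continuous.integrable_of_hasCompactSupport hs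
  have h := integral_mul_fderiv_eq_neg_fderiv_mul_of_integrable (μ := (volume : Measure Space))
    (f := fun _ => (1 : ℂ)) (g := G) (v := v) (by simp) (by simpa using hi) (by simpa using hGi)
    (fun x _ => differentiableAt_const _) (fun x _ => (hG.differentiable (by norm_num)) x)
  simpa using h

variable {V₁ V₂ : ℝ → Space → ℝ} {u₁ u₂ : ℝ → Space → Spinor} {w : ℝ → Space → ℝ}

/-- The bilinear local conservation law, integrated against a weight. -/
theorem hasDerivAt_weighted_inner (h₁ : IsDiracSolution V₁ u₁) (h₂ : IsDiracSolution V₂ u₂)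
    (hw : ContDiff ℝ 1 (fun p : ℝ × Space => w p.1 p.2)) (hs : LocallyBoundedSupport w) (t : ℝ) :
    Integrable (fun x => ((deriv (fun s => w s x) t : ℝ) : ℂ) * inner ℂ (u₁ t x) (u₂ t x)
        + ∑ j, ((fderiv ℝ (w t) x (EuclideanSpace.single j 1) : ℝ) : ℂ)
          * inner ℂ (u₁ t x) (alpha j (u₂ t x))
        + (w t x : ℂ) * (Complex.I * ((V₂ t x - V₁ t x : ℝ) : ℂ)
            * inner ℂ (u₁ t x) (beta (u₂ t x)))) ∧
    HasDerivAt (fun t => ∫ x, (w t x : ℂ) * inner ℂ (u₁ t x) (u₂ t x))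
      (∫ x, (((deriv (fun s => w s x) t : ℝ) : ℂ) * inner ℂ (u₁ t x) (u₂ t x)
        + ∑ j, ((fderiv ℝ (w t) x (EuclideanSpace.single j 1) : ℝ) : ℂ)
          * inner ℂ (u₁ t x) (alpha j (u₂ t x))
        + (w t x : ℂ) * (Complex.I * ((V₂ t x - V₁ t x : ℝ) : ℂ)
            * inner ℂ (u₁ t x) (beta (u₂ t x))))) t := by
  have hF : ContDiff ℝ 1 (fun p : ℝ × Space => (w p.1 p.2 : ℂ) * inner ℂ (u₁ p.1 p.2) (u₂ p.1 p.2)) :=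
    (Complex.ofRealCLM.contDiff.comp hw).mul (h₁.contDiff.inner ℂ h₂.contDiff)
  have hFs : LocallyBoundedSupport (fun t x => (w t x : ℂ) * inner ℂ (u₁ t x) (u₂ t x)) := fun T => by
    obtain ⟨r, hr⟩ := hs T
    exact ⟨r, fun t ht x hx => by simp [hr t ht x hx]⟩
  obtain ⟨hi, hD⟩ := hasDerivAt_integral_of_contDiff hF hFs t
  have hslice : ∀ {E : Type} [NormedAddCommGroup E] [NormedSpace ℝ E] {u : ℝ → Space → E},
      ContDiff ℝ 1 (fun p : ℝ × Space => u p.1 p.2) → ContDiff ℝ 1 (u t) := fun h =>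
    h.comp (by fun_prop : ContDiff ℝ 1 fun x : Space => (t, x))
  have hG : ∀ j, ContDiff ℝ 1 (fun x => (w t x : ℂ) * inner ℂ (u₁ t x) (alpha j (u₂ t x))) := fun j =>
    (Complex.ofRealCLM.contDiff.comp (hslice hw)).mul ((hslice h₁.contDiff).inner ℂ
      (((alpha j).restrictScalars ℝ).contDiff.comp (hslice h₂.contDiff)))
  have hGs : ∀ j, HasCompactSupport (fun x => (w t x : ℂ) * inner ℂ (u₁ t x) (alpha j (u₂ t x))) :=
    fun j => by
      have := (hs.hasCompactSupport t).comp_left (g := fun r : ℝ => (r : ℂ)) (by simp)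
      exact this.mul_right
  have hdiv := fun j => integral_fderiv_eq_zero (hG j) (hGs j) (EuclideanSpace.single j 1)
  have hsum : ∫ x, ∑ j, fderiv ℝ (fun x => (w t x : ℂ) * inner ℂ (u₁ t x) (alpha j (u₂ t x))) x
      (EuclideanSpace.single j 1) = 0 := by
    rw [integral_finsetSum _ fun j _ => (hdiv j).1]
    exact Finset.sum_eq_zero fun j _ => (hdiv j).2
  -- Adding the divergence of w u₁†αu₂, which integrates to zero, removes every derivative of u₁ and
  -- u₂ from the integrand; only derivatives of w remain.
  have hzero := integral_add hi (integrable_finsetSum Finset.univ fun j _ => (hdiv j).1)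
  rw [hsum, add_zero] at hzero
  rw [← hzero] at hD
  have hint := hi.add (integrable_finsetSum Finset.univ fun j _ => (hdiv j).1)
  suffices key : ∀ x, ((deriv (fun s => w s x) t : ℝ) : ℂ) * inner ℂ (u₁ t x) (u₂ t x)
        + ∑ j, ((fderiv ℝ (w t) x (EuclideanSpace.single j 1) : ℝ) : ℂ)
          * inner ℂ (u₁ t x) (alpha j (u₂ t x))
        + (w t x : ℂ) * (Complex.I * ((V₂ t x - V₁ t x : ℝ) : ℂ)
            * inner ℂ (u₁ t x) (beta (u₂ t x)))
      = deriv (fun s => (w s x : ℂ) * inner ℂ (u₁ s x) (u₂ s x)) t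
        + ∑ j, fderiv ℝ (fun x => (w t x : ℂ) * inner ℂ (u₁ t x) (alpha j (u₂ t x))) x
          (EuclideanSpace.single j 1) by
    simp_rw [key]
    exact ⟨hint, hD⟩
  intro x
  have d1 : DifferentiableAt ℝ (fun s => u₁ s x) t := (hasDerivAt_time h₁.contDiff t x).differentiableAt
  have d2 : DifferentiableAt ℝ (fun s => u₂ s x) t := (hasDerivAt_time h₂.contDiff t x).differentiableAt
  have dw : DifferentiableAt ℝ (fun s => w s x) t := (hasDerivAt_time hw t x).differentiableAt
  have s1 := (hasFDerivAt_space h₁.contDiff t x).differentiableAt.hasFDerivAt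
  have s2 := (hasFDerivAt_space h₂.contDiff t x).differentiableAt.hasFDerivAt
  have sw := (hasFDerivAt_space hw t x).differentiableAt.hasFDerivAt
  have et : deriv (fun s => (w s x : ℂ) * inner ℂ (u₁ s x) (u₂ s x)) t
      = ((deriv (fun s => w s x) t : ℝ) : ℂ) * inner ℂ (u₁ t x) (u₂ t x)
        + (w t x : ℂ) * (inner ℂ (u₁ t x) (deriv (fun s => u₂ s x) t)
          + inner ℂ (deriv (fun s => u₁ s x) t) (u₂ t x)) := by
    have hm : HasDerivAt (fun s => (w s x : ℂ) * inner ℂ (u₁ s x) (u₂ s x)) _ t :=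
      dw.hasDerivAt.ofReal_comp.mul (d1.hasDerivAt.inner ℂ d2.hasDerivAt)
    exact hm.deriv
  have ej : ∀ j, fderiv ℝ (fun x => (w t x : ℂ) * inner ℂ (u₁ t x) (alpha j (u₂ t x))) x
      (EuclideanSpace.single j 1)
      = ((fderiv ℝ (w t) x (EuclideanSpace.single j 1) : ℝ) : ℂ) * inner ℂ (u₁ t x) (alpha j (u₂ t x))
        + (w t x : ℂ) * (inner ℂ (u₁ t x) (alpha j (fderiv ℝ (u₂ t) x (EuclideanSpace.single j 1)))
          + inner ℂ (fderiv ℝ (u₁ t) x (EuclideanSpace.single j 1)) (alpha j (u₂ t x))) := fun j => by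
    have hw' : HasFDerivAt (fun x => (w t x : ℂ)) (Complex.ofRealCLM.comp (fderiv ℝ (w t) x)) x :=
      Complex.ofRealCLM.hasFDerivAt.comp x sw
    have h2' : HasFDerivAt (fun x => alpha j (u₂ t x))
        (((alpha j).restrictScalars ℝ).comp (fderiv ℝ (u₂ t) x)) x :=
      ((alpha j).restrictScalars ℝ).hasFDerivAt.comp x s2
    have hm : HasFDerivAt (fun x => (w t x : ℂ) * inner ℂ (u₁ t x) (alpha j (u₂ t x))) _ x :=
      hw'.mul (s1.inner ℂ h2')
    rw [hm.fderiv]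
    simp [fderivInnerCLM_apply]
    ring
  simp only [et, ej]
  rw [h₁.equation, h₂.equation]
  -- Self-adjointness of αʲ and β cancels the transport and mass terms; of the real potentials only
  -- the difference survives.
  simp only [inner_add_left, inner_add_right, inner_sub_left, inner_sub_right, inner_neg_left,
    inner_neg_right, inner_sum, sum_inner, inner_alpha, inner_smul_left, inner_smul_right, inner_beta,
    Finset.sum_add_distrib, ← Finset.mul_sum]
  simp only [map_mul, Complex.conj_I, Complex.conj_ofReal, Complex.ofReal_sub]
  ring

/-! ### Weights on expanding cones and monotonicity of charge. -/

lemma contDiff_bracket : ContDiff ℝ 1 bracket := by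
  unfold bracket
  refine ContDiff.sqrt (contDiff_const.add (contDiff_norm_sq ℝ)) fun x => ?_
  positivity

lemma fderiv_bracket (x v : Space) : fderiv ℝ bracket x v = inner ℝ x v / bracket x := by
  have h1 : HasFDerivAt (fun x : Space => 1 + ‖x‖ ^ 2) (2 • innerSL ℝ x) x :=
    (hasStrictFDerivAt_norm_sq x).hasFDerivAt.const_add 1
  have h2 := h1.sqrt (by positivity)
  have h3 : HasFDerivAt bracket _ x := h2
  rw [h3.fderiv]
  simp only [smul_apply, innerSL_apply_apply, smul_eq_mul, nsmul_eq_mul]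
  unfold bracket
  field_simp
  norm_num

/-- The weight `1` for `⟨x⟩ ≤ t - c`, `0` for `⟨x⟩ ≥ t - c + 1`. -/
def coneWeight (c t : ℝ) (x : Space) : ℝ := Real.smoothTransition (1 - (bracket x - t + c))

lemma contDiff_coneWeight (c : ℝ) : ContDiff ℝ 1 (fun p : ℝ × Space => coneWeight c p.1 p.2) := by
  unfold coneWeight
  refine Real.smoothTransition.contDiff.comp ?_
  have := contDiff_bracket.comp (contDiff_snd (E := ℝ) (F := Space))
  exact contDiff_const.sub ((this.sub contDiff_fst).add contDiff_const)

lemma locallyBoundedSupport_coneWeight (c : ℝ) : LocallyBoundedSupport (coneWeight c) := fun T => by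
  refine ⟨T - c + 1, fun t ht x hx => Real.smoothTransition.zero_of_nonpos ?_⟩
  have := norm_le_bracket x
  have := abs_le.1 ht
  linarith

/-- Charge monotonicity inside an expanding cone. -/
theorem monotone_cone_charge {V : ℝ → Space → ℝ} {u : ℝ → Space → Spinor}
    (h : IsDiracSolution V u) (c : ℝ) :
    Monotone fun t => ∫ x, coneWeight c t x * ‖u t x‖ ^ 2 := by
  have hD := fun t => hasDerivAt_weighted_inner h h (contDiff_coneWeight c)
    (locallyBoundedSupport_coneWeight c) t
  have e : ∀ t, ∫ x, (coneWeight c t x : ℂ) * inner ℂ (u t x) (u t x)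
      = ((∫ x, coneWeight c t x * ‖u t x‖ ^ 2 : ℝ) : ℂ) := fun t => by
    rw [← integral_complex_ofReal]
    refine integral_congr_ae (ae_of_all _ fun x => ?_)
    simp only [inner_self_eq_norm_sq_to_K]
    push_cast
    rfl
  simp_rw [e] at hD
  refine monotone_of_hasDerivAt_nonneg (fun t => by
    have h1 := Complex.reCLM.hasFDerivAt.comp_hasDerivAt t (hD t).2
    exact h1) fun t => ?_
  change 0 ≤ Complex.re _
  rw [show ∀ z : ℂ, z.re = RCLike.re z from fun _ => rfl, ← integral_re (hD t).1]
  refine integral_nonneg fun x => ?_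
  set d := deriv Real.smoothTransition (1 - (bracket x - t + c)) with hd
  have hd0 : 0 ≤ d := Real.smoothTransition.monotone.deriv_nonneg
  have hst : DifferentiableAt ℝ Real.smoothTransition (1 - (bracket x - t + c)) :=
    (Real.smoothTransition.contDiff (n := 1)).differentiable (by norm_num) _
  have e1 : deriv (fun s => coneWeight c s x) t = d := by
    have h1 : HasDerivAt (fun s => 1 - (bracket x - s + c)) 1 t := by
      simpa using (((hasDerivAt_id t).const_sub (bracket x)).add_const c).const_sub 1
    have h2 : HasDerivAt (fun s => coneWeight c s x) _ t := hst.hasDerivAt.comp t h1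
    rw [h2.deriv, mul_one]
  have e2 : ∀ v, fderiv ℝ (coneWeight c t) x v = -(d * (inner ℝ x v / bracket x)) := fun v => by
    have h1 : HasFDerivAt (fun x => 1 - (bracket x - t + c)) (-(fderiv ℝ bracket x)) x := by
      have := (contDiff_bracket.differentiable (by norm_num) x).hasFDerivAt
      simpa using ((this.sub_const t).add_const c).const_sub 1
    have h2 : HasFDerivAt (coneWeight c t) _ x := hst.hasDerivAt.hasFDerivAt.comp x h1
    rw [h2.fderiv]
    simp [fderiv_bracket, hd, mul_comm]
  have e3 : ∑ j, ((fderiv ℝ (coneWeight c t) x (EuclideanSpace.single j 1) : ℝ) : ℂ)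
        * inner ℂ (u t x) (alpha j (u t x))
      = -((d / bracket x : ℝ) : ℂ) * inner ℂ (u t x) (diracOp x 0 (u t x)) := by
    simp only [e2, diracOp, EuclideanSpace.inner_single_right]
    simp [Finset.mul_sum, sum_apply]
    refine Finset.sum_congr rfl fun j _ => ?_
    ring
  have hb := bracket_pos x
  have h3 : ‖inner ℂ (u t x) (diracOp x 0 (u t x))‖ ≤ bracket x * ‖u t x‖ ^ 2 := by
    refine (norm_inner_le_norm _ _).trans ?_
    rw [norm_diracOp_zero_right]
    have := mul_le_mul_of_nonneg_right (norm_le_bracket x) (sq_nonneg ‖u t x‖)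
    nlinarith
  have h4 := (Complex.re_le_norm (inner ℂ (u t x) (diracOp x 0 (u t x)))).trans h3
  simp only [e1]
  rw [e3]
  -- The spatial flux (d/⟨x⟩) u†(x·α)u is at most d|u|², the gain from the moving weight: the cone
  -- expands at least as fast as the solution propagates. The potential term vanishes since both
  -- solutions have the same V.
  have h5 : (d / bracket x) * (inner ℂ (u t x) (diracOp x 0 (u t x))).re ≤ d * ‖u t x‖ ^ 2 := by
    calc _ ≤ (d / bracket x) * (bracket x * ‖u t x‖ ^ 2) :=
          mul_le_mul_of_nonneg_left h4 (by positivity)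
      _ = _ := by field_simp
  have h6 : (inner ℂ (u t x) (u t x)) = ((‖u t x‖ ^ 2 : ℝ) : ℂ) := by
    rw [inner_self_eq_norm_sq_to_K]; push_cast; rfl
  rw [h6, sub_self, Complex.ofReal_zero, mul_zero, zero_mul, mul_zero, add_zero, ← Complex.ofReal_neg,
    ← Complex.ofReal_mul]
  simp only [RCLike.re_eq_complex_re, Complex.add_re, Complex.ofReal_re, Complex.re_ofReal_mul,
    Pi.zero_apply]
  linarith

/-- The charge in the ball `⟨x⟩ ≤ ρ` at time `t₀` is at most that in `⟨x⟩ ≤ ρ + 1 + (t₁ - t₀)` at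
time `t₁`. -/
theorem setIntegral_charge_le {V : ℝ → Space → ℝ} {u : ℝ → Space → Spinor}
    (h : IsDiracSolution V u) {t₀ t₁ : ℝ} (ht : t₀ ≤ t₁) (ρ : ℝ) :
    ∫ x in {x | bracket x ≤ ρ}, ‖u t₀ x‖ ^ 2
      ≤ ∫ x in {x | bracket x ≤ ρ + 1 + (t₁ - t₀)}, ‖u t₁ x‖ ^ 2 := by
  have hc : ∀ t, Continuous (u t) := fun t =>
    h.contDiff.continuous.comp (by fun_prop : Continuous fun x : Space => (t, x))
  have hmeas : ∀ r, MeasurableSet {x : Space | bracket x ≤ r} := fun r =>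
    (isClosed_le continuous_bracket continuous_const).measurableSet
  have hint : ∀ t r, IntegrableOn (fun x => ‖u t x‖ ^ 2) {x : Space | bracket x ≤ r} := fun t r => by
    refine (((hc t).norm.pow 2).continuousOn.integrableOn_compact
      (isCompact_closedBall (0 : Space) r)).mono_set fun x hx => ?_
    simpa using (norm_le_bracket x).trans hx
  have hwi : ∀ t, Integrable fun x => coneWeight (t₀ - ρ) t x * ‖u t x‖ ^ 2 := fun t => by
    refine Continuous.integrable_of_hasCompactSupport ?_
      ((locallyBoundedSupport_coneWeight (t₀ - ρ)).hasCompactSupport t).mul_right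
    exact ((contDiff_coneWeight (t₀ - ρ)).continuous.comp
      (by fun_prop : Continuous fun x : Space => (t, x))).mul ((hc t).norm.pow 2)
  -- With this shift the weight is 1 on ⟨x⟩ ≤ ρ at time t₀ and 0 outside ⟨x⟩ ≤ ρ + 1 + (t₁ - t₀) at
  -- time t₁.
  have h1 := monotone_cone_charge h (t₀ - ρ) ht
  simp only at h1
  calc _ ≤ ∫ x, coneWeight (t₀ - ρ) t₀ x * ‖u t₀ x‖ ^ 2 := by
        rw [← integral_indicator (hmeas _)]
        refine integral_mono ((integrable_indicator_iff (hmeas _)).2 (hint _ _)) (hwi t₀) fun x => ?_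
        by_cases hx : bracket x ≤ ρ
        · have : coneWeight (t₀ - ρ) t₀ x = 1 := Real.smoothTransition.one_of_one_le (by linarith)
          simp [Set.indicator, hx, this]
        · rw [Set.indicator_of_notMem (s := {x | bracket x ≤ ρ}) hx]
          exact mul_nonneg (Real.smoothTransition.nonneg _) (sq_nonneg _)
    _ ≤ ∫ x, coneWeight (t₀ - ρ) t₁ x * ‖u t₁ x‖ ^ 2 := h1
    _ ≤ _ := by
        rw [← integral_indicator (hmeas _)]
        refine integral_mono (hwi t₁) ((integrable_indicator_iff (hmeas _)).2 (hint _ _)) fun x => ?_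
        by_cases hx : bracket x ≤ ρ + 1 + (t₁ - t₀)
        · simp only [Set.indicator, Set.mem_ofPred_eq, hx, if_true]
          exact mul_le_of_le_one_left (sq_nonneg _) (Real.smoothTransition.le_one _)
        · rw [Set.indicator_of_notMem (s := {x | bracket x ≤ ρ + 1 + (t₁ - t₀)}) hx]
          have : coneWeight (t₀ - ρ) t₁ x = 0 :=
            Real.smoothTransition.zero_of_nonpos (by linarith)
          simp [this]

end Conservation

/-! ### Estimates for the Coulomb potential -/

section Coulomb

lemma potential_zero (x : Space) : potential 0 x = (4 * Real.pi)⁻¹ * ‖x‖⁻¹ := by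
  simp [potential]

lemma potential_zero_nonneg (x : Space) : 0 ≤ potential 0 x := by
  rw [potential_zero]; positivity

lemma measurable_potential_zero : Measurable (potential 0) := by
  have : potential 0 = fun x => (4 * Real.pi)⁻¹ * ‖x‖⁻¹ := funext potential_zero
  rw [this]
  fun_prop

lemma potential_zero_smul {r : ℝ} (hr : 0 < r) (x : Space) :
    potential 0 (r • x) = r⁻¹ * potential 0 x := by
  rw [potential_zero, potential_zero, norm_smul, Real.norm_of_nonneg hr.le, mul_inv]
  ring

/-- The Coulomb potential restricted to the ball of radius `r`. -/
def nearPotential (r : ℝ) (x : Space) : ℝ≥0∞ :=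
  (Metric.ball (0 : Space) r).indicator (fun x => ENNReal.ofReal (potential 0 x)) x

lemma measurable_nearPotential (r : ℝ) : Measurable (nearPotential r) :=
  measurable_potential_zero.ennreal_ofReal.indicator Metric.isOpen_ball.measurableSet

lemma nearPotential_smul {r : ℝ} (hr : 0 < r) (x : Space) :
    nearPotential r (r • x) = ENNReal.ofReal r⁻¹ * nearPotential 1 x := by
  have h : r • x ∈ Metric.ball (0 : Space) r ↔ x ∈ Metric.ball (0 : Space) 1 := by
    simp only [mem_ball_zero_iff, norm_smul, Real.norm_of_nonneg hr.le]
    exact mul_lt_iff_lt_one_right hr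
  unfold nearPotential
  by_cases hx : x ∈ Metric.ball (0 : Space) 1
  · rw [Set.indicator_of_mem hx, Set.indicator_of_mem (h.2 hx), potential_zero_smul hr,
      ENNReal.ofReal_mul (by positivity)]
  · rw [Set.indicator_of_notMem hx, Set.indicator_of_notMem (mt h.1 hx), mul_zero]

/-- |x|⁻² is integrable at the origin of a three-dimensional space. -/
lemma lintegral_nearPotential_one_lt_top : ∫⁻ x, nearPotential 1 x ^ (2 : ℝ) < ⊤ := by
  have h1 : IntegrableOn (fun x : Space => potential 0 x ^ 2) (Metric.ball 0 1) := by
    refine integrableOn_ball_of_norm_le_rpow (C := (4 * Real.pi)⁻¹ ^ 2) (α := 2) ?_ ?_ ?_ ?_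
    · simp
    · simp; norm_num
    · refine ae_of_all _ fun x => ?_
      rw [potential_zero, Real.norm_of_nonneg (by positivity), mul_pow, Real.rpow_neg (norm_nonneg _),
        Real.rpow_two, inv_pow ‖x‖]
    · exact (measurable_potential_zero.pow_const 2).aestronglyMeasurable
  have h2 := (hasFiniteIntegral_iff_ofReal (ae_of_all _ fun x => sq_nonneg (potential 0 x))).1 h1.2
  rw [← lintegral_indicator Metric.isOpen_ball.measurableSet] at h2
  refine lt_of_eq_of_lt (lintegral_congr fun x => ?_) h2
  unfold nearPotential
  by_cases hx : x ∈ Metric.ball (0 : Space) 1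
  · rw [Set.indicator_of_mem hx, Set.indicator_of_mem hx, ENNReal.rpow_two,
      ENNReal.ofReal_pow (potential_zero_nonneg x)]
  · rw [Set.indicator_of_notMem hx, Set.indicator_of_notMem hx, ENNReal.zero_rpow_of_pos (by norm_num)]

/-- Scaling: the squared potential contributes r⁻² and the volume r³, so the near potential has L²
norm proportional to √r. -/
lemma lintegral_nearPotential {r : ℝ} (hr : 0 < r) :
    ∫⁻ x, nearPotential r x ^ (2 : ℝ) = ENNReal.ofReal r * ∫⁻ x, nearPotential 1 x ^ (2 : ℝ) := by
  have h1 : ∫⁻ x, nearPotential r (r • x) ^ (2 : ℝ)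
      = ENNReal.ofReal (r ^ 3)⁻¹ * ∫⁻ x, nearPotential r x ^ (2 : ℝ) := by
    rw [← lintegral_map (f := fun x => nearPotential r x ^ (2 : ℝ)) (g := fun x : Space => r • x)
      ((measurable_nearPotential r).pow_const 2) (measurable_const_smul r),
      Measure.map_addHaar_smul volume hr.ne', lintegral_smul_measure]
    simp [abs_of_pos hr]
  simp_rw [nearPotential_smul hr, ENNReal.mul_rpow_of_nonneg _ _ (by norm_num : (0 : ℝ) ≤ 2)] at h1
  rw [lintegral_const_mul _ ((measurable_nearPotential 1).pow_const 2)] at h1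
  have h2 : ENNReal.ofReal (r ^ 3) * (ENNReal.ofReal r⁻¹ ^ (2 : ℝ)) = ENNReal.ofReal r := by
    rw [ENNReal.rpow_two, ← ENNReal.ofReal_pow (by positivity), ← ENNReal.ofReal_mul (by positivity)]
    congr 1
    field_simp
  have h3 : ENNReal.ofReal (r ^ 3) * ENNReal.ofReal (r ^ 3)⁻¹ = 1 := by
    rw [← ENNReal.ofReal_mul (by positivity), mul_inv_cancel₀ (by positivity), ENNReal.ofReal_one]
  rw [← h2, mul_assoc, h1, ← mul_assoc, h3, one_mul]

lemma lintegral_mul_le_eLpNorm {α : Type*} [MeasurableSpace α] {μ : Measure α} {E F : Type*}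
    [NormedAddCommGroup E] [NormedAddCommGroup F]
    {f : α → E} {g : α → F} (hf : AEStronglyMeasurable f μ) (hg : AEStronglyMeasurable g μ) :
    ∫⁻ x, ‖f x‖ₑ * ‖g x‖ₑ ∂μ ≤ eLpNorm f 2 μ * eLpNorm g 2 μ := by
  have := ENNReal.lintegral_mul_le_Lp_mul_Lq μ Real.HolderConjugate.two_two hf.enorm hg.enorm
  rw [eLpNorm_eq_lintegral_rpow_enorm_toReal (by norm_num) (by norm_num),
    eLpNorm_eq_lintegral_rpow_enorm_toReal (by norm_num) (by norm_num)]
  simpa using this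

/-- The constant in the Coulomb estimate. -/
def coulombConst : ℝ := ((∫⁻ x, nearPotential 1 x ^ (2 : ℝ)) ^ (1 / 2 : ℝ)).toReal + (4 * Real.pi)⁻¹

lemma coulombConst_pos : 0 < coulombConst := by unfold coulombConst; positivity

lemma ofReal_potential_le {r : ℝ} (hr : 0 < r) (x : Space) :
    ENNReal.ofReal (potential 0 x) ≤ nearPotential r x + ENNReal.ofReal ((4 * Real.pi)⁻¹ * r⁻¹) := by
  unfold nearPotential
  by_cases hx : x ∈ Metric.ball (0 : Space) r
  · rw [Set.indicator_of_mem hx]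
    exact le_self_add
  · rw [Set.indicator_of_notMem hx, zero_add, potential_zero]
    have h : r ≤ ‖x‖ := by simpa using hx
    gcongr

variable {E F : Type*} [NormedAddCommGroup E] [NormedAddCommGroup F] {c : Space → E} {d : Space → F}

/-- The potential of `|c| |d|` for bounded `c` and square-integrable `c`, `d`. -/
lemma lintegral_potential_mul_le (hc : AEStronglyMeasurable c volume)
    (hd : AEStronglyMeasurable d volume) {m nc nd r : ℝ} (hm0 : 0 ≤ m) (hnc0 : 0 ≤ nc) (hnd0 : 0 ≤ nd)
    (hm : ∀ᵐ x, ‖c x‖ ≤ m) (hnc : eLpNorm c 2 volume ≤ ENNReal.ofReal nc)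
    (hnd : eLpNorm d 2 volume ≤ ENNReal.ofReal nd) (hr : 0 < r) (y : Space) :
    ∫⁻ x, ENNReal.ofReal (potential 0 (x - y)) * (‖c x‖ₑ * ‖d x‖ₑ)
      ≤ ENNReal.ofReal (coulombConst * (√r * m * nd + nc * nd / r)) := by
  set K := (∫⁻ x, nearPotential 1 x ^ (2 : ℝ)) ^ (1 / 2 : ℝ) with hK
  have hKtop : K ≠ ⊤ := (ENNReal.rpow_lt_top_of_nonneg (by norm_num)
    lintegral_nearPotential_one_lt_top.ne).ne
  have hnear : ∫⁻ x, nearPotential r (x - y) * ‖d x‖ₑ ≤ ENNReal.ofReal (√r) * K * ENNReal.ofReal nd := by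
    have h := ENNReal.lintegral_mul_le_Lp_mul_Lq volume Real.HolderConjugate.two_two
      ((measurable_nearPotential r).comp (measurable_sub_const y)).aemeasurable hd.enorm
    refine h.trans (mul_le_mul' (le_of_eq ?_) ?_)
    · simp only [Function.comp_apply]
      rw [lintegral_sub_right_eq_self (fun x => nearPotential r x ^ (2 : ℝ)) y,
        lintegral_nearPotential hr, ENNReal.mul_rpow_of_nonneg _ _ (by norm_num), ← hK,
        Real.sqrt_eq_rpow, ENNReal.ofReal_rpow_of_pos hr]
    · rw [eLpNorm_eq_lintegral_rpow_enorm_toReal (by norm_num) (by norm_num)] at hnd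
      simpa using hnd
  have hfar := (lintegral_mul_le_eLpNorm hc hd).trans (mul_le_mul' hnc hnd)
  -- Near y: c in L^∞ and Cauchy–Schwarz between the potential and d. Away from y: the potential is
  -- at most 1/(4πr), with Cauchy–Schwarz between c and d.
  calc _ ≤ ∫⁻ x, (ENNReal.ofReal m * (nearPotential r (x - y) * ‖d x‖ₑ)
          + ENNReal.ofReal ((4 * Real.pi)⁻¹ * r⁻¹) * (‖c x‖ₑ * ‖d x‖ₑ)) := by
        refine lintegral_mono_ae ?_
        filter_upwards [hm] with x hx
        have hx' : ‖c x‖ₑ ≤ ENNReal.ofReal m := by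
          rw [← ofReal_norm]; exact ENNReal.ofReal_le_ofReal hx
        refine (mul_le_mul_left (ofReal_potential_le hr (x - y)) _).trans ?_
        rw [add_mul]
        refine add_le_add ?_ le_rfl
        calc nearPotential r (x - y) * (‖c x‖ₑ * ‖d x‖ₑ)
            ≤ nearPotential r (x - y) * (ENNReal.ofReal m * ‖d x‖ₑ) := by gcongr
          _ = _ := by ring
    _ = ENNReal.ofReal m * (∫⁻ x, nearPotential r (x - y) * ‖d x‖ₑ)
          + ENNReal.ofReal ((4 * Real.pi)⁻¹ * r⁻¹) * ∫⁻ x, ‖c x‖ₑ * ‖d x‖ₑ := by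
        have hmeas : AEMeasurable (fun x => nearPotential r (x - y) * ‖d x‖ₑ) volume :=
          ((measurable_nearPotential r).comp (measurable_sub_const y)).aemeasurable.mul hd.enorm
        rw [lintegral_add_left' (hmeas.const_mul _), lintegral_const_mul'' _ hmeas,
          lintegral_const_mul'' _ (by exact hc.enorm.mul hd.enorm)]
    _ ≤ ENNReal.ofReal m * (ENNReal.ofReal (√r) * K * ENNReal.ofReal nd)
          + ENNReal.ofReal ((4 * Real.pi)⁻¹ * r⁻¹) * (ENNReal.ofReal nc * ENNReal.ofReal nd) := by
        gcongr
    _ = ENNReal.ofReal (K.toReal * (√r * m * nd) + (4 * Real.pi)⁻¹ * (nc * nd / r)) := by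
        have hq : 0 ≤ (4 * Real.pi)⁻¹ * r⁻¹ := by positivity
        have h1 : 0 ≤ √r * m * nd := by positivity
        have h2 : 0 ≤ nc * nd / r := by positivity
        rw [ENNReal.ofReal_add (mul_nonneg ENNReal.toReal_nonneg h1) (by positivity),
          ENNReal.ofReal_mul ENNReal.toReal_nonneg, ENNReal.ofReal_toReal hKtop,
          ENNReal.ofReal_mul (p := √r * m) (by positivity), ENNReal.ofReal_mul (p := √r) (by positivity),
          ← ENNReal.ofReal_mul hnc0, ← ENNReal.ofReal_mul hq]
        congr 1
        · ring
        · congr 1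
          field_simp
    _ ≤ _ := by
        refine ENNReal.ofReal_le_ofReal ?_
        have h1 : 0 ≤ √r * m * nd := by positivity
        have h2 : 0 ≤ nc * nd / r := by positivity
        have h3 : 0 ≤ K.toReal := ENNReal.toReal_nonneg
        have h4 : 0 < (4 * Real.pi)⁻¹ := by positivity
        unfold coulombConst
        rw [← hK]
        nlinarith [mul_nonneg h3 h2, mul_nonneg h4.le h1]

/-- The integrand of the Coulomb energy of the densities `⟨a, A b⟩` and `⟨c, A d⟩`. -/
def coulombIntegrand (A : Spinor →L[ℂ] Spinor) (a b c d : Space → Spinor) (p : Space × Space) : ℂ :=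
  (potential 0 (p.1 - p.2) : ℂ) * (inner ℂ (a p.2) (A (b p.2)) * inner ℂ (c p.1) (A (d p.1)))

lemma aestronglyMeasurable_inner_clm (A : Spinor →L[ℂ] Spinor) {a b : Space → Spinor}
    (ha : AEStronglyMeasurable a volume) (hb : AEStronglyMeasurable b volume) :
    AEStronglyMeasurable (fun x => (inner ℂ (a x) (A (b x)) : ℂ)) volume :=
  ha.inner (A.continuous.comp_aestronglyMeasurable hb)

variable {A : Spinor →L[ℂ] Spinor} {a b c d : Space → Spinor}

lemma aestronglyMeasurable_coulombIntegrand (ha : AEStronglyMeasurable a volume)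
    (hb : AEStronglyMeasurable b volume) (hc : AEStronglyMeasurable c volume)
    (hd : AEStronglyMeasurable d volume) :
    AEStronglyMeasurable (coulombIntegrand A a b c d) (volume.prod volume) := by
  have h1 : AEStronglyMeasurable (fun p : Space × Space => (potential 0 (p.1 - p.2) : ℂ))
      (volume.prod volume) :=
    (Complex.measurable_ofReal.comp (measurable_potential_zero.comp
      (measurable_fst.sub measurable_snd))).aestronglyMeasurable
  exact h1.mul (((aestronglyMeasurable_inner_clm A ha hb).comp_snd).mul
    ((aestronglyMeasurable_inner_clm A hc hd).comp_fst))

lemma enorm_inner_clm_le (hA : ∀ v, ‖A v‖ ≤ ‖v‖) (v w : Spinor) :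
    ‖(inner ℂ v (A w) : ℂ)‖ₑ ≤ ‖v‖ₑ * ‖w‖ₑ := by
  rw [← ofReal_norm, ← ofReal_norm, ← ofReal_norm, ← ENNReal.ofReal_mul (norm_nonneg _)]
  exact ENNReal.ofReal_le_ofReal ((norm_inner_le_norm _ _).trans
    (mul_le_mul_of_nonneg_left (hA w) (norm_nonneg _)))

/-- Integrating in x at fixed y gives a potential bounded uniformly in y, so a and b need only be in
L². Of the four factors only c must be bounded. -/
lemma lintegral_coulombIntegrand_le (hA : ∀ v, ‖A v‖ ≤ ‖v‖) (ha : AEStronglyMeasurable a volume)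
    (hb : AEStronglyMeasurable b volume) (hc : AEStronglyMeasurable c volume)
    (hd : AEStronglyMeasurable d volume) {na nb m nc nd r : ℝ} (hna0 : 0 ≤ na) (hm0 : 0 ≤ m)
    (hnc0 : 0 ≤ nc) (hnd0 : 0 ≤ nd) (hna : eLpNorm a 2 volume ≤ ENNReal.ofReal na)
    (hnb : eLpNorm b 2 volume ≤ ENNReal.ofReal nb)
    (hm : ∀ᵐ x, ‖c x‖ ≤ m) (hnc : eLpNorm c 2 volume ≤ ENNReal.ofReal nc)
    (hnd : eLpNorm d 2 volume ≤ ENNReal.ofReal nd) (hr : 0 < r) :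
    ∫⁻ p, ‖coulombIntegrand A a b c d p‖ₑ ∂(volume.prod volume)
      ≤ ENNReal.ofReal (na * nb * (coulombConst * (√r * m * nd + nc * nd / r))) := by
  rw [lintegral_prod_symm _ (aestronglyMeasurable_coulombIntegrand ha hb hc hd).enorm]
  set S := coulombConst * (√r * m * nd + nc * nd / r) with hS
  have hS0 : 0 ≤ S := by have := coulombConst_pos; positivity
  calc _ ≤ ∫⁻ y, (‖a y‖ₑ * ‖b y‖ₑ) * ENNReal.ofReal S := by
        refine lintegral_mono fun y => ?_
        refine le_trans ?_ (mul_le_mul_right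
          (lintegral_potential_mul_le hc hd hm0 hnc0 hnd0 hm hnc hnd hr y) _)
        rw [← lintegral_const_mul' _ _ (ENNReal.mul_ne_top enorm_ne_top enorm_ne_top)]
        refine lintegral_mono fun x => ?_
        simp only [coulombIntegrand, enorm_mul]
        have h1 : ‖(potential 0 (x - y) : ℂ)‖ₑ = ENNReal.ofReal (potential 0 (x - y)) := by
          rw [← ofReal_norm, Complex.norm_real, Real.norm_of_nonneg (potential_zero_nonneg _)]
        rw [h1]
        calc _ ≤ ENNReal.ofReal (potential 0 (x - y)) * ((‖a y‖ₑ * ‖b y‖ₑ) * (‖c x‖ₑ * ‖d x‖ₑ)) := by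
              gcongr
              · exact enorm_inner_clm_le hA _ _
              · exact enorm_inner_clm_le hA _ _
          _ = _ := by ring
    _ = (∫⁻ y, ‖a y‖ₑ * ‖b y‖ₑ) * ENNReal.ofReal S :=
        lintegral_mul_const'' _ (ha.enorm.mul hb.enorm)
    _ ≤ (ENNReal.ofReal na * ENNReal.ofReal nb) * ENNReal.ofReal S := by
        gcongr
        exact (lintegral_mul_le_eLpNorm ha hb).trans (mul_le_mul' hna hnb)
    _ = _ := by
        rw [← ENNReal.ofReal_mul hna0, ← ENNReal.ofReal_mul' hS0]

/-- The Coulomb energy of two densities, one of which has a bounded factor. -/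
theorem integrable_coulombIntegrand (hA : ∀ v, ‖A v‖ ≤ ‖v‖) (ha : AEStronglyMeasurable a volume)
    (hb : AEStronglyMeasurable b volume) (hc : AEStronglyMeasurable c volume)
    (hd : AEStronglyMeasurable d volume) {na nb m nc nd r : ℝ} (hna0 : 0 ≤ na) (hnb0 : 0 ≤ nb)
    (hm0 : 0 ≤ m)
    (hnc0 : 0 ≤ nc) (hnd0 : 0 ≤ nd) (hna : eLpNorm a 2 volume ≤ ENNReal.ofReal na)
    (hnb : eLpNorm b 2 volume ≤ ENNReal.ofReal nb)
    (hm : ∀ᵐ x, ‖c x‖ ≤ m) (hnc : eLpNorm c 2 volume ≤ ENNReal.ofReal nc)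
    (hnd : eLpNorm d 2 volume ≤ ENNReal.ofReal nd) (hr : 0 < r) :
    Integrable (coulombIntegrand A a b c d) (volume.prod volume) ∧
    ‖∫ p, coulombIntegrand A a b c d p ∂(volume.prod volume)‖
      ≤ na * nb * (coulombConst * (√r * m * nd + nc * nd / r)) := by
  have h := lintegral_coulombIntegrand_le hA ha hb hc hd hna0 hm0 hnc0 hnd0 hna hnb hm hnc hnd hr
  have := coulombConst_pos
  refine ⟨⟨aestronglyMeasurable_coulombIntegrand ha hb hc hd, h.trans_lt ENNReal.ofReal_lt_top⟩, ?_⟩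
  have h2 := (enorm_integral_le_lintegral_enorm _).trans h
  rw [← ofReal_norm] at h2
  exact (ENNReal.ofReal_le_ofReal_iff (by positivity)).1 h2

lemma potentialConv_eq_integral (f : Space → ℂ) (x : Space) :
    potentialConv 0 f x = ∫ y, (potential 0 (x - y) : ℂ) * f y := by
  unfold potentialConv
  rw [convolution_lsmul_swap]
  simp

lemma integral_potentialConv_mul (hi : Integrable (coulombIntegrand A a b c d) (volume.prod volume)) :
    ∫ x, potentialConv 0 (fun y => inner ℂ (a y) (A (b y))) x * inner ℂ (c x) (A (d x))
      = ∫ p, coulombIntegrand A a b c d p ∂(volume.prod volume) := by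
  rw [integral_prod _ hi]
  refine integral_congr_ae (ae_of_all _ fun x => ?_)
  simp only [coulombIntegrand]
  rw [potentialConv_eq_integral, ← integral_mul_const]
  simp only [mul_assoc]

lemma inner_clm_im_eq_zero (hA : ∀ v w, inner ℂ (A v) w = inner ℂ v (A w)) (v : Spinor) :
    (inner ℂ v (A v) : ℂ) = (((inner ℂ v (A v) : ℂ).re : ℝ) : ℂ) := by
  refine (Complex.conj_eq_iff_re.1 ?_).symm
  rw [inner_conj_symm, hA]

lemma potentialConv_ofReal (f : Space → ℝ) (x : Space) :
    potentialConv 0 (fun y => (f y : ℂ)) x = ((∫ y, potential 0 (x - y) * f y : ℝ) : ℂ) := by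
  rw [potentialConv_eq_integral, ← integral_complex_ofReal]
  simp

/-- The energy of a real density is real. -/
lemma integral_coulombIntegrand_im (hA : ∀ v w, inner ℂ (A v) w = inner ℂ v (A w)) :
    ∫ p, coulombIntegrand A a a c c p ∂(volume.prod volume)
      = ((∫ p, (coulombIntegrand A a a c c p).re ∂(volume.prod volume) : ℝ) : ℂ) := by
  rw [← integral_complex_ofReal]
  refine integral_congr_ae (ae_of_all _ fun p => ?_)
  simp only [coulombIntegrand]
  rw [inner_clm_im_eq_zero hA (a p.2), inner_clm_im_eq_zero hA (c p.1), ← Complex.ofReal_mul,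
    ← Complex.ofReal_mul, Complex.ofReal_re]

end Coulomb

/-! ### Stability and lower bounds of the Coulomb energy -/

section Energy

variable {A : Spinor →L[ℂ] Spinor} {ψ u v : Space → Spinor}

/-- The telescoping is arranged so that the third slot, which must be bounded, only ever contains u
- v or v. The function ψ, for which no L^∞ bound is available, never appears there. -/
lemma coulombIntegrand_sub_eq (p : Space × Space) :
    coulombIntegrand A ψ ψ u ψ p - coulombIntegrand A v v v v p
      = coulombIntegrand A ψ ψ (u - v) ψ p + coulombIntegrand A ψ ψ v (ψ - v) p
        + coulombIntegrand A (ψ - v) ψ v v p + coulombIntegrand A v (ψ - v) v v p := by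
  simp only [coulombIntegrand, Pi.sub_apply, inner_sub_left, map_sub, inner_sub_right]
  ring

/-- Stability of the Coulomb energy. -/
theorem norm_coulomb_sub_le (hA : ∀ v, ‖A v‖ ≤ ‖v‖) (hψ : AEStronglyMeasurable ψ volume)
    (hu : AEStronglyMeasurable u volume) (hv : AEStronglyMeasurable v volume)
    {N m ε r s : ℝ} (hN : 0 ≤ N) (hm : 0 ≤ m) (hε : 0 ≤ ε) (hr : 0 < r) (hs : 0 < s)
    (hψN : eLpNorm ψ 2 volume ≤ ENNReal.ofReal N) (hvN : eLpNorm v 2 volume ≤ ENNReal.ofReal N)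
    (huε : eLpNorm (u - v) 2 volume ≤ ENNReal.ofReal ε)
    (hψε : eLpNorm (ψ - v) 2 volume ≤ ENNReal.ofReal ε)
    (hum : ∀ᵐ x, ‖u x‖ ≤ m) (hvm : ∀ᵐ x, ‖v x‖ ≤ m) :
    Integrable (coulombIntegrand A ψ ψ u ψ) (volume.prod volume) ∧
    Integrable (coulombIntegrand A v v v v) (volume.prod volume) ∧
    ‖∫ p, coulombIntegrand A ψ ψ u ψ p ∂(volume.prod volume)
        - ∫ p, coulombIntegrand A v v v v p ∂(volume.prod volume)‖
      ≤ coulombConst * (N * N * (√r * (2 * m) * N + ε * N / r) + N * N * (√s * m * ε + N * ε / s)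
        + 2 * (N * ε * (√s * m * N + N * N / s))) := by
  have huvm : ∀ᵐ x, ‖(u - v) x‖ ≤ 2 * m := by
    filter_upwards [hum, hvm] with x h1 h2
    exact (norm_sub_le _ _).trans (by linarith)
  -- Here the near part has no factor ε: u - v is small in L² but only bounded by 2m in L^∞. This
  -- term therefore has its own radius r, to be taken small relative to the radius s of the others.
  obtain ⟨i1, b1⟩ := integrable_coulombIntegrand hA hψ hψ (hu.sub hv) hψ hN hN
    (by positivity : 0 ≤ 2 * m) hε hN hψN hψN huvm huε hψN hr
  obtain ⟨i2, b2⟩ := integrable_coulombIntegrand hA hψ hψ hv (hψ.sub hv) hN hN hm hN hε hψN hψN hvm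
    hvN hψε hs
  obtain ⟨i3, b3⟩ := integrable_coulombIntegrand hA (hψ.sub hv) hψ hv hv hε hN hm hN hN hψε hψN hvm
    hvN hvN hs
  obtain ⟨i4, b4⟩ := integrable_coulombIntegrand hA hv (hψ.sub hv) hv hv hN hε hm hN hN hvN hψε hvm
    hvN hvN hs
  obtain ⟨i5, -⟩ := integrable_coulombIntegrand hA hv hv hv hv hN hN hm hN hN hvN hvN hvm hvN hvN hs
  have e : coulombIntegrand A ψ ψ u ψ = coulombIntegrand A v v v v
      + (coulombIntegrand A ψ ψ (u - v) ψ + coulombIntegrand A ψ ψ v (ψ - v)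
        + coulombIntegrand A (ψ - v) ψ v v + coulombIntegrand A v (ψ - v) v v) := by
    funext p
    simp only [Pi.add_apply]
    rw [← coulombIntegrand_sub_eq]
    ring
  have i6 : Integrable (coulombIntegrand A ψ ψ u ψ) (volume.prod volume) := by
    rw [e]
    exact i5.add (((i1.add i2).add i3).add i4)
  refine ⟨i6, i5, ?_⟩
  have e' : ∫ p, coulombIntegrand A ψ ψ u ψ p ∂(volume.prod volume)
      = ∫ p, coulombIntegrand A v v v v p ∂(volume.prod volume)
        + (∫ p, coulombIntegrand A ψ ψ (u - v) ψ p ∂(volume.prod volume)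
          + ∫ p, coulombIntegrand A ψ ψ v (ψ - v) p ∂(volume.prod volume)
          + ∫ p, coulombIntegrand A (ψ - v) ψ v v p ∂(volume.prod volume)
          + ∫ p, coulombIntegrand A v (ψ - v) v v p ∂(volume.prod volume)) := by
    rw [← integral_add' i1 i2, ← integral_add' (i1.add i2) i3,
      ← integral_add' ((i1.add i2).add i3) i4, ← integral_add' i5 (((i1.add i2).add i3).add i4), ← e]
  rw [e', add_sub_cancel_left]
  refine (norm_add_le _ _).trans ((add_le_add_left (norm_add₃_le) _).trans ?_)
  linarith

lemma integral_norm_sq_le_of_eLpNorm_le {g : Space → Spinor} (hg : MemLp g 2 volume) {ε : ℝ}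
    (hε : 0 ≤ ε) : eLpNorm g 2 volume ≤ ENNReal.ofReal ε ↔ ∫ x, ‖g x‖ ^ 2 ≤ ε ^ 2 := by
  rw [hg.eLpNorm_eq_integral_rpow_norm (by norm_num) (by norm_num)]
  have h0 : 0 ≤ ∫ x, ‖g x‖ ^ 2 := integral_nonneg fun x => sq_nonneg _
  simp only [ENNReal.toReal_ofNat, Real.rpow_two]
  rw [ENNReal.ofReal_le_ofReal_iff hε, ← one_div, ← Real.sqrt_eq_rpow, Real.sqrt_le_left hε]

/-- The Coulomb energy of a charge distribution concentrated in a ball. -/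
theorem coulombI_self_ge (hv : MemLp v 2 volume)
    (hi : Integrable (coulombIntegrand (1 : Spinor →L[ℂ] Spinor) v v v v) (volume.prod volume))
    {ρ κ : ℝ} (hρ : 0 < ρ) (hκ : 0 ≤ κ) (h : κ ≤ ∫ x in {x | bracket x ≤ ρ}, ‖v x‖ ^ 2) :
    κ ^ 2 / (8 * Real.pi * ρ) ≤ (coulombI v v).re := by
  have e : coulombI v v = ∫ p, coulombIntegrand (1 : Spinor →L[ℂ] Spinor) v v v v p
      ∂(volume.prod volume) := by
    have := integral_potentialConv_mul hi
    simp only [one_apply_eq_self] at this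
    exact this
  have e1 : ∀ p, (coulombIntegrand (1 : Spinor →L[ℂ] Spinor) v v v v p).re
      = potential 0 (p.1 - p.2) * (‖v p.2‖ ^ 2 * ‖v p.1‖ ^ 2) := fun p => by
    simp only [coulombIntegrand, one_apply_eq_self, inner_self_eq_norm_sq_to_K]
    norm_cast
    rw [Complex.re_ofReal_mul]
    rfl
  have hre : (coulombI v v).re
      = ∫ p, (coulombIntegrand (1 : Spinor →L[ℂ] Spinor) v v v v p).re ∂(volume.prod volume) := by
    rw [e]; exact (integral_re hi).symm
  set S := {x : Space | bracket x ≤ ρ} with hS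
  have hSm : MeasurableSet S := (isClosed_le continuous_bracket continuous_const).measurableSet
  have hint : Integrable (fun x => ‖v x‖ ^ 2) := hv.integrable_norm_pow (by norm_num)
  -- On the diagonal the formal potential takes the value 0 (division by zero), so the pointwise
  -- lower bound would fail; the diagonal is a null set.
  have hne : ∀ᵐ p : Space × Space ∂(volume.prod volume), p.1 ≠ p.2 := by
    refine (Measure.ae_prod_iff_ae_ae (measurableSet_eq_fun measurable_fst measurable_snd).compl).2
      (ae_of_all _ fun x => ?_)
    have : ∀ᵐ y : Space, y ≠ x := Measure.ae_ne volume x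
    filter_upwards [this] with y hy
    exact hy.symm
  rw [hre]
  have hlow : ∫ p in S ×ˢ S, (8 * Real.pi * ρ)⁻¹ * (‖v p.2‖ ^ 2 * ‖v p.1‖ ^ 2) ∂(volume.prod volume)
      ≤ ∫ p, (coulombIntegrand (1 : Spinor →L[ℂ] Spinor) v v v v p).re ∂(volume.prod volume) := by
    rw [← integral_indicator (hSm.prod hSm)]
    refine integral_mono_ae ?_ hi.re ?_
    · refine ((hint.mul_prod hint).const_mul (8 * Real.pi * ρ)⁻¹).indicator (hSm.prod hSm) |>.congr ?_
      refine ae_of_all _ fun p => ?_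
      simp only [mul_comm]
    · filter_upwards [hne] with p hp
      rw [e1]
      have h0 : 0 ≤ ‖v p.2‖ ^ 2 * ‖v p.1‖ ^ 2 := by positivity
      by_cases hpS : p ∈ S ×ˢ S
      · rw [Set.indicator_of_mem hpS]
        refine mul_le_mul_of_nonneg_right ?_ h0
        rw [potential_zero, ← mul_inv]
        have h1 : 0 < ‖p.1 - p.2‖ := norm_pos_iff.2 (sub_ne_zero.2 hp)
        -- Two points of the ball are at distance at most 2ρ, whence the kernel is at least 1/(8πρ).
        have h2 : ‖p.1 - p.2‖ ≤ 2 * ρ := by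
          have a1 : ‖p.1‖ ≤ ρ := (norm_le_bracket _).trans hpS.1
          have a2 : ‖p.2‖ ≤ ρ := (norm_le_bracket _).trans hpS.2
          exact (norm_sub_le _ _).trans (by linarith)
        refine inv_anti₀ (by positivity) ?_
        nlinarith [Real.pi_pos]
      · rw [Set.indicator_of_notMem hpS]
        exact mul_nonneg (potential_zero_nonneg _) h0
  refine le_trans ?_ hlow
  rw [integral_const_mul, ← Measure.prod_restrict]
  have h3 := integral_prod_mul (μ := volume.restrict S) (ν := volume.restrict S)
    (fun x : Space => ‖v x‖ ^ 2) (fun y : Space => ‖v y‖ ^ 2)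
  simp_rw [mul_comm (‖v (Prod.snd _)‖ ^ 2)]
  rw [h3, div_eq_inv_mul]
  refine mul_le_mul_of_nonneg_left ?_ (by positivity)
  nlinarith

end Energy

/-! ### Concentration of free solutions inside the light cone -/

section Concentration

lemma measurableSet_bracket_le (ρ : ℝ) : MeasurableSet {x : Space | bracket x ≤ ρ} :=
  (isClosed_le continuous_bracket continuous_const).measurableSet

/-- Take a ball carrying all but ε² of the initial charge. Its charge stays inside the ball
expanding at unit speed, and the total charge is constant, so at most ε² lies outside. -/
lemma exists_concentration_of_support {f : L2} {b : ℝ} (hsupp : ∀ᵐ η, b < ‖η‖ → (𝓕 f : L2) η = 0)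
    {ε : ℝ} (hε : 0 < ε) : ∃ R : ℝ, 0 < R ∧ ∀ t, 0 ≤ t →
      eLpNorm ({x | bracket x ≤ R + t}ᶜ.indicator (freeDirac f t)) 2 volume ≤ ENNReal.ofReal ε := by
  have hsol := isDiracSolution_classicalFree hsupp
  have hmon : Monotone fun n : ℕ => {x : Space | bracket x ≤ n} := fun m n hmn x hx =>
    le_trans (show bracket x ≤ m from hx) (by exact_mod_cast hmn)
  have hunion : ⋃ n : ℕ, {x : Space | bracket x ≤ n} = Set.univ :=
    Set.eq_univ_of_forall fun x => Set.mem_iUnion.2 (exists_nat_ge (bracket x))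
  have hlim := tendsto_setIntegral_of_monotone (μ := (volume : Measure Space))
    (f := fun x => ‖freeDirac f 0 x‖ ^ 2) (fun n : ℕ => measurableSet_bracket_le n) hmon
    (integrable_norm_sq (freeDirac f 0)).integrableOn
  rw [hunion, Measure.restrict_univ, ← L2_norm_sq_eq_integral, norm_freeDirac] at hlim
  obtain ⟨n, hn⟩ := (hlim.eventually (lt_mem_nhds (sub_lt_self (‖f‖ ^ 2) (pow_pos hε 2)))).exists
  -- The extra 1 is the width of the transition layer of the cone weight.
  refine ⟨n + 1, by positivity, fun t ht => ?_⟩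
  set S := {x : Space | bracket x ≤ n + 1 + t} with hS
  have hSm : MeasurableSet S := measurableSet_bracket_le _
  have hcone := setIntegral_charge_le hsol ht n
  rw [sub_zero] at hcone
  have e : ∀ s (B : Set Space), ∫ x in B, ‖classicalFree f s x‖ ^ 2
      = ∫ x in B, ‖freeDirac f s x‖ ^ 2 := fun s B => by
    refine integral_congr_ae (ae_restrict_of_ae ?_)
    filter_upwards [freeDirac_ae_eq_classicalFree hsupp s] with x hx
    rw [hx]
  rw [e, e] at hcone
  have hmem : MemLp (Sᶜ.indicator (freeDirac f t)) 2 volume :=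
    (Lp.memLp (freeDirac f t)).indicator hSm.compl
  rw [integral_norm_sq_le_of_eLpNorm_le hmem hε.le]
  have h1 : ∫ x, ‖Sᶜ.indicator (freeDirac f t) x‖ ^ 2 = ∫ x in Sᶜ, ‖freeDirac f t x‖ ^ 2 := by
    rw [← integral_indicator hSm.compl]
    refine integral_congr_ae (ae_of_all _ fun x => ?_)
    by_cases hx : x ∈ Sᶜ
    · simp only [Set.indicator_of_mem hx]
    · simp [Set.indicator_of_notMem hx]
  have h2 := integral_add_compl hSm (integrable_norm_sq (freeDirac f t))
  rw [← L2_norm_sq_eq_integral, norm_freeDirac] at h2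
  rw [h1]
  linarith

lemma eLpNorm_freeDirac_sub (φ χ : L2) (t : ℝ) :
    eLpNorm (fun x => freeDirac φ t x - freeDirac χ t x) 2 volume = ENNReal.ofReal ‖φ - χ‖ := by
  rw [← norm_freeDirac (φ - χ) t, freeDirac_sub, Lp.norm_def, ENNReal.ofReal_toReal
    (Lp.eLpNorm_ne_top _)]
  exact eLpNorm_congr_ae (Lp.coeFn_sub _ _).symm

lemma eLpNorm_freeDirac (φ : L2) (t : ℝ) :
    eLpNorm (freeDirac φ t) 2 volume = ENNReal.ofReal ‖φ‖ := by
  rw [← norm_freeDirac φ t, Lp.norm_def, ENNReal.ofReal_toReal (Lp.eLpNorm_ne_top _)]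

/-- A nonzero free solution keeps a fixed amount of charge in a ball growing with unit speed. -/
theorem exists_charge_lower_bound {φ : L2} (hφ : φ ≠ 0) : ∃ R κ : ℝ, 0 < R ∧ 0 < κ ∧ ∀ t, 0 ≤ t →
    κ ≤ ∫ x in {x | bracket x ≤ R + t}, ‖freeDirac φ t x‖ ^ 2 := by
  have hpos : 0 < ‖φ‖ := norm_pos_iff.2 hφ
  obtain ⟨n, hn⟩ := ((tendsto_iff_norm_sub_tendsto_zero.1 (tendsto_lowPart φ)).eventually
    (gt_mem_nhds (by positivity : 0 < ‖φ‖ / 4))).exists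
  rw [norm_sub_rev] at hn
  obtain ⟨R, hR, h⟩ := exists_concentration_of_support (fourier_lowPart_support n φ)
    (by positivity : 0 < ‖φ‖ / 4)
  -- Truncation and tail each cost at most ‖φ‖/4, so the outside charge is at most ‖φ‖²/4, and 3/4
  -- of the charge stays inside.
  refine ⟨R, ‖φ‖ ^ 2 / 2, hR, by positivity, fun t ht => ?_⟩
  set S := {x : Space | bracket x ≤ R + t} with hS
  have hSm : MeasurableSet S := measurableSet_bracket_le _
  have hmem : MemLp (Sᶜ.indicator (freeDirac φ t)) 2 volume :=
    (Lp.memLp (freeDirac φ t)).indicator hSm.compl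
  have hm1 := (Lp.memLp (freeDirac φ t)).1
  have hm2 := (Lp.memLp (freeDirac (lowPart n φ) t)).1
  have h1 : eLpNorm (Sᶜ.indicator (freeDirac φ t)) 2 volume ≤ ENNReal.ofReal (‖φ‖ / 2) := by
    have e : (Sᶜ.indicator (freeDirac φ t) : Space → Spinor)
        = Sᶜ.indicator (fun x => freeDirac φ t x - freeDirac (lowPart n φ) t x)
          + Sᶜ.indicator (freeDirac (lowPart n φ) t) := by
      rw [← Set.indicator_add']
      congr 1
      funext x
      simp
    rw [e]
    refine (eLpNorm_add_le ((hm1.sub hm2).indicator hSm.compl) (hm2.indicator hSm.compl)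
      (by norm_num)).trans ?_
    refine (add_le_add ((eLpNorm_indicator_le _).trans
      ((eLpNorm_freeDirac_sub _ _ t).le.trans (ENNReal.ofReal_le_ofReal hn.le))) (h t ht)).trans ?_
    rw [← ENNReal.ofReal_add (by positivity) (by positivity)]
    exact ENNReal.ofReal_le_ofReal (by linarith)
  rw [integral_norm_sq_le_of_eLpNorm_le hmem (by positivity)] at h1
  have h3 : ∫ x, ‖Sᶜ.indicator (freeDirac φ t) x‖ ^ 2 = ∫ x in Sᶜ, ‖freeDirac φ t x‖ ^ 2 := by
    rw [← integral_indicator hSm.compl]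
    refine integral_congr_ae (ae_of_all _ fun x => ?_)
    by_cases hx : x ∈ Sᶜ
    · simp only [Set.indicator_of_mem hx]
    · simp [Set.indicator_of_notMem hx]
  have h2 := integral_add_compl hSm (integrable_norm_sq (freeDirac φ t))
  rw [← L2_norm_sq_eq_integral, norm_freeDirac] at h2
  rw [h3] at h1
  nlinarith

end Concentration

/-! ### The nonlinear solution -/

section Nonlinear

/-- The mean-field potential `V₀ * (ψ†βψ)`. -/
def meanField (ψ : ℝ → Space → Spinor) (t : ℝ) (x : Space) : ℝ :=
  ∫ y, potential 0 (x - y) * (inner ℂ (ψ t y) (beta (ψ t y)) : ℂ).re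

lemma potentialConv_eq_meanField (ψ : ℝ → Space → Spinor) (t : ℝ) (x : Space) :
    potentialConv 0 (fun y => inner ℂ (ψ t y) (beta (ψ t y))) x = (meanField ψ t x : ℂ) := by
  unfold meanField
  rw [← potentialConv_ofReal]
  congr 1
  funext y
  exact inner_clm_im_eq_zero inner_beta (ψ t y)

variable {ψ : ℝ → Space → Spinor}

lemma IsSmoothSolution.isDiracSolution (h : IsSmoothSolution 0 ψ) :
    IsDiracSolution (meanField ψ) ψ where
  contDiff := h.smooth.of_le (by norm_cast)
  equation t x := by
    have h1 := h.equation t x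
    simp only [act_gamma_zero_eq_beta] at h1
    rw [potentialConv_eq_meanField] at h1
    -- Multiplication by iβ turns the covariant form into the Hamiltonian form, since β² = 1 and βγʲ
    -- = αʲ.
    have h2 := congrArg (fun w => Complex.I • beta w) h1
    simp only [map_add, map_smul, beta_beta, map_sum, ← alpha_apply, smul_add, smul_smul] at h2
    simp only [mul_neg, Complex.I_mul_I, neg_neg, one_smul] at h2
    rw [← h2]
    abel

/-- The charge of a solution is nondecreasing. -/
lemma IsSmoothSolution.eLpNorm_mono (h : IsSmoothSolution 0 ψ) :
    Monotone fun t => eLpNorm (ψ t) 2 volume := by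
  intro t₀ t₁ ht
  have hint : ∀ t, Integrable fun x => ‖ψ t x‖ ^ 2 := fun t =>
    (h.memLp t).integrable_norm_pow (by norm_num)
  have hmon : Monotone fun n : ℕ => {x : Space | bracket x ≤ n} := fun m n hmn x hx =>
    le_trans (show bracket x ≤ m from hx) (by exact_mod_cast hmn)
  have hunion : ⋃ n : ℕ, {x : Space | bracket x ≤ n} = Set.univ :=
    Set.eq_univ_of_forall fun x => Set.mem_iUnion.2 (exists_nat_ge (bracket x))
  have hlim := tendsto_setIntegral_of_monotone (μ := (volume : Measure Space))
    (f := fun x => ‖ψ t₀ x‖ ^ 2) (fun n : ℕ => measurableSet_bracket_le n) hmon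
    (hint t₀).integrableOn
  rw [hunion, Measure.restrict_univ] at hlim
  -- The expanding-cone inequality with the radius sent to infinity; no decay of ψ beyond L² is
  -- used.
  have hle : ∫ x, ‖ψ t₀ x‖ ^ 2 ≤ ∫ x, ‖ψ t₁ x‖ ^ 2 := by
    refine le_of_tendsto' hlim fun n => (setIntegral_charge_le h.isDiracSolution ht n).trans ?_
    exact setIntegral_le_integral (hint t₁) (ae_of_all _ fun x => sq_nonneg _)
  simp only
  rw [(h.memLp t₀).eLpNorm_eq_integral_rpow_norm (by norm_num) (by norm_num),
    (h.memLp t₁).eLpNorm_eq_integral_rpow_norm (by norm_num) (by norm_num)]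
  simp only [ENNReal.toReal_ofNat, Real.rpow_two]
  exact ENNReal.ofReal_le_ofReal (Real.rpow_le_rpow (integral_nonneg fun x => sq_nonneg _) hle
    (by norm_num))

end Nonlinear

/-! ### A logarithmic growth lemma -/

/-- A bounded function cannot have a derivative of size at least `a / t` for too long. -/
lemma mul_log_le_of_le_abs_deriv {G g : ℝ → ℝ} {a B T T' : ℝ} (ha : 0 < a) (hT : 0 < T) (hTT : T ≤ T')
    (hG : ∀ t ∈ Set.Icc T T', HasDerivAt G (g t) t) (hg : ∀ t ∈ Set.Icc T T', a / t ≤ |g t|)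
    (hB : ∀ t ∈ Set.Icc T T', |G t| ≤ B) : a * (Real.log T' - Real.log T) ≤ 2 * B := by
  wlog hpos : ∀ t ∈ Set.Icc T T', 0 < g t generalizing G g
  · have h := hasDerivWithinAt_forall_lt_or_forall_gt_of_forall_ne (convex_Icc T T')
      (fun t ht => (hG t ht).hasDerivWithinAt) (m := 0) fun t ht h0 => by
        have := hg t ht
        rw [h0, abs_zero] at this
        have : 0 < a / t := div_pos ha (hT.trans_le ht.1)
        linarith
    rcases h with h | h
    · exact this (G := -G) (g := -g) (fun t ht => (hG t ht).neg) (fun t ht => by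
        simpa using hg t ht) (fun t ht => by simpa using hB t ht) fun t ht => by simpa using h t ht
    · exact absurd h hpos
  have hmono : MonotoneOn (fun t => G t - a * Real.log t) (Set.Icc T T') := by
    have hd : ∀ t ∈ Set.Icc T T', HasDerivAt (fun t => G t - a * Real.log t) (g t - a * t⁻¹) t :=
      fun t ht => (hG t ht).sub ((Real.hasDerivAt_log (hT.trans_le ht.1).ne').const_mul a)
    refine monotoneOn_of_deriv_nonneg (convex_Icc T T')
      (fun t ht => (hd t ht).continuousAt.continuousWithinAt)
      (fun t ht => (hd t (interior_subset ht)).differentiableAt.differentiableWithinAt) fun t ht => ?_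
    have ht' := interior_subset ht
    rw [(hd t ht').deriv]
    have := hg t ht'
    rw [abs_of_pos (hpos t ht'), div_eq_mul_inv] at this
    linarith
  have h := hmono (Set.left_mem_Icc.2 hTT) (Set.right_mem_Icc.2 hTT) hTT
  simp only at h
  have h1 := abs_le.1 (hB T (Set.left_mem_Icc.2 hTT))
  have h2 := abs_le.1 (hB T' (Set.right_mem_Icc.2 hTT))
  linarith

/-! ### The localized pairing of the nonlinear solution with a free solution -/

section Pairing

/-- The transition function is constant on either side of [0, 1], so its derivative is bounded by
its maximum there. -/
lemma exists_deriv_smoothTransition_bound : ∃ C : ℝ, 0 ≤ C ∧ ∀ y, |deriv Real.smoothTransition y| ≤ C := by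
  have hc : Continuous (deriv Real.smoothTransition) :=
    (Real.smoothTransition.contDiff (n := 1)).continuous_deriv (by norm_num)
  obtain ⟨C, hC⟩ := (isCompact_Icc (a := (0 : ℝ)) (b := 1)).exists_bound_of_continuousOn hc.continuousOn
  refine ⟨max C 0, le_max_right _ _, fun y => ?_⟩
  rcases lt_or_ge y 0 with h | h
  · have : Real.smoothTransition =ᶠ[𝓝 y] fun _ => 0 := by
      filter_upwards [gt_mem_nhds h] with z hz
      exact Real.smoothTransition.zero_of_nonpos (le_of_lt hz)
    rw [this.deriv_eq]
    simp
  rcases lt_or_ge 1 y with h' | h'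
  · have : Real.smoothTransition =ᶠ[𝓝 y] fun _ => 1 := by
      filter_upwards [lt_mem_nhds h'] with z hz
      exact Real.smoothTransition.one_of_one_le (le_of_lt hz)
    rw [this.deriv_eq]
    simp
  · exact (hC y ⟨h, h'⟩).trans (le_max_left _ _)

/-- A smooth cutoff: `1` for `⟨x⟩ ≤ L` and `0` for `⟨x⟩ ≥ 2L`. -/
def spatialCutoff (L : ℝ) (x : Space) : ℝ := Real.smoothTransition (2 - L⁻¹ * bracket x)

lemma contDiff_spatialCutoff (L : ℝ) : ContDiff ℝ 1 (spatialCutoff L) :=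
  Real.smoothTransition.contDiff.comp (contDiff_const.sub (contDiff_const.mul contDiff_bracket))

lemma spatialCutoff_nonneg (L : ℝ) (x : Space) : 0 ≤ spatialCutoff L x := Real.smoothTransition.nonneg _

lemma spatialCutoff_le_one (L : ℝ) (x : Space) : spatialCutoff L x ≤ 1 := Real.smoothTransition.le_one _

lemma spatialCutoff_eq_one {L : ℝ} (hL : 0 < L) {x : Space} (hx : bracket x ≤ L) :
    spatialCutoff L x = 1 := by
  refine Real.smoothTransition.one_of_one_le ?_
  have : L⁻¹ * bracket x ≤ 1 := by rw [inv_mul_le_iff₀ hL]; linarith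
  linarith

lemma spatialCutoff_eq_zero {L : ℝ} (hL : 0 < L) {x : Space} (hx : 2 * L ≤ ‖x‖) :
    spatialCutoff L x = 0 := by
  refine Real.smoothTransition.zero_of_nonpos ?_
  have : 2 ≤ L⁻¹ * bracket x := by
    rw [le_inv_mul_iff₀ hL]
    linarith [norm_le_bracket x]
  linarith

lemma abs_fderiv_spatialCutoff_le {C L : ℝ} (hL : 0 < L)
    (hC : ∀ y, |deriv Real.smoothTransition y| ≤ C) (x : Space) (j : Fin 3) :
    |fderiv ℝ (spatialCutoff L) x (EuclideanSpace.single j 1)| ≤ C / L := by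
  have h1 : HasFDerivAt (fun x => 2 - L⁻¹ * bracket x) (-(L⁻¹ • fderiv ℝ bracket x)) x :=
    (((contDiff_bracket.differentiable (by norm_num) x).hasFDerivAt).const_mul L⁻¹).const_sub 2
  have hst : DifferentiableAt ℝ Real.smoothTransition (2 - L⁻¹ * bracket x) :=
    (Real.smoothTransition.contDiff (n := 1)).differentiable (by norm_num) _
  have h2 : HasFDerivAt (spatialCutoff L) _ x := hst.hasDerivAt.hasFDerivAt.comp x h1
  rw [h2.fderiv]
  have h3 : |inner ℝ x (EuclideanSpace.single j (1 : ℝ)) / bracket x| ≤ 1 := by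
    rw [abs_div, abs_of_pos (bracket_pos x), div_le_one (bracket_pos x)]
    refine (abs_real_inner_le_norm _ _).trans ?_
    simpa using norm_le_bracket x
  have h4 := hC (2 - L⁻¹ * bracket x)
  have hC0 : 0 ≤ C := (abs_nonneg _).trans h4
  have e : ((ContinuousLinearMap.toSpanSingleton ℝ
      (deriv Real.smoothTransition (2 - L⁻¹ * bracket x))).comp (-(L⁻¹ • fderiv ℝ bracket x)))
        (EuclideanSpace.single j 1)
      = -(deriv Real.smoothTransition (2 - L⁻¹ * bracket x) * L⁻¹
        * (inner ℝ x (EuclideanSpace.single j (1 : ℝ)) / bracket x)) := by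
    simp only [ContinuousLinearMap.comp_apply, neg_apply, smul_apply, fderiv_bracket,
      ContinuousLinearMap.toSpanSingleton_apply, smul_eq_mul]
    ring
  refine (congrArg abs e).le.trans ?_
  rw [abs_neg, abs_mul, abs_mul, abs_of_pos (inv_pos.2 hL), div_eq_mul_inv C L]
  have h5 : 0 < L⁻¹ := inv_pos.2 hL
  calc _ ≤ C * L⁻¹ * 1 := by gcongr
    _ = _ := mul_one _

lemma integral_norm_mul_norm_le {f g : Space → Spinor} (hf : MemLp f 2 volume) (hg : MemLp g 2 volume)
    {a b : ℝ} (ha : 0 ≤ a) (hb : 0 ≤ b) (hfa : eLpNorm f 2 volume ≤ ENNReal.ofReal a)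
    (hgb : eLpNorm g 2 volume ≤ ENNReal.ofReal b) :
    Integrable (fun x => ‖f x‖ * ‖g x‖) ∧ ∫ x, ‖f x‖ * ‖g x‖ ≤ a * b := by
  have hi : Integrable (fun x => ‖f x‖ * ‖g x‖) := hf.norm.integrable_mul hg.norm
  refine ⟨hi, ?_⟩
  have h0 : ∀ x, 0 ≤ ‖f x‖ * ‖g x‖ := fun x => by positivity
  rw [← ENNReal.ofReal_le_ofReal_iff (by positivity),
    ofReal_integral_eq_lintegral_ofReal hi (ae_of_all _ h0)]
  refine le_trans (le_of_eq (lintegral_congr fun x => ?_))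
    ((lintegral_mul_le_eLpNorm hf.1 hg.1).trans ((mul_le_mul' hfa hgb).trans_eq
      (ENNReal.ofReal_mul ha).symm))
  rw [ENNReal.ofReal_mul (norm_nonneg _), ofReal_norm, ofReal_norm]

lemma norm_alpha (j : Fin 3) (v : Spinor) : ‖alpha j v‖ = ‖v‖ := by
  rw [← diracOp_single, norm_diracOp_zero_right]
  simp

variable {u ψ : ℝ → Space → Spinor}

/-- The localized pairing. -/
def localPairing (L : ℝ) (u ψ : ℝ → Space → Spinor) (t : ℝ) : ℝ :=
  (∫ x, (spatialCutoff L x : ℂ) * inner ℂ (u t x) (ψ t x)).im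

lemma abs_localPairing_le {L t N : ℝ} (hu : MemLp (u t) 2 volume) (hψ : MemLp (ψ t) 2 volume)
    (hN : 0 ≤ N) (huN : eLpNorm (u t) 2 volume ≤ ENNReal.ofReal N)
    (hψN : eLpNorm (ψ t) 2 volume ≤ ENNReal.ofReal N) : |localPairing L u ψ t| ≤ N * N := by
  obtain ⟨hi, hle⟩ := integral_norm_mul_norm_le hu hψ hN hN huN hψN
  refine (Complex.abs_im_le_norm _).trans ((norm_integral_le_of_norm_le hi (ae_of_all _ fun x => ?_)).trans
    hle)
  rw [norm_mul, Complex.norm_real, Real.norm_of_nonneg (spatialCutoff_nonneg L x)]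
  exact (mul_le_of_le_one_left (norm_nonneg _) (spatialCutoff_le_one L x)).trans
    (norm_inner_le_norm _ _)

/-- The derivative of the localized pairing is the Coulomb energy of the two densities, up to an
error of size `1 / L`. -/
theorem exists_hasDerivAt_localPairing (hu : IsDiracSolution (fun _ _ => 0) u)
    (hψ : IsDiracSolution (meanField ψ) ψ) {L t N C : ℝ} (hL : 0 < L) (hN : 0 ≤ N)
    (hC : ∀ y, |deriv Real.smoothTransition y| ≤ C)
    (hu2 : MemLp (u t) 2 volume) (hψ2 : MemLp (ψ t) 2 volume)
    (huN : eLpNorm (u t) 2 volume ≤ ENNReal.ofReal N)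
    (hψN : eLpNorm (ψ t) 2 volume ≤ ENNReal.ofReal N)
    (hi : Integrable (coulombIntegrand beta (ψ t) (ψ t)
      (fun x => (spatialCutoff L x : ℂ) • u t x) (ψ t)) (volume.prod volume)) :
    ∃ g, HasDerivAt (localPairing L u ψ) g t ∧
      |g - (∫ p, coulombIntegrand beta (ψ t) (ψ t) (fun x => (spatialCutoff L x : ℂ) • u t x) (ψ t) p
        ∂(volume.prod volume)).re| ≤ 3 * C / L * (N * N) := by
  have hw : ContDiff ℝ 1 (fun p : ℝ × Space => (fun _ => spatialCutoff L : ℝ → Space → ℝ) p.1 p.2) :=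
    (contDiff_spatialCutoff L).comp contDiff_snd
  have hs : LocallyBoundedSupport (fun _ => spatialCutoff L : ℝ → Space → ℝ) := fun T =>
    ⟨2 * L, fun t _ x hx => spatialCutoff_eq_zero hL hx.le⟩
  obtain ⟨hint, hD⟩ := hasDerivAt_weighted_inner hu hψ hw hs t
  obtain ⟨hnn, hle⟩ := integral_norm_mul_norm_le hu2 hψ2 hN hN huN hψN
  have hC0 : 0 ≤ C := (abs_nonneg _).trans (hC 0)
  set X : Space → ℂ := fun x => ∑ j, ((fderiv ℝ (spatialCutoff L) x (EuclideanSpace.single j 1) : ℝ) : ℂ)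
    * inner ℂ (u t x) (alpha j (ψ t x)) with hX
  set Y : Space → ℂ := fun x => (meanField ψ t x : ℂ)
    * inner ℂ ((spatialCutoff L x : ℂ) • u t x) (beta (ψ t x)) with hY
  have hslice : ∀ {u : ℝ → Space → Spinor}, ContDiff ℝ 1 (fun p : ℝ × Space => u p.1 p.2) →
      Continuous (u t) := fun h =>
    h.continuous.comp (by fun_prop : Continuous fun x : Space => (t, x))
  have hXc : Continuous X := by
    refine continuous_finsetSum _ fun j _ => ?_
    refine Continuous.mul (Complex.continuous_ofReal.comp
      (((contDiff_spatialCutoff L).continuous_fderiv (by norm_num)).clm_apply continuous_const)) ?_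
    exact (hslice hu.contDiff).inner ((alpha j).continuous.comp (hslice hψ.contDiff))
  have hXle : ∀ x, ‖X x‖ ≤ 3 * C / L * (‖u t x‖ * ‖ψ t x‖) := fun x => by
    have hj : ∀ j ∈ (Finset.univ : Finset (Fin 3)),
        ‖((fderiv ℝ (spatialCutoff L) x (EuclideanSpace.single j 1) : ℝ) : ℂ)
          * inner ℂ (u t x) (alpha j (ψ t x))‖ ≤ C / L * (‖u t x‖ * ‖ψ t x‖) := fun j _ => by
      rw [norm_mul, Complex.norm_real]
      refine mul_le_mul (abs_fderiv_spatialCutoff_le hL hC x j) ?_ (norm_nonneg _) (by positivity)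
      rw [← norm_alpha j (ψ t x)]
      exact norm_inner_le_norm _ _
    refine (norm_sum_le_of_le _ hj).trans (le_of_eq ?_)
    simp
    ring
  have hXi : Integrable X := (hnn.const_mul (3 * C / L)).mono' hXc.aestronglyMeasurable (ae_of_all _ hXle)
  have e : ∀ x, ((deriv (fun s => (fun _ => spatialCutoff L : ℝ → Space → ℝ) s x) t : ℝ) : ℂ)
        * inner ℂ (u t x) (ψ t x)
        + ∑ j, ((fderiv ℝ ((fun _ => spatialCutoff L : ℝ → Space → ℝ) t) x
          (EuclideanSpace.single j 1) : ℝ) : ℂ) * inner ℂ (u t x) (alpha j (ψ t x))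
        + ((fun _ => spatialCutoff L : ℝ → Space → ℝ) t x : ℂ) * (Complex.I
          * ((meanField ψ t x - (fun _ _ => 0 : ℝ → Space → ℝ) t x : ℝ) : ℂ)
            * inner ℂ (u t x) (beta (ψ t x))) = X x + Complex.I * Y x := fun x => by
    -- The cutoff does not depend on time and u has zero potential, so only the gradient error X and
    -- the interaction iY remain; taking imaginary parts turns iY into Re Y.
    simp only [hX, hY, deriv_const, sub_zero, inner_smul_left, Complex.conj_ofReal, Complex.ofReal_zero]
    ring
  simp_rw [e] at hD hint
  have hYi : Integrable (fun x => Complex.I * Y x) := by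
    simpa [Pi.sub_def] using hint.sub hXi
  rw [integral_add hXi hYi, integral_const_mul] at hD
  have hYF : ∫ x, Y x = ∫ p, coulombIntegrand beta (ψ t) (ψ t)
      (fun x => (spatialCutoff L x : ℂ) • u t x) (ψ t) p ∂(volume.prod volume) := by
    rw [← integral_potentialConv_mul hi]
    simp only [potentialConv_eq_meanField, hY]
  refine ⟨_, Complex.imCLM.hasFDerivAt.comp_hasDerivAt t hD, ?_⟩
  rw [hYF]
  simp only [Complex.imCLM_apply, Complex.add_im, Complex.I_mul_im, add_sub_cancel_right]
  refine (Complex.abs_im_le_norm _).trans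
    ((norm_integral_le_of_norm_le (hnn.const_mul (3 * C / L)) (ae_of_all _ hXle)).trans ?_)
  rw [integral_const_mul]
  exact mul_le_mul_of_nonneg_left hle (by positivity)

end Pairing

/-! ### Absence of scattering -/

section Scattering

lemma exists_pos_mul_le {P c : ℝ} (hP : 0 ≤ P) (hc : 0 < c) : ∃ q : ℝ, 0 < q ∧ q ≤ 1 ∧ P * q ≤ c := by
  refine ⟨min 1 (c / (P + 1)), by positivity, min_le_left _ _, ?_⟩
  calc P * min 1 (c / (P + 1)) ≤ P * (c / (P + 1)) := by gcongr; exact min_le_right _ _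
    _ ≤ (P + 1) * (c / (P + 1)) := by gcongr; linarith
    _ = c := by field_simp

/-- For suitable `δ` and all sufficiently small `ε`, the stability bound is at most `c / t`. -/
lemma exists_stability_parameters {N M c : ℝ} (hN : 0 ≤ N) (hM : 0 ≤ M) (hc : 0 < c) :
    ∃ δ ε : ℝ, 0 < δ ∧ 0 < ε ∧ ε ≤ 1 ∧ ∀ t, 0 < t →
      coulombConst * (N * N * (√(δ * t) * (2 * (M / (t * √t))) * N + ε * N / (δ * t))
        + N * N * (√t * (M / (t * √t)) * ε + N * ε / t)
        + 2 * (N * ε * (√t * (M / (t * √t)) * N + N * N / t))) ≤ c / t := by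
  have hK := coulombConst_pos
  -- The order matters: q controls the one term without a factor ε, and ε is chosen afterwards
  -- because its coefficient contains N³/q².
  obtain ⟨q, hq, -, hq1⟩ := exists_pos_mul_le (P := coulombConst * (2 * N ^ 3 * M)) (by positivity)
    (half_pos hc)
  obtain ⟨ε, hε, hε1, hε2⟩ := exists_pos_mul_le
    (P := coulombConst * (N ^ 3 / q ^ 2 + N ^ 2 * M + N ^ 3 + 2 * N * (M * N + N ^ 2)))
    (by positivity) (half_pos hc)
  -- With δ = q², √(δt) · M/(t√t) = qM/t, so every term scales exactly like 1/t.
  refine ⟨q ^ 2, ε, by positivity, hε, hε1, fun t ht => ?_⟩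
  have hst : 0 < √t := Real.sqrt_pos.2 ht
  have e : coulombConst * (N * N * (√(q ^ 2 * t) * (2 * (M / (t * √t))) * N + ε * N / (q ^ 2 * t))
        + N * N * (√t * (M / (t * √t)) * ε + N * ε / t)
        + 2 * (N * ε * (√t * (M / (t * √t)) * N + N * N / t)))
      = (coulombConst * (2 * N ^ 3 * M) * q
        + coulombConst * (N ^ 3 / q ^ 2 + N ^ 2 * M + N ^ 3 + 2 * N * (M * N + N ^ 2)) * ε) / t := by
    rw [Real.sqrt_mul (by positivity), Real.sqrt_sq hq.le]
    field_simp
    ring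
  rw [e]
  gcongr
  linarith

/-- The localized cutoff of a function concentrated in a ball. -/
lemma eLpNorm_cutoff_sub_le {u v : Space → Spinor} (hu : AEStronglyMeasurable u volume)
    (hv : AEStronglyMeasurable v volume) {ρ L ε : ℝ} (hL : 0 < L) (hρ : ρ ≤ L) (hε : 0 ≤ ε)
    (h1 : eLpNorm ({x | bracket x ≤ ρ}ᶜ.indicator u) 2 volume ≤ ENNReal.ofReal (ε / 2))
    (h2 : eLpNorm (u - v) 2 volume ≤ ENNReal.ofReal (ε / 2)) :
    eLpNorm ((fun x => (spatialCutoff L x : ℂ) • u x) - v) 2 volume ≤ ENNReal.ofReal ε := by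
  set w : Space → Spinor := fun x => (spatialCutoff L x : ℂ) • u x with hw
  have hwm : AEStronglyMeasurable w volume :=
    (Complex.continuous_ofReal.comp (contDiff_spatialCutoff L).continuous).aestronglyMeasurable.smul hu
  have h3 : eLpNorm (w - u) 2 volume ≤ ENNReal.ofReal (ε / 2) := by
    refine le_trans (eLpNorm_mono fun x => ?_) h1
    by_cases hxS : bracket x ≤ ρ
    · simp [hw, spatialCutoff_eq_one hL (hxS.trans hρ)]
    · rw [Set.indicator_of_mem (show x ∈ {x | bracket x ≤ ρ}ᶜ from hxS)]
      have : (w - u) x = ((spatialCutoff L x - 1 : ℝ) : ℂ) • u x := by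
        simp [hw, sub_smul]
      rw [this, norm_smul, Complex.norm_real, Real.norm_eq_abs]
      refine mul_le_of_le_one_left (norm_nonneg _) (abs_le.2 ⟨?_, ?_⟩)
      · linarith [spatialCutoff_nonneg L x]
      · linarith [spatialCutoff_le_one L x]
  have h4 := eLpNorm_add_le (hwm.sub hu) (hu.sub hv) (p := 2) (by norm_num)
  rw [sub_add_sub_cancel] at h4
  refine h4.trans ((add_le_add h3 h2).trans ?_)
  rw [← ENNReal.ofReal_add (by positivity) (by positivity), add_halves]

/-- At a time `t` at which `ψ` and `u` are close to `v`, the pairing of `u` and `ψ` grows or decays at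
a rate comparable to `1 / t`. -/
lemma exists_deriv_localPairing_ge {u ψ : ℝ → Space → Spinor} {v : Space → Spinor}
    (hu : IsDiracSolution (fun _ _ => 0) u) (hψ : IsDiracSolution (meanField ψ) ψ)
    {a c κ C L M N R δ ε t : ℝ} (ht : 1 ≤ t) (hc0 : 0 ≤ c)
    (hκ : 0 ≤ κ) (hL : 0 < L) (hM : 0 ≤ M) (hN : 0 ≤ N) (hR : 0 < R) (hδ : 0 < δ) (hε : 0 ≤ ε)
    (ha : a = c * (κ ^ 2 / (8 * Real.pi * (R + 1))))
    (hC : ∀ y, |deriv Real.smoothTransition y| ≤ C)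
    (hstab : coulombConst * (N * N * (√(δ * t) * (2 * (M / (t * √t))) * N + ε * N / (δ * t))
        + N * N * (√t * (M / (t * √t)) * ε + N * ε / t)
        + 2 * (N * ε * (√t * (M / (t * √t)) * N + N * N / t))) ≤ a / 4 / t)
    (hLerr : 3 * C / L * (N * N) ≤ a / 4 / t)
    (hu2 : MemLp (u t) 2 volume) (hψ2 : MemLp (ψ t) 2 volume) (hv2 : MemLp v 2 volume)
    (huN : eLpNorm (u t) 2 volume ≤ ENNReal.ofReal N)
    (hψN : eLpNorm (ψ t) 2 volume ≤ ENNReal.ofReal N)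
    (hvN : eLpNorm v 2 volume ≤ ENNReal.ofReal N)
    (huε : eLpNorm ((fun x => (spatialCutoff L x : ℂ) • u t x) - v) 2 volume ≤ ENNReal.ofReal ε)
    (hψε : eLpNorm (ψ t - v) 2 volume ≤ ENNReal.ofReal ε)
    (hud : ∀ᵐ x, ‖u t x‖ ≤ M / (t * √t)) (hvd : ∀ᵐ x, ‖v x‖ ≤ M / (t * √t))
    (hcharge : κ ≤ ∫ x in {x | bracket x ≤ R + t}, ‖v x‖ ^ 2)
    (hcond : c * (coulombI v v).re ≤ ‖coulombI v (fun x => beta (v x))‖) :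
    ∃ g, HasDerivAt (localPairing L u ψ) g t ∧ a / 2 / t ≤ |g| := by
  have ht0 : 0 < t := by linarith
  set w : Space → Spinor := fun x => (spatialCutoff L x : ℂ) • u t x with hw
  have hwm : AEStronglyMeasurable w volume :=
    (Complex.continuous_ofReal.comp (contDiff_spatialCutoff L).continuous).aestronglyMeasurable.smul
      hu2.1
  have hwd : ∀ᵐ x, ‖w x‖ ≤ M / (t * √t) := by
    filter_upwards [hud] with x h1
    simp only [hw]
    rw [norm_smul, Complex.norm_real, Real.norm_of_nonneg (spatialCutoff_nonneg L x)]
    exact (mul_le_of_le_one_left (norm_nonneg _) (spatialCutoff_le_one L x)).trans h1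
  obtain ⟨hi, hiv, hdiff⟩ := norm_coulomb_sub_le (A := beta) (fun v => (norm_beta v).le) hψ2.1
    hwm hv2.1 hN (by positivity) hε (mul_pos hδ ht0) ht0 hψN hvN huε hψε hwd hvd
  obtain ⟨g, hg, hgle⟩ := exists_hasDerivAt_localPairing hu hψ hL hN hC hu2 hψ2 huN hψN hi
  refine ⟨g, hg, ?_⟩
  have hdiff' := hdiff.trans hstab
  obtain ⟨hi1, -⟩ := integrable_coulombIntegrand (A := (1 : Spinor →L[ℂ] Spinor)) (fun v => le_rfl)
    hv2.1 hv2.1 hv2.1 hv2.1 hN hN (by positivity) hN hN hvN hvN hvd hvN hvN ht0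
  have hlow := coulombI_self_ge hv2 hi1 (by positivity : 0 < R + t) hκ hcharge
  have hJ : coulombI v (fun x => beta (v x))
      = ∫ p, coulombIntegrand beta v v v v p ∂(volume.prod volume) := integral_potentialConv_mul hiv
  have hJre := integral_coulombIntegrand_im (a := v) (c := v) inner_beta
  set J := ∫ p, (coulombIntegrand beta v v v v p).re ∂(volume.prod volume) with hJdef
  have hJlow : a / t ≤ |J| := by
    rw [hJ, hJre, Complex.norm_real, Real.norm_eq_abs] at hcond
    refine le_trans ?_ ((mul_le_mul_of_nonneg_left hlow hc0).trans hcond)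
    rw [ha, mul_div_assoc, div_div]
    refine mul_le_mul_of_nonneg_left ?_ hc0
    refine div_le_div_of_nonneg_left (by positivity) (by positivity) ?_
    -- Uses t ≥ 1; this replaces 1/(R + t) by a multiple of 1/t.
    have h2 : R + t ≤ (R + 1) * t := by nlinarith
    rw [mul_assoc (8 * Real.pi)]
    exact mul_le_mul_of_nonneg_left h2 (by positivity)
  rw [hJre] at hdiff'
  have h3 := (Complex.abs_re_le_norm _).trans hdiff'
  rw [Complex.sub_re, Complex.ofReal_re] at h3
  have h5 := hgle.trans hLerr
  have h7 := abs_sub_abs_le_abs_sub J g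
  have h8 := abs_sub_le g (∫ p, coulombIntegrand beta (ψ t) (ψ t) w (ψ t) p
    ∂(volume.prod volume)).re J
  rw [abs_sub_comm J g] at h7
  -- One quarter of the main term pays for the stability error, another for the cutoff error.
  have h9 : a / t = a / 2 / t + (a / 4 / t + a / 4 / t) := by ring
  linarith

/-- The contradiction argument. For nonzero φ the localized pairing is bounded by N² on [T, T'], yet
its derivative has modulus at least a/(2t) there. -/
theorem eq_zero_of_scattering
    (ψ : ℝ → Space → Spinor) (hψ : IsSmoothSolution 0 ψ) (φ : L2)
    (hφ_pos : besovNorm (5 / 2) (diracProj 1 φ) < ⊤)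
    (hφ_neg : besovNorm (5 / 2) (diracProj (-1) φ) < ⊤)
    (hscatter : Tendsto (fun t : ℝ => eLpNorm (fun x => ψ t x - freeDirac φ t x) 2 volume)
      atTop (𝓝 0))
    (c : ℝ) (hc0 : 0 < c) (tstar : ℝ)
    (hcond : ∀ t : ℝ, tstar < t → c * (coulombI (freeDirac φ t) (freeDirac φ t)).re
      ≤ ‖coulombI (freeDirac φ t) (fun x => beta (freeDirac φ t x))‖) : φ = 0 := by
  by_contra hφ
  obtain ⟨M, hM, hdisp⟩ := exists_dispersive_bound φ hφ_pos hφ_neg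
  obtain ⟨R₁, κ, hR₁, hκ, hcharge⟩ := exists_charge_lower_bound hφ
  obtain ⟨C, hC0, hC⟩ := exists_deriv_smoothTransition_bound
  -- A common L² bound for u, v and, for t ≥ T, also ψ, because ε ≤ 1.
  set N := ‖φ‖ + 1 with hN
  have hN0 : 0 < N := by positivity
  set a := c * (κ ^ 2 / (8 * Real.pi * (R₁ + 1))) with ha
  have ha0 : 0 < a := by positivity
  obtain ⟨δ, ε, hδ, hε, hε1, hstab⟩ := exists_stability_parameters hN0.le hM.le
    (by positivity : 0 < a / 4)
  obtain ⟨n, hn⟩ := ((tendsto_iff_norm_sub_tendsto_zero.1 (tendsto_lowPart φ)).eventually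
    (gt_mem_nhds (half_pos hε))).exists
  set f := lowPart n φ with hf
  have hsupp := fourier_lowPart_support n φ
  obtain ⟨R, hR, hconc⟩ := exists_concentration_of_support hsupp (half_pos hε)
  set u := classicalFree f with hu
  have huf := fun t => freeDirac_ae_eq_classicalFree hsupp t
  have husol := isDiracSolution_classicalFree hsupp
  have hu2 : ∀ t, MemLp (u t) 2 volume := fun t => (Lp.memLp (freeDirac f t)).ae_eq (huf t)
  have huN : ∀ t, eLpNorm (u t) 2 volume ≤ ENNReal.ofReal N := fun t => by
    rw [← eLpNorm_congr_ae (huf t), eLpNorm_freeDirac]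
    exact ENNReal.ofReal_le_ofReal ((norm_lowPart_le n φ).trans (by linarith))
  have hvN : ∀ t, eLpNorm (freeDirac φ t) 2 volume ≤ ENNReal.ofReal N := fun t => by
    rw [eLpNorm_freeDirac]
    exact ENNReal.ofReal_le_ofReal (by linarith)
  have hvm : ∀ t, AEStronglyMeasurable (freeDirac φ t) volume := fun t => (Lp.memLp _).1
  obtain ⟨T₀, hT₀⟩ := eventually_atTop.1 (hscatter.eventually
    (gt_mem_nhds (ENNReal.ofReal_pos.2 hε)))
  set T := max T₀ (max (tstar + 1) 1) with hT
  have hTT₀ : T₀ ≤ T := le_max_left _ _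
  have hTt : tstar + 1 ≤ T := (le_max_left _ _).trans (le_max_right _ _)
  have hT1 : 1 ≤ T := (le_max_right _ _).trans (le_max_right _ _)
  have hψε : ∀ t, T ≤ t → eLpNorm (ψ t - (freeDirac φ t : Space → Spinor)) 2 volume ≤ ENNReal.ofReal ε := fun t ht =>
    (hT₀ t (hTT₀.trans ht)).le
  have hψN : ∀ t, T ≤ t → eLpNorm (ψ t) 2 volume ≤ ENNReal.ofReal N := fun t ht => by
    have h1 := eLpNorm_add_le ((hψ.memLp t).1.sub (hvm t)) (hvm t) (p := 2) (by norm_num)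
    rw [sub_add_cancel] at h1
    refine h1.trans ((add_le_add (hψε t ht) (eLpNorm_freeDirac φ t).le).trans ?_)
    rw [← ENNReal.ofReal_add hε.le (norm_nonneg _)]
    exact ENNReal.ofReal_le_ofReal (by linarith)
  -- Chosen so that (a/2) log(T'/T) = 2N² + a/2, which exceeds twice the bound on the pairing.
  set T' := T * Real.exp (2 * (N * N) / (a / 2) + 1) with hT'
  have hTT' : T ≤ T' := le_mul_of_one_le_right (by linarith) (Real.one_le_exp (by positivity))
  -- R + T' keeps the concentration ball inside the region where the cutoff is 1, for all t ≤ T'.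
  -- The last summand makes the cutoff error at most a/(4T').
  set L := R + T' + 12 * C * (N * N) * T' / a with hL
  have hT'0 : 0 < T' := by linarith
  have hL0 : 0 < L := by positivity
  have hLerr : 3 * C / L * (N * N) ≤ a / 4 / T' := by
    rw [div_mul_eq_mul_div, div_le_div_iff₀ hL0 hT'0]
    have : a / 4 * L = a / 4 * (R + T') + 3 * C * (N * N) * T' := by
      rw [hL]; field_simp; ring
    rw [this]
    have : 0 ≤ a / 4 * (R + T') := by positivity
    linarith
  have key : ∀ t ∈ Set.Icc T T', ∃ g, HasDerivAt (localPairing L u ψ) g t ∧ a / 2 / t ≤ |g| := by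
    intro t ht
    have ht0 : 0 < t := by linarith [ht.1]
    have hut := huf t
    have hudisp : ∀ᵐ x, ‖u t x‖ ≤ M / (t * √t) := by
      filter_upwards [(hdisp t ht0).2 n, hut] with x h1 h2
      rwa [h2] at h1
    have hρ : R + t ≤ L := by
      have : 0 ≤ 12 * C * (N * N) * T' / a := by positivity
      linarith [ht.2]
    have hin : eLpNorm ({x | bracket x ≤ R + t}ᶜ.indicator (u t)) 2 volume
        ≤ ENNReal.ofReal (ε / 2) := by
      refine le_trans (eLpNorm_congr_ae ?_).le (hconc t ht0.le)
      filter_upwards [hut] with x hx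
      simp only [Set.indicator, hx, hu, hf]
    have hsub : eLpNorm (u t - (freeDirac φ t : Space → Spinor)) 2 volume
        ≤ ENNReal.ofReal (ε / 2) := by
      refine (le_of_eq (eLpNorm_congr_ae ?_)).trans
        ((eLpNorm_freeDirac_sub f φ t).le.trans (ENNReal.ofReal_le_ofReal hn.le))
      filter_upwards [hut] with x hx
      rw [Pi.sub_apply, hx]
    have hclose := eLpNorm_cutoff_sub_le (hu2 t).1 (hvm t) hL0 hρ hε.le hin hsub
    have hLt : a / 4 / T' ≤ a / 4 / t := div_le_div_of_nonneg_left (by positivity) ht0 ht.2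
    exact exists_deriv_localPairing_ge (v := (freeDirac φ t : Space → Spinor)) husol hψ.isDiracSolution
      (hT1.trans ht.1) hc0.le hκ.le hL0 hM.le hN0.le hR₁ hδ hε.le ha hC (hstab t ht0)
      (hLerr.trans hLt) (hu2 t) (hψ.memLp t) (Lp.memLp (freeDirac φ t)) (huN t) (hψN t ht.1) (hvN t)
      hclose (hψε t ht.1) hudisp (hdisp t ht0).1 (hcharge t ht0.le)
      (hcond t (by linarith [ht.1]))
  choose! g hg1 hg2 using key
  have hfin := mul_log_le_of_le_abs_deriv (half_pos ha0) (by linarith : 0 < T) hTT' hg1 hg2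
    (B := N * N) fun t ht => abs_localPairing_le (hu2 t) (hψ.memLp t) hN0.le (huN t) (hψN t ht.1)
  have hlog : Real.log T' = Real.log T + (2 * (N * N) / (a / 2) + 1) := by
    rw [hT', Real.log_mul (by linarith) (Real.exp_pos _).ne', Real.log_exp]
  rw [hlog, add_sub_cancel_left, mul_add, mul_div_cancel₀ _ (half_pos ha0).ne'] at hfin
  linarith

end Scattering

end DiracHartree

end

/-! ### Conclusion: both the free solution and the nonlinear solution vanish. -/

theorem theorem1p2
    (ψ : ℝ → DiracHartree.Space → DiracHartree.Spinor)
    (hψ : DiracHartree.IsSmoothSolution 0 ψ)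
    (φ : DiracHartree.L2)
    (hφ_pos : DiracHartree.besovNorm (5 / 2) (DiracHartree.diracProj 1 φ) < ⊤)
    (hφ_neg : DiracHartree.besovNorm (5 / 2) (DiracHartree.diracProj (-1) φ) < ⊤)
    (hscatter : Tendsto
      (fun t : ℝ => eLpNorm (fun x => ψ t x - DiracHartree.freeDirac φ t x) 2 volume)
      atTop (𝓝 0))
    (c : ℝ) (hc0 : 0 < c) (hc1 : c < 1) (tstar : ℝ) (htstar : 0 < tstar)
    (hcond : ∀ t : ℝ, tstar < t →
      c * (DiracHartree.coulombI (DiracHartree.freeDirac φ t) (DiracHartree.freeDirac φ t)).re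
        ≤ ‖DiracHartree.coulombI (DiracHartree.freeDirac φ t)
            (fun x => DiracHartree.beta (DiracHartree.freeDirac φ t x))‖) :
    (∀ t : ℝ, ψ t =ᵐ[volume] 0) ∧ (∀ t : ℝ, DiracHartree.freeDirac φ t = 0) := by
  have hφ : φ = 0 :=
    DiracHartree.eq_zero_of_scattering ψ hψ φ hφ_pos hφ_neg hscatter c hc0 tstar hcond
  have hfree : ∀ t : ℝ, DiracHartree.freeDirac φ t = 0 := fun t =>
    norm_eq_zero.1 (by rw [DiracHartree.norm_freeDirac, hφ, norm_zero])
  refine ⟨fun t => ?_, hfree⟩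
  have hlim : Tendsto (fun t : ℝ => eLpNorm (ψ t) 2 volume) atTop (𝓝 0) := by
    refine hscatter.congr fun s => eLpNorm_congr_ae ?_
    filter_upwards [Lp.coeFn_zero DiracHartree.Spinor 2 (volume : Measure DiracHartree.Space)]
      with x hx
    rw [hfree s, hx, Pi.zero_apply, sub_zero]
  -- A nondecreasing charge with limit zero at infinity is at most zero at every earlier time.
  have h0 : eLpNorm (ψ t) 2 volume ≤ 0 :=
    ge_of_tendsto hlim ((eventually_ge_atTop t).mono fun s hs => hψ.eLpNorm_mono hs)
  exact (eLpNorm_eq_zero_iff (hψ.memLp t).1 (by norm_num)).1 (le_antisymm h0 zero_le)
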